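/- Let $d\in\mathbb N$. Let $C_{xy}=C_{yx}\in[0,\infty)$ ($x,y\in\mathbb Z^d$, $C_{xx}=0$) be conductances satisfying, with $|\cdot|$ the Euclidean norm and $\nu_x=\sum_y C_{xy}$: (A1) $c_1\le \nu_x\le c_2$ for all $x\in\mathbb Z^d$, where $c_1,c_2>0$. (A2) $M_0\ge1$, $\delta>0$, and for all $x,y\in\mathbb Z^d$ with $|x-y|=1$ there are $N\ge2$ and $z_1,\dots,z_N\in\mathbb Z^d$ with $|z_i-x|<M_0$, $z_1=x$, $z_N=y$ and $C_{z_iz_{i+1}}\ge\delta$ for $1\le i<N$. (A3) $\varphi:\mathbb N\to[0,\infty)$ is nonincreasing, $\sum_{i\ge1} i^{d+1}\varphi(i)<\infty$, $\varphi(2i)\le K\varphi(i)$ for all $i$ and some constant $K$, and $C_{xy}\le\varphi(\lfloor|x-y|\rfloor)$ for all $x,y$. Let $Y$ be the continuous time Markov chain on $\mathbb Z^d$ which waits at each visited point $x$ for an independent exponential time with parameter $\nu_x$ and then jumps to $y$ with probability $C_{xy}/\nu_x$. For $D\ge1$ let $\mathcal S=D^{-1}\mathbb Z^d$, $V_t=D^{-1}Y_{D^2t}$,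 $\mu^D(A)=D^{-d}|A|$ for $A\subset\mathcal S$, and let $p^D(t,x,y)=\mathbb P^x(V_t=y)/\mu^D(\{y\})$ be the transition density of $V$ with respect to $\mu^D$. Under $\mathbb P^{(t,x)}$ let $Z_s=(t+s,V_s)$ with $V_0=x$. A nonnegative Borel function $q$ on $[0,\infty)\times\mathcal S$ is called parabolic in a relatively open set $B\subset[0,\infty)\times\mathcal S$ if for every open $B_1$ whose closure is compact and contained in $B$, and every $(t,x)\in B_1$, $q(t,x)=\mathbb E^{(t,x)}[q(Z_{\tau_{B_1}})]$, where $\tau_{B_1}=\inf\{s>0: Z_s\notin B_1\}$. Fix $\gamma\in(0,1)$, and for $t\ge 0$, $x\in\mathcal S$, $r>0$ put $Q^D(t,x,r)=[t,t+\gamma r^2]\times\{y\in\mathcal S:|x-y|\le r\}$. Theorem. There are constants $c,\beta>0$, depending only on $d,\gamma,c_1,c_2,M_0,\delta,\varphi$ (in particular independent of $R$, $D$, $x_0$), such that for every such family of conductances and every $D\ge1$ the following hold. (i) For every $R>0$, every $x_0\in\mathcal S$ and every $q$ that is parabolic in the interior of $Q^D(0,x_0,4R)$ relative to $[0,\infty)\times\mathcal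 S$ and bounded on $[0,\gamma(4R)^2]\times\mathcal S$, $$|q(s,x)-q(t,y)|\le c\,\|q\|_{\infty,R}\,R^{-\beta}\big(|t-s|^{1/2}+|x-y|\big)^\beta\qquad\text{for all }(s,x),(t,y)\in Q^D(0,x_0,R),$$ where $\|q\|_{\infty,R}=\sup_{[0,\gamma(4R)^2]\times\mathcal S}|q|$. (ii) For every $0<t_0<1$, all $s,t\in[t_0,\infty)$ and all $x_1,x_2,y_1,y_2\in\mathcal S$, $$|p^D(s,x_1,y_1)-p^D(t,x_2,y_2)|\le c\,t_0^{-(d+\beta)/2}\big(|t-s|^{1/2}+|x_1-x_2|+|y_1-y_2|\big)^\beta.$$ -/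

import Mathlib

open MeasureTheory ProbabilityTheory Set
open scoped NNReal ENNReal

namespace SymChain

/-- Points of `ℤ^d`. -/
abbrev Lattice (d : ℕ) : Type := Fin d → ℤ

/-- The inclusion of `ℤ^d` in Euclidean space `ℝ^d`. -/
def toE {d : ℕ} (k : Lattice d) : EuclideanSpace ℝ (Fin d) :=
  WithLp.toLp 2 (fun i => (k i : ℝ))

/-- The Euclidean distance `|x - y|` of two points of `ℤ^d`. -/
noncomputable def edist2 {d : ℕ} (x y : Lattice d) : ℝ := dist (toE x) (toE y)

/-- A family of conductances `C_{xy} ∈ [0, ∞)`, symmetric, with no conductance from a point to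
itself. The last two fields say that `ν_x = ∑_y C_{xy}` is finite and positive at every `x`, so that
the transition probabilities `C_{xy} / ν_x` make sense; both are part of `A1` below. -/
structure Conductances (d : ℕ) where
  C : Lattice d → Lattice d → ℝ≥0
  symm : ∀ x y, C x y = C y x
  diag : ∀ x, C x x = 0
  summable : ∀ x, Summable (C x)
  pos : ∀ x, 0 < ∑' y, C x y

namespace Conductances

variable {d : ℕ} (G : Conductances d)

/-- `ν_x = ∑_y C_{xy}`. -/
noncomputable def nu (x : Lattice d) : ℝ≥0 := ∑' y, G.C x y

/-- Uniform bounds on `ν_x`. -/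
def A1 (c₁ c₂ : ℝ) : Prop :=
  0 < c₁ ∧ 0 < c₂ ∧ ∀ x, c₁ ≤ (G.nu x : ℝ) ∧ (G.nu x : ℝ) ≤ c₂

/-- Uniform local irreducibility: nearest neighbours `x`, `y` are joined by a chain
`x = z_1, …, z_N = y` in the open ball `B(x, M₀)` whose steps have conductance at least `δ`. -/
def A2 (M₀ δ : ℝ) : Prop :=
  1 ≤ M₀ ∧ 0 < δ ∧ ∀ x y : Lattice d, edist2 x y = 1 →
    ∃ N : ℕ, 2 ≤ N ∧ ∃ z : ℕ → Lattice d, z 1 = x ∧ z N = y ∧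
      (∀ i, 1 ≤ i → i ≤ N → edist2 x (z i) < M₀) ∧
      (∀ i, 1 ≤ i → i < N → δ ≤ (G.C (z i) (z (i + 1)) : ℝ))

/-- Uniform second moment condition. Since `φ` is a function on `ℕ` while the Euclidean distance
need not be an integer, `φ(|x - y|)` is read as `φ(⌊|x - y|⌋)`; as `φ` is decreasing this is the
weakest reading. -/
def A3 (φ : ℕ → ℝ) : Prop :=
  Antitone φ ∧ (∀ i, 0 ≤ φ i) ∧ Summable (fun i : ℕ => (i : ℝ) ^ (d + 1) * φ i) ∧
    (∃ K : ℝ, ∀ i, φ (2 * i) ≤ K * φ i) ∧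
    ∀ x y, (G.C x y : ℝ) ≤ φ ⌊edist2 x y⌋₊

lemma tsum_coe (x : Lattice d) : ∑' y, (G.C x y : ℝ≥0∞) = (G.nu x : ℝ≥0∞) :=
  (ENNReal.coe_tsum (G.summable x)).symm

/-- The one-step law of the discrete time chain from `x`: mass `C_{xy} / ν_x` at `y`. -/
noncomputable def stepPMF (x : Lattice d) : PMF (Lattice d) :=
  PMF.normalize (fun y => (G.C x y : ℝ≥0∞))
    (by rw [G.tsum_coe]; exact_mod_cast (G.pos x).ne')
    (by rw [G.tsum_coe]; exact ENNReal.coe_ne_top)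

/-- The one-step transition kernel of the discrete time chain `X`. -/
noncomputable def stepKernel : Kernel (Lattice d) (Lattice d) :=
  Kernel.ofFunOfCountable (fun x => (G.stepPMF x).toMeasure)

instance : IsMarkovKernel G.stepKernel :=
  ⟨fun x => inferInstanceAs (IsProbabilityMeasure (G.stepPMF x).toMeasure)⟩

/-- The transition from the history `(X_0, …, X_n)` to `X_{n+1}`, which uses only `X_n`. -/
noncomputable def historyKernel (n : ℕ) :
    Kernel ((i : Finset.Iic n) → (fun _ : ℕ => Lattice d) i) (Lattice d) :=
  G.stepKernel.comap (fun h => h ⟨n, Finset.mem_Iic.2 le_rfl⟩) (measurable_pi_apply _)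

instance (n : ℕ) : IsMarkovKernel (G.historyKernel n) := by
  unfold historyKernel; infer_instance

/-- The law of the discrete time chain `(X_n)` with `X_0 = x`. -/
noncomputable def chainLaw (x : Lattice d) : Measure (ℕ → Lattice d) :=
  Kernel.traj (X := fun _ : ℕ => Lattice d) G.historyKernel 0 (fun _ => x)

/-- Sample space: a path of the discrete chain, and a clock for each pair `(n, z)`. -/
abbrev Omega (d : ℕ) : Type := (ℕ → Lattice d) × (ℕ × Lattice d → ℝ)

/-- `ℙ^x`: the chain `X` starts at `x`, and independently of it the clocks `U_{n+1}^z` (stored at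
index `(n, z)`) are independent exponential random variables with parameter `ν_z`. -/
noncomputable def law (x : Lattice d) : Measure (Omega d) :=
  (G.chainLaw x).prod (Measure.infinitePi (fun i : ℕ × Lattice d => expMeasure (G.nu i.2 : ℝ)))

end Conductances

open Conductances (Omega)

/-- `T_n = ∑_{k=1}^n U_k^{X_{k-1}}`, the time of the `n`-th jump. -/
noncomputable def jumpTime {d : ℕ} (ω : Omega d) (n : ℕ) : ℝ :=
  ∑ k ∈ Finset.range n, ω.2 (k, ω.1 k)

open Classical in
/-- The continuous time chain: `Y_t = X_n` if `T_n ≤ t < T_{n+1}`. (The default value is only used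
on a null set of `ω`.) -/
noncomputable def Y {d : ℕ} (t : ℝ) (ω : Omega d) : Lattice d :=
  if h : ∃ n, jumpTime ω n ≤ t ∧ t < jumpTime ω (n + 1) then ω.1 (Nat.find h) else ω.1 0

/-- `𝒮 = D⁻¹ ℤ^d`, with the distance, topology and Borel sets it has as a subset of `ℝ^d`. -/
abbrev S (d : ℕ) (D : ℝ) : Type :=
  ↥(Set.range (fun k : Lattice d => D⁻¹ • toE k) : Set (EuclideanSpace ℝ (Fin d)))

/-- `k ↦ D⁻¹ k` from `ℤ^d` to `𝒮`. -/
noncomputable def scale {d : ℕ} (D : ℝ) (k : Lattice d) : S d D := ⟨D⁻¹ • toE k, k, rfl⟩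

/-- `x ↦ D x` from `𝒮` to `ℤ^d`. -/
noncomputable def unscale {d : ℕ} {D : ℝ} (x : S d D) : Lattice d := fun i => round (D * x.1 i)

lemma unscale_scale {d : ℕ} {D : ℝ} (hD : D ≠ 0) (k : Lattice d) : unscale (scale D k) = k := by
  funext i
  simp [unscale, scale, toE, hD]

lemma scale_unscale {d : ℕ} {D : ℝ} (hD : D ≠ 0) (x : S d D) : scale D (unscale x) = x := by
  obtain ⟨_, k, rfl⟩ := x
  exact congrArg (scale D) (unscale_scale hD k)

/-- `μ^D(A) = D^{-d} |A|` on `𝒮`. -/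
noncomputable def muD (d : ℕ) (D : ℝ) : Measure (S d D) :=
  ENNReal.ofReal ((D ^ d)⁻¹) • Measure.count

/-- The rescaled process `V_t = D⁻¹ Y_{D² t}`. -/
noncomputable def V {d : ℕ} (D : ℝ) (t : ℝ≥0) (ω : Omega d) : S d D := scale D (Y (D ^ 2 * t) ω)

/-- The law `ℙ^x` under which `V_0 = x ∈ 𝒮`. -/
noncomputable def lawV {d : ℕ} (G : Conductances d) {D : ℝ} (x : S d D) : Measure (Omega d) :=
  G.law (unscale x)

/-- The transition density `p^D(t, x, y)` of `V` with respect to `μ^D`. -/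
noncomputable def heatKernel {d : ℕ} (G : Conductances d) (D : ℝ) (t : ℝ≥0) (x y : S d D) : ℝ :=
  (lawV G x).real {ω | V D t ω = y} / (muD d D).real {y}

/-- The space-time process `Z_s = (t + s, V_s)` started at time coordinate `t`. -/
noncomputable def Z {d : ℕ} (D : ℝ) (t s : ℝ≥0) (ω : Omega d) : ℝ≥0 × S d D := (t + s, V D s ω)

/-- `τ_B = inf {s > 0 : Z_s ∉ B}` for the space-time process started at time coordinate `t`. -/
noncomputable def exitTime {d : ℕ} {D : ℝ} (B : Set (ℝ≥0 × S d D)) (t : ℝ≥0) (ω : Omega d) : ℝ≥0 :=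
  sInf {s : ℝ≥0 | 0 < s ∧ Z D t s ω ∉ B}

/-- `q` is parabolic in the (relatively open) subset `B` of `[0, ∞) × 𝒮`: it is nonnegative and Borel
measurable, and `q(t, x) = 𝔼^{(t, x)} [q(Z_{τ_{B₁}})]` for all `(t, x) ∈ B₁`, for every open `B₁` whose
closure is compact and contained in `B`. -/
def IsParabolic {d : ℕ} {D : ℝ} (G : Conductances d) (q : ℝ≥0 × S d D → ℝ)
    (B : Set (ℝ≥0 × S d D)) : Prop :=
  (∀ z, 0 ≤ q z) ∧ Measurable q ∧
    ∀ B₁ : Set (ℝ≥0 × S d D), IsOpen B₁ → IsCompact (closure B₁) → closure B₁ ⊆ B →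
      ∀ z ∈ B₁,
        Integrable (fun ω => q (Z D z.1 (exitTime B₁ z.1 ω) ω)) (lawV G z.2) ∧
        q z = ∫ ω, q (Z D z.1 (exitTime B₁ z.1 ω) ω) ∂(lawV G z.2)

/-- The cylinder `Q^D(t, x, r) = [t, t + γ r²] × (B(x, r) ∩ 𝒮)`, `B(x, r)` being the closed ball. -/
def Q {d : ℕ} {D : ℝ} (γ : ℝ) (t : ℝ≥0) (x : S d D) (r : ℝ) : Set (ℝ≥0 × S d D) :=
  {z | t ≤ z.1 ∧ (z.1 : ℝ) ≤ t + γ * r ^ 2 ∧ dist z.2 x ≤ r}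

/-- The slab `[0, γ (4R)²] × 𝒮`. -/
def slab {d : ℕ} {D : ℝ} (γ R : ℝ) : Set (ℝ≥0 × S d D) :=
  {z | (z.1 : ℝ) ≤ γ * (4 * R) ^ 2}

/-- `‖q‖_{∞,R} = sup |q|` over `[0, γ (4R)²] × 𝒮`. -/
noncomputable def supNorm {d : ℕ} {D : ℝ} (γ R : ℝ) (q : ℝ≥0 × S d D → ℝ) : ℝ :=
  sSup ((fun z => |q z|) '' slab γ R)

end SymChain

/-!
Both estimates come from one interior Hölder estimate, `exists_holder`, for bounded solutions of
`∂ₜ u = L u` on `ℤ^d` in parabolic cylinders of the lattice, where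
`L f (x) = ∑_y C_{xy} (f y - f x)`. Its constants depend only on the dimension, on a bound for
`∑_y C_{xy} (1 + |x - y|²)` and on the comparison of the nearest neighbour energy with the energy
of `C`; these are collected in `Elliptic`, and `exists_elliptic` derives them from `A1`, `A2`, `A3`.

The Hölder estimate is proved by the method of De Giorgi. All sets are boxes for the sup norm, and
the energies are compared with the nearest neighbour energy, for which Poincaré and Nash
inequalities hold on boxes. The jumps have unbounded range, so every truncation has to control the
tail of the solution far away: the solutions are allowed to grow quadratically away from the
cylinder, and the second moment of `C` absorbs this growth. The steps are `exists_deGiorgi` (small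
mean square implies a pointwise bound), `exists_growth` (a nonnegative solution which is large on
half of a time slice is bounded below at later times; this uses the logarithm of the solution, whose
energy is bounded a priori) and the resulting decay of oscillation, iterated over all scales down to
the lattice spacing, below which the equation at a single point gives the modulus of continuity in
time.

The probabilistic input is the decomposition of `ℙ^x` at the first jump,
`Conductances.lintegral_first_step`. For the heat kernel, it gives the backward equation in
integrated form, hence a classical solution of the heat equation (`Conductances.transition_sol`).
The symmetry of the transition probabilities follows by comparing the decompositions at the first
and at the last jump. A solution of mass at most one decays like `t^{-d/2}` (`exists_onDiagonal`, by
halving the supremum repeatedly with `exists_deGiorgi`), and the Hölder estimate on a cylinder of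
size `√t` gives the second part of the theorem.

For a parabolic function `q`, the open sets `[0, b) × {x}` are admissible because `𝒮` is discrete,
and the mean value property over them is a Duhamel formula for `q` with time reversed
(`IsParabolic.duhamel`). Outside the cylinder `q` is only measurable in time, so `q` itself need not
be differentiable; its Steklov averages are classical solutions (`abs_sub_le_of_duhamel`), and they
converge to `q` inside the cylinder.
-/


namespace SymChain

/-! ### Boxes in the lattice, Poincaré and Nash inequalities -/

/-- The box `{x : ‖x - z‖ ≤ r}` of the lattice; `‖·‖` is the sup norm. -/
noncomputable def box {d : ℕ} (z : Lattice d) (r : ℝ) : Finset (Lattice d) :=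
  Finset.Icc (fun i => z i - ⌊r⌋) (fun i => z i + ⌊r⌋)

lemma mem_box {d : ℕ} {z x : Lattice d} {r : ℝ} (hr : 0 ≤ r) : x ∈ box z r ↔ ‖x - z‖ ≤ r := by
  rw [pi_norm_le_iff_of_nonneg hr, box, Finset.mem_Icc, Pi.le_def, Pi.le_def, ← forall_and]
  refine forall_congr' fun i => ?_
  rw [Pi.sub_apply, Int.norm_eq_abs, abs_le]
  constructor
  · rintro ⟨h1, h2⟩
    have h3 : x i - z i ≤ ⌊r⌋ := by omega
    have h4 : -(x i - z i) ≤ ⌊r⌋ := by omega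
    have h5 := Int.le_floor.1 h3
    have h6 := Int.le_floor.1 h4
    push_cast at h5 h6 ⊢
    constructor <;> linarith
  · rintro ⟨h1, h2⟩
    have h3 : x i - z i ≤ ⌊r⌋ := Int.le_floor.2 h2
    have h4 : -(x i - z i) ≤ ⌊r⌋ := Int.le_floor.2 (by push_cast at h1 ⊢; linarith)
    constructor <;> omega

lemma card_box {d : ℕ} (z : Lattice d) {r : ℝ} (hr : 0 ≤ r) :
    ((box z r).card : ℝ) = (2 * (⌊r⌋ : ℝ) + 1) ^ d := by
  rw [box, Pi.card_Icc]
  simp only [Int.card_Icc]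
  have h0 : 0 ≤ ⌊r⌋ := Int.floor_nonneg.2 hr
  have : ∀ i, (((z i + ⌊r⌋ + 1 - (z i - ⌊r⌋)).toNat : ℕ) : ℝ) = 2 * (⌊r⌋ : ℝ) + 1 := by
    intro i
    have h1 : z i + ⌊r⌋ + 1 - (z i - ⌊r⌋) = 2 * ⌊r⌋ + 1 := by ring
    rw [h1, ← Int.cast_natCast, Int.toNat_of_nonneg (by omega)]
    push_cast; ring
  push_cast
  rw [Finset.prod_congr rfl (fun i _ => this i)]
  simp

lemma card_box_le {d : ℕ} (z : Lattice d) {r : ℝ} (hr : 0 ≤ r) :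
    ((box z r).card : ℝ) ≤ (2 * r + 1) ^ d := by
  rw [card_box z hr]
  have h0 : (0 : ℝ) ≤ ⌊r⌋ := by exact_mod_cast Int.floor_nonneg.2 hr
  have := Int.floor_le r
  gcongr

lemma le_card_box {d : ℕ} (z : Lattice d) {r : ℝ} (hr : 0 ≤ r) :
    r ^ d ≤ ((box z r).card : ℝ) := by
  rw [card_box z hr]
  have h0 : (0 : ℝ) ≤ ⌊r⌋ := by exact_mod_cast Int.floor_nonneg.2 hr
  have := Int.lt_floor_add_one r
  gcongr
  linarith

lemma box_subset_box {d : ℕ} (z : Lattice d) {r s : ℝ} (hr : 0 ≤ r) (h : r ≤ s) :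
    box z r ⊆ box z s := fun _ hx =>
  (mem_box (hr.trans h)).2 (((mem_box hr).1 hx).trans h)

/-- The sum of `(f x - f y)²` over the nearest neighbour pairs of `A`. -/
noncomputable def edgeEnergy {d : ℕ} (A : Finset (Lattice d)) (f : Lattice d → ℝ) : ℝ :=
  ∑ i, ∑ x ∈ A with x + Pi.single i 1 ∈ A, (f (x + Pi.single i 1) - f x) ^ 2

lemma edgeEnergy_nonneg {d : ℕ} (A : Finset (Lattice d)) (f : Lattice d → ℝ) :
    0 ≤ edgeEnergy A f :=
  Finset.sum_nonneg fun _ _ => Finset.sum_nonneg fun _ _ => sq_nonneg _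

lemma sum_translate_le {d : ℕ} (S T : Finset (Lattice d)) (c : Lattice d) (g : Lattice d → ℝ)
    (hg : ∀ x, 0 ≤ g x) (h : ∀ x ∈ S, x + c ∈ T) : ∑ x ∈ S, g (x + c) ≤ ∑ x ∈ T, g x := by
  have h1 : ∑ x ∈ S, g (x + c) = ∑ z ∈ S.image (· + c), g z := by
    rw [Finset.sum_image]
    intro x _ y _ hxy
    exact add_right_cancel hxy
  rw [h1]
  refine Finset.sum_le_sum_of_subset_of_nonneg ?_ fun _ _ _ => hg _
  intro z hz
  obtain ⟨x, hx, rfl⟩ := Finset.mem_image.1 hz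
  exact h x hx

lemma edge_le_edgeEnergy {d : ℕ} (A : Finset (Lattice d)) (f : Lattice d → ℝ) (i : Fin d) :
    ∑ x ∈ A with x + Pi.single i 1 ∈ A, (f (x + Pi.single i 1) - f x) ^ 2 ≤ edgeEnergy A f := by
  unfold edgeEnergy
  generalize hg : (fun i => ∑ x ∈ A with x + Pi.single i 1 ∈ A,
    (f (x + Pi.single i 1) - f x) ^ 2) = g
  have h0 : ∀ j, 0 ≤ g j := fun j => by
    rw [← hg]; exact Finset.sum_nonneg fun _ _ => sq_nonneg _
  have := Finset.single_le_sum (fun j _ => h0 j) (Finset.mem_univ i)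
  subst hg
  exact this

lemma sum_natAbs_le {d : ℕ} {h : Lattice d} {r : ℝ} (hh : ‖h‖ ≤ r) :
    ((∑ i, (h i).natAbs : ℕ) : ℝ) ≤ d * r := by
  push_cast
  calc ∑ i, (((h i).natAbs : ℕ) : ℝ) ≤ ∑ i : Fin d, r := by
        refine Finset.sum_le_sum fun i _ => ?_
        have := (norm_le_pi_norm h i).trans hh
        rwa [Int.norm_eq_abs, ← Int.cast_abs, Int.abs_eq_natAbs, Int.cast_natCast] at this
    _ = d * r := by simp

lemma sum_add_sq_le {ι : Type*} (S : Finset ι) (A B : ι → ℝ) {n E : ℝ} (hn : 0 ≤ n) (hE : 0 ≤ E)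
    (hA : ∑ x ∈ S, A x ^ 2 ≤ E) (hB : ∑ x ∈ S, B x ^ 2 ≤ n ^ 2 * E) :
    ∑ x ∈ S, (A x + B x) ^ 2 ≤ (n + 1) ^ 2 * E := by
  have h1 := Finset.sum_mul_sq_le_sq_mul_sq S A B
  have h2 : (∑ x ∈ S, A x * B x) ^ 2 ≤ (n * E) ^ 2 := by
    refine h1.trans ?_
    calc _ ≤ E * (n ^ 2 * E) := by
          apply mul_le_mul hA hB (Finset.sum_nonneg fun _ _ => sq_nonneg _) hE
      _ = _ := by ring
  have h3 := (le_abs_self _).trans (abs_le_of_sq_le_sq h2 (by positivity))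
  have h4 : ∑ x ∈ S, (A x + B x) ^ 2
      = ∑ x ∈ S, A x ^ 2 + 2 * ∑ x ∈ S, A x * B x + ∑ x ∈ S, B x ^ 2 := by
    rw [Finset.mul_sum, ← Finset.sum_add_distrib, ← Finset.sum_add_distrib]
    exact Finset.sum_congr rfl fun _ _ => by ring
  rw [h4]
  nlinarith

/-- A lattice path from `0` to `h` that changes each coordinate monotonically stays, translated by
`x`, in any order interval containing `x` and `x + h`; this bounds the increments of `f` by `h`. -/
lemma sum_increment_sq_le {d : ℕ} (a b : Lattice d) (f : Lattice d → ℝ) (n : ℕ) :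
    ∀ h : Lattice d, ∑ i, (h i).natAbs = n →
      ∑ x ∈ Finset.Icc a b with x + h ∈ Finset.Icc a b, (f (x + h) - f x) ^ 2 ≤
        (n : ℝ) ^ 2 * edgeEnergy (Finset.Icc a b) f := by
  have hE := edgeEnergy_nonneg (Finset.Icc a b) f
  induction n with
  | zero =>
    intro h hh
    have : h = 0 := by
      funext i
      have := (Finset.sum_eq_zero_iff.1 hh) i (Finset.mem_univ i)
      simpa using this
    subst this
    simp
  | succ n ih =>
    intro h hh
    obtain ⟨i, hi⟩ : ∃ i, h i ≠ 0 := by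
      by_contra! hc
      simp [hc] at hh
    set h' : Lattice d := h - Pi.single i (h i).sign with hh'
    have hself : h' i = h i - (h i).sign := by simp [hh']
    have hne : ∀ j, j ≠ i → h' j = h j := fun j hj => by simp [hh', Pi.single_eq_of_ne hj]
    have hsum : ∑ i, (h' i).natAbs = n := by
      rw [← Finset.add_sum_erase _ _ (Finset.mem_univ i)] at hh ⊢
      rw [Finset.sum_congr rfl (fun j hj => by rw [hne j (Finset.ne_of_mem_erase hj)]), hself]
      have : (h i - (h i).sign).natAbs + 1 = (h i).natAbs := by
        rcases lt_or_gt_of_ne hi with h0 | h0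
        · rw [Int.sign_eq_neg_one_of_neg h0]; omega
        · rw [Int.sign_eq_one_of_pos h0]; omega
      omega
    have hbtw : ∀ x ∈ Finset.Icc a b, x + h ∈ Finset.Icc a b → x + h' ∈ Finset.Icc a b := by
      intro x hx hxh
      rw [Finset.mem_Icc, Pi.le_def, Pi.le_def, ← forall_and] at hx hxh ⊢
      intro j
      have hxj := hx j
      have hxhj := hxh j
      simp only [Pi.add_apply] at hxj hxhj ⊢
      by_cases hj : j = i
      · subst hj
        rw [hself]
        rcases lt_or_gt_of_ne hi with h0 | h0
        · rw [Int.sign_eq_neg_one_of_neg h0]; omega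
        · rw [Int.sign_eq_one_of_pos h0]; omega
      · rw [hne j hj]; exact hxhj
    have hB : ∑ x ∈ Finset.Icc a b with x + h ∈ Finset.Icc a b, (f (x + h') - f x) ^ 2 ≤
        (n : ℝ) ^ 2 * edgeEnergy (Finset.Icc a b) f := by
      refine le_trans (Finset.sum_le_sum_of_subset_of_nonneg ?_ fun x _ _ => sq_nonneg _)
        (ih h' hsum)
      intro x hx
      rw [Finset.mem_filter] at hx ⊢
      exact ⟨hx.1, hbtw x hx.1 hx.2⟩
    have hA : ∑ x ∈ Finset.Icc a b with x + h ∈ Finset.Icc a b, (f (x + h) - f (x + h')) ^ 2 ≤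
        edgeEnergy (Finset.Icc a b) f := by
      refine le_trans ?_ (edge_le_edgeEnergy _ f i)
      rcases lt_or_gt_of_ne hi with h0 | h0
      · have he : h' = h + Pi.single i 1 := by
          rw [hh', Int.sign_eq_neg_one_of_neg h0, Pi.single_neg, sub_neg_eq_add]
        refine le_trans (le_of_eq ?_) (sum_translate_le
          {x ∈ Finset.Icc a b | x + h ∈ Finset.Icc a b} _ h
          (fun z => (f (z + Pi.single i 1) - f z) ^ 2) (fun _ => sq_nonneg _) ?_)
        · refine Finset.sum_congr rfl fun x _ => ?_
          rw [he, add_assoc]; ring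
        · intro x hx
          rw [Finset.mem_filter] at hx ⊢
          refine ⟨hx.2, ?_⟩
          rw [add_assoc, ← he]
          exact hbtw x hx.1 hx.2
      · have he : h = h' + Pi.single i 1 := by
          rw [hh', Int.sign_eq_one_of_pos h0, sub_add_cancel]
        refine le_trans (le_of_eq ?_) (sum_translate_le
          {x ∈ Finset.Icc a b | x + h ∈ Finset.Icc a b} _ h'
          (fun z => (f (z + Pi.single i 1) - f z) ^ 2) (fun _ => sq_nonneg _) ?_)
        · refine Finset.sum_congr rfl fun x _ => ?_
          rw [add_assoc, ← he]
        · intro x hx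
          rw [Finset.mem_filter] at hx ⊢
          refine ⟨hbtw x hx.1 hx.2, ?_⟩
          rw [add_assoc, ← he]
          exact hx.2
    have := sum_add_sq_le _ _ _ (Nat.cast_nonneg n) hE hA hB
    simpa using this

/-- Poincaré inequality on a box. -/
lemma poincare_box {d : ℕ} (z : Lattice d) {r : ℝ} (hr : 0 ≤ r) (f : Lattice d → ℝ) :
    ∑ x ∈ box z r, ∑ y ∈ box z r, (f x - f y) ^ 2 ≤
      (4 * r + 1) ^ d * ((2 * d * r) ^ 2 * edgeEnergy (box z r) f) := by
  have hE := edgeEnergy_nonneg (box z r) f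
  have h1 : ∀ x ∈ box z r, ∑ y ∈ box z r, (f x - f y) ^ 2 ≤
      ∑ h ∈ box (0 : Lattice d) (2 * r), if x + h ∈ box z r then (f (x + h) - f x) ^ 2 else 0 := by
    intro x hx
    rw [← Finset.sum_filter]
    have := sum_translate_le (box z r) {h ∈ box (0 : Lattice d) (2 * r) | x + h ∈ box z r} (-x)
      (fun h => (f (x + h) - f x) ^ 2) (fun _ => sq_nonneg _) ?_
    · refine le_trans (le_of_eq ?_) this
      refine Finset.sum_congr rfl fun y _ => ?_
      rw [add_neg_cancel_comm_assoc]; ring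
    · intro y hy
      rw [Finset.mem_filter, add_neg_cancel_comm_assoc]
      refine ⟨?_, hy⟩
      rw [mem_box (by positivity)]
      rw [mem_box hr] at hx hy
      have : y + -x - 0 = (y - z) - (x - z) := by abel
      rw [this]
      exact (norm_sub_le _ _).trans (by linarith)
  calc _ ≤ ∑ x ∈ box z r, ∑ h ∈ box (0 : Lattice d) (2 * r),
          if x + h ∈ box z r then (f (x + h) - f x) ^ 2 else 0 := Finset.sum_le_sum h1
    _ = ∑ h ∈ box (0 : Lattice d) (2 * r), ∑ x ∈ box z r with x + h ∈ box z r,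
          (f (x + h) - f x) ^ 2 := by
        rw [Finset.sum_comm]
        exact Finset.sum_congr rfl fun _ _ => (Finset.sum_filter _ _).symm
    _ ≤ ∑ h ∈ box (0 : Lattice d) (2 * r), (2 * d * r) ^ 2 * edgeEnergy (box z r) f := by
        refine Finset.sum_le_sum fun h hh => (sum_increment_sq_le _ _ f _ h rfl).trans ?_
        refine mul_le_mul_of_nonneg_right ?_ hE
        gcongr
        rw [mem_box (by positivity), sub_zero] at hh
        refine (sum_natAbs_le hh).trans (le_of_eq (by ring))
    _ = (box (0 : Lattice d) (2 * r)).card * ((2 * d * r) ^ 2 * edgeEnergy (box z r) f) := by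
        rw [Finset.sum_const, nsmul_eq_mul]
    _ ≤ _ := by
        refine mul_le_mul_of_nonneg_right ?_ (by positivity)
        have := card_box_le (0 : Lattice d) (r := 2 * r) (by positivity)
        refine this.trans (le_of_eq (by ring))

/-- A function vanishing on `Z` is controlled by its gradient if `Z` is a large part of the box. -/
lemma poincare_zero_set {d : ℕ} (z : Lattice d) {r : ℝ} (hr : 0 ≤ r) (f : Lattice d → ℝ)
    (Z : Finset (Lattice d)) (hZ : Z ⊆ box z r) (h0 : ∀ x ∈ Z, f x = 0) :
    Z.card * ∑ x ∈ box z r, f x ^ 2 ≤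
      (4 * r + 1) ^ d * ((2 * d * r) ^ 2 * edgeEnergy (box z r) f) := by
  refine le_trans ?_ (poincare_box z hr f)
  rw [Finset.mul_sum]
  refine Finset.sum_le_sum fun x _ => ?_
  calc (Z.card : ℝ) * f x ^ 2 = ∑ y ∈ Z, (f x - f y) ^ 2 := by
        rw [Finset.sum_congr rfl (fun y hy => by rw [h0 y hy, sub_zero]), Finset.sum_const,
          nsmul_eq_mul]
    _ ≤ _ := Finset.sum_le_sum_of_subset_of_nonneg hZ fun _ _ _ => sq_nonneg _

/-- Nash inequality in linear form: compare `f` with its averages over boxes of side `s`. -/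
lemma nash_edge {d : ℕ} (z : Lattice d) {r s : ℝ} (hr : 0 ≤ r) (hs : 0 < s) (f : Lattice d → ℝ)
    (hf : ∀ x, x ∉ box z r → f x = 0) :
    ∑ x ∈ box z r, f x ^ 2 ≤ 2 * (d * s) ^ 2 * edgeEnergy (box z (r + s)) f
      + 2 * (s ^ d)⁻¹ * (∑ x ∈ box z r, |f x|) ^ 2 := by
  classical
  set H := box (0 : Lattice d) s with hH
  have hcard : 0 < (H.card : ℝ) := lt_of_lt_of_le (by positivity) (le_card_box 0 hs.le)
  have hE := edgeEnergy_nonneg (box z (r + s)) f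
  have hadd : ∀ x ∈ box z r, ∀ h ∈ H, x + h ∈ box z (r + s) := by
    intro x hx h hh
    rw [mem_box hr] at hx
    rw [hH, mem_box hs.le, sub_zero] at hh
    rw [mem_box (by positivity)]
    have : x + h - z = (x - z) + h := by abel
    rw [this]
    exact (norm_add_le _ _).trans (by linarith)
  -- increments
  have hI : ∀ h ∈ H, ∑ x ∈ box z r, (f (x + h) - f x) ^ 2 ≤
      (d * s) ^ 2 * edgeEnergy (box z (r + s)) f := by
    intro h hh
    calc ∑ x ∈ box z r, (f (x + h) - f x) ^ 2
        ≤ ∑ x ∈ box z (r + s) with x + h ∈ box z (r + s), (f (x + h) - f x) ^ 2 := by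
          refine Finset.sum_le_sum_of_subset_of_nonneg ?_ fun _ _ _ => sq_nonneg _
          intro x hx
          rw [Finset.mem_filter]
          exact ⟨box_subset_box z hr (by linarith) hx, hadd x hx h hh⟩
      _ ≤ _ := (sum_increment_sq_le _ _ f _ h rfl)
      _ ≤ _ := by
        refine mul_le_mul_of_nonneg_right ?_ hE
        gcongr
        rw [hH, mem_box hs.le, sub_zero] at hh
        exact sum_natAbs_le hh
  have hL1 : ∀ x, ∑ h ∈ H, |f (x + h)| ≤ ∑ x ∈ box z r, |f x| := by
    intro x
    rw [← Finset.sum_filter_add_sum_filter_not H (fun h => x + h ∈ box z r)]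
    have h2 : ∑ h ∈ H with ¬ (x + h ∈ box z r), |f (x + h)| = 0 :=
      Finset.sum_eq_zero fun h hh => by rw [hf _ (Finset.mem_filter.1 hh).2, abs_zero]
    rw [h2, add_zero]
    have := sum_translate_le {h ∈ H | x + h ∈ box z r} (box z r) x (fun y => |f y|)
      (fun _ => abs_nonneg _) (fun h hh => by rw [add_comm]; exact (Finset.mem_filter.1 hh).2)
    simpa only [add_comm x] using this
  have hL1' : ∀ h, ∑ x ∈ box z r, |f (x + h)| ≤ ∑ x ∈ box z r, |f x| := by
    intro h
    rw [← Finset.sum_filter_add_sum_filter_not (box z r) (fun x => x + h ∈ box z r)]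
    have h2 : ∑ x ∈ box z r with ¬ (x + h ∈ box z r), |f (x + h)| = 0 :=
      Finset.sum_eq_zero fun x hx => by rw [hf _ (Finset.mem_filter.1 hx).2, abs_zero]
    rw [h2, add_zero]
    exact sum_translate_le {x ∈ box z r | x + h ∈ box z r} (box z r) h (fun y => |f y|)
      (fun _ => abs_nonneg _) (fun x hx => (Finset.mem_filter.1 hx).2)
  set N := ∑ x ∈ box z r, |f x| with hN
  have hN0 : 0 ≤ N := Finset.sum_nonneg fun _ _ => abs_nonneg _
  -- pointwise comparison with the average
  have hpt : ∀ x, (H.card : ℝ) ^ 2 * f x ^ 2 ≤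
      2 * (H.card * ∑ h ∈ H, (f (x + h) - f x) ^ 2) + 2 * (N * ∑ h ∈ H, |f (x + h)|) := by
    intro x
    have e1 : (H.card : ℝ) * f x = ∑ h ∈ H, f (x + h) - ∑ h ∈ H, (f (x + h) - f x) := by
      rw [← Finset.sum_sub_distrib, Finset.sum_congr rfl (fun h _ => sub_sub_cancel _ _),
        Finset.sum_const, nsmul_eq_mul]
    have e2 : (∑ h ∈ H, (f (x + h) - f x)) ^ 2 ≤ H.card * ∑ h ∈ H, (f (x + h) - f x) ^ 2 :=
      sq_sum_le_card_mul_sum_sq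
    have e3 : (∑ h ∈ H, f (x + h)) ^ 2 ≤ N * ∑ h ∈ H, |f (x + h)| := by
      have e4 : |∑ h ∈ H, f (x + h)| ≤ ∑ h ∈ H, |f (x + h)| := Finset.abs_sum_le_sum_abs _ _
      rw [← sq_abs, sq]
      exact mul_le_mul (e4.trans (hL1 x)) e4 (abs_nonneg _) hN0
    rw [← mul_pow, e1]
    nlinarith [sq_nonneg (∑ h ∈ H, f (x + h) + ∑ h ∈ H, (f (x + h) - f x))]
  have hsum : (H.card : ℝ) ^ 2 * ∑ x ∈ box z r, f x ^ 2 ≤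
      (H.card : ℝ) ^ 2 * (2 * (d * s) ^ 2 * edgeEnergy (box z (r + s)) f)
      + 2 * (N * (H.card * N)) := by
    rw [Finset.mul_sum]
    refine (Finset.sum_le_sum fun x _ => hpt x).trans ?_
    rw [Finset.sum_add_distrib, ← Finset.mul_sum, ← Finset.mul_sum, ← Finset.mul_sum,
      ← Finset.mul_sum, Finset.sum_comm, Finset.sum_comm (s := box z r) (t := H)]
    have a1 : ∑ h ∈ H, ∑ x ∈ box z r, (f (x + h) - f x) ^ 2 ≤
        H.card * ((d * s) ^ 2 * edgeEnergy (box z (r + s)) f) := by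
      refine (Finset.sum_le_sum hI).trans ?_
      rw [Finset.sum_const, nsmul_eq_mul]
    have a2 : ∑ h ∈ H, ∑ x ∈ box z r, |f (x + h)| ≤ H.card * N := by
      refine (Finset.sum_le_sum fun h _ => hL1' h).trans ?_
      rw [Finset.sum_const, nsmul_eq_mul]
    have a3 := mul_le_mul_of_nonneg_left a1 hcard.le
    have a4 := mul_le_mul_of_nonneg_left a2 hN0
    nlinarith
  have hinv : (H.card : ℝ)⁻¹ ≤ (s ^ d)⁻¹ := inv_anti₀ (by positivity) (le_card_box 0 hs.le)
  have h5 : ∑ x ∈ box z r, f x ^ 2 ≤ 2 * (d * s) ^ 2 * edgeEnergy (box z (r + s)) f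
      + 2 * (H.card : ℝ)⁻¹ * N ^ 2 := by
    have e : (H.card : ℝ) ^ 2 * (2 * (d * s) ^ 2 * edgeEnergy (box z (r + s)) f
      + 2 * (H.card : ℝ)⁻¹ * N ^ 2) = (H.card : ℝ) ^ 2 * (2 * (d * s) ^ 2 *
      edgeEnergy (box z (r + s)) f) + 2 * (N * (H.card * N)) := by
      field_simp
    exact le_of_mul_le_mul_left (hsum.trans e.ge) (by positivity)
  refine h5.trans ?_
  gcongr

/-! ### Symmetric jump kernels and the Caccioppoli inequality -/

/-- The energy `∑_{x, y ∈ A} C_{xy} (f x - f y)²` of `f` on the pairs of points of `A`. -/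
noncomputable def dirichlet {d : ℕ} (C : Lattice d → Lattice d → ℝ) (A : Finset (Lattice d))
    (f : Lattice d → ℝ) : ℝ :=
  ∑ x ∈ A, ∑ y ∈ A, C x y * (f x - f y) ^ 2

/-- The generator `f ↦ ∑_y C_{xy} (f y - f x)`. -/
noncomputable def gen {d : ℕ} (C : Lattice d → Lattice d → ℝ) (f : Lattice d → ℝ)
    (x : Lattice d) : ℝ :=
  ∑' y, C x y * (f y - f x)

/-- Quantitative properties of a symmetric jump kernel on which the regularity theory rests:
total rates and second moments at most `Λ`, and an energy that controls the discrete gradient,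
up to enlarging boxes by `M`. -/
structure Elliptic {d : ℕ} (C : Lattice d → Lattice d → ℝ) (Λ M : ℝ) : Prop where
  one_le : 1 ≤ Λ
  one_le_range : 1 ≤ M
  nonneg : ∀ x y, 0 ≤ C x y
  symm : ∀ x y, C x y = C y x
  summable : ∀ x, Summable (C x)
  tsum_le : ∀ x, ∑' y, C x y ≤ Λ
  summable_moment : ∀ x, Summable fun y => C x y * ‖y - x‖ ^ 2
  tsum_moment_le : ∀ x, ∑' y, C x y * ‖y - x‖ ^ 2 ≤ Λ
  edge_le : ∀ (z : Lattice d) (r : ℝ), 0 ≤ r → ∀ f,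
    edgeEnergy (box z r) f ≤ Λ * dirichlet C (box z (r + M)) f

lemma sum_sum_le_of_symm {ι : Type*} (A : Finset ι) (k e : ι → ι → ℝ)
    (h : ∀ x ∈ A, ∀ y ∈ A, k x y + k y x ≤ e x y + e y x) :
    ∑ x ∈ A, ∑ y ∈ A, k x y ≤ ∑ x ∈ A, ∑ y ∈ A, e x y := by
  have hs : ∀ g : ι → ι → ℝ, ∑ x ∈ A, ∑ y ∈ A, (g x y + g y x) = 2 * ∑ x ∈ A, ∑ y ∈ A, g x y := by
    intro g
    simp only [Finset.sum_add_distrib]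
    rw [Finset.sum_comm (f := fun x y => g y x)]
    ring
  have := Finset.sum_le_sum fun x hx => Finset.sum_le_sum fun y hy => h x hx y hy
  rw [hs, hs] at this
  linarith

lemma tsum_le_sum_add_tsum {ι : Type*} (A : Finset ι) {g h : ι → ℝ} (hg : Summable g)
    (hh : Summable h) (hle : ∀ y, y ∉ A → g y ≤ h y) :
    ∑' y, g y ≤ ∑ y ∈ A, (g y - h y) + ∑' y, h y := by
  have h1 := (hh.sub hg).sum_le_tsum A (fun i hi => sub_nonneg.2 (hle i hi))
  rw [hh.tsum_sub hg] at h1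
  have h2 : ∑ y ∈ A, (h y - g y) = - ∑ y ∈ A, (g y - h y) := by
    rw [← Finset.sum_neg_distrib]; simp
  linarith

/-- A function with a continuous subgradient is differentiable, with that derivative. -/
lemma hasDerivAt_of_subgradient {F g : ℝ → ℝ} {a : ℝ} (h : ∀ x y, g x * (y - x) ≤ F y - F x)
    (hg : ContinuousAt g a) : HasDerivAt F (g a) a := by
  rw [hasDerivAt_iff_isLittleO, Asymptotics.isLittleO_iff]
  intro c hc
  filter_upwards [Metric.tendsto_nhds.1 hg c hc] with y hy
  rw [Real.dist_eq] at hy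
  have h1 := h a y
  have h2 := h y a
  rw [smul_eq_mul, Real.norm_eq_abs, Real.norm_eq_abs, abs_of_nonneg (by nlinarith)]
  have h3 : F y - F a - (y - a) * g a ≤ (g y - g a) * (y - a) := by nlinarith
  refine h3.trans ((le_abs_self _).trans ?_)
  rw [abs_mul]
  gcongr

lemma hasDerivAt_max_zero_sq (a : ℝ) : HasDerivAt (fun s : ℝ => max s 0 ^ 2) (2 * max a 0) a := by
  refine hasDerivAt_of_subgradient (g := fun s => 2 * max s 0) ?_ (by fun_prop)
  intro x y
  rcases le_total x 0 with hx | hx <;> rcases le_total y 0 with hy | hy <;>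
    simp only [max_eq_left, max_eq_right, hx, hy] <;> nlinarith [sq_nonneg (x - y)]

namespace Elliptic

variable {d : ℕ} {C : Lattice d → Lattice d → ℝ} {Λ M : ℝ}

lemma summable_mul (h : Elliptic C Λ M) (x : Lattice d) {f : Lattice d → ℝ} {B : ℝ}
    (hf : ∀ y, |f y| ≤ B) : Summable fun y => C x y * f y := by
  refine Summable.of_norm_bounded ((h.summable x).mul_right B) fun y => ?_
  rw [Real.norm_eq_abs, abs_mul, abs_of_nonneg (h.nonneg x y)]
  exact mul_le_mul_of_nonneg_left (hf y) (h.nonneg x y)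

lemma summable_gen (h : Elliptic C Λ M) (x : Lattice d) {f : Lattice d → ℝ} {B : ℝ}
    (hf : ∀ y, |f y| ≤ B) : Summable fun y => C x y * (f y - f x) := by
  refine h.summable_mul x (B := 2 * B) fun y => ?_
  have := abs_sub (f y) (f x)
  linarith [hf y, hf x]

lemma dirichlet_nonneg (h : Elliptic C Λ M) (A : Finset (Lattice d)) (f : Lattice d → ℝ) :
    0 ≤ dirichlet C A f :=
  Finset.sum_nonneg fun _ _ => Finset.sum_nonneg fun _ _ => mul_nonneg (h.nonneg _ _) (sq_nonneg _)

lemma pos (h : Elliptic C Λ M) : 0 < Λ := lt_of_lt_of_le one_pos h.one_le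

/-- Nash inequality for the energy, in linear form. -/
lemma nash (h : Elliptic C Λ M) (z : Lattice d) {r s : ℝ} (hr : 0 ≤ r) (hs : 0 < s)
    (f : Lattice d → ℝ) (hf : ∀ x, x ∉ box z r → f x = 0) :
    ∑ x ∈ box z r, f x ^ 2 ≤ 2 * (d * s) ^ 2 * (Λ * dirichlet C (box z (r + s + M)) f)
      + 2 * (s ^ d)⁻¹ * (∑ x ∈ box z r, |f x|) ^ 2 := by
  refine (nash_edge z hr hs f hf).trans ?_
  gcongr
  exact h.edge_le z (r + s) (by positivity) f

/-- Discrete Caccioppoli inequality; the identity behind it is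
`(w - w') (η² w - η'² w') = (η w - η' w')² - w w' (η - η')²`. -/
lemma sum_gen_le (h : Elliptic C Λ M) {A₀ A : Finset (Lattice d)} (hA : A₀ ⊆ A)
    {η w : Lattice d → ℝ} (hη : ∀ x, x ∉ A₀ → η x = 0) (hw : ∀ x, 0 ≤ w x) {B : ℝ}
    (hB : ∀ x, w x ≤ B) {N : ℝ}
    (hN : ∀ x ∈ A₀, ∑' y, C x y * (w y * (η x - η y) ^ 2) ≤ N)
    (hη1 : ∀ x, |η x| ≤ 1) :
    ∑ x ∈ A₀, η x ^ 2 * w x * gen C w x ≤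
      -(1 / 2) * dirichlet C A (fun x => η x * w x) + N * ∑ x ∈ A₀, w x := by
  classical
  have hB' : ∀ x, |w x| ≤ B := fun x => by rw [abs_of_nonneg (hw x)]; exact hB x
  set T : Lattice d → Lattice d → ℝ := fun x y => C x y * (η x ^ 2 * w x * (w y - w x)) with hT
  set W : Lattice d → Lattice d → ℝ := fun x y => C x y * (w x * w y * (η x - η y) ^ 2) with hW
  have hTs : ∀ x, Summable (T x) := fun x => by
    have := (h.summable_gen x hB').mul_left (η x ^ 2 * w x)
    refine this.congr fun y => ?_
    simp only [hT]; ring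
  have hWs0 : ∀ x, Summable fun y => C x y * (w y * (η x - η y) ^ 2) := fun x => by
    refine h.summable_mul x (B := B * 2 ^ 2) fun y => ?_
    rw [abs_mul, abs_of_nonneg (hw y), abs_of_nonneg (sq_nonneg _), ← sq_abs]
    have h1 : |η x - η y| ≤ 2 := (abs_sub _ _).trans (by linarith [hη1 x, hη1 y])
    have := hB y
    have := (hw y).trans (hB y)
    gcongr
  have hWs : ∀ x, Summable (W x) := fun x => by
    refine ((hWs0 x).mul_left (w x)).congr fun y => ?_
    simp only [hW]; ring
  have h1 : ∀ x ∈ A₀, η x ^ 2 * w x * gen C w x ≤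
      ∑ y ∈ A, (T x y - W x y) + ∑' y, W x y := by
    intro x hx
    have e : η x ^ 2 * w x * gen C w x = ∑' y, T x y := by
      rw [gen, ← tsum_mul_left]
      exact tsum_congr fun y => by simp only [hT]; ring
    rw [e]
    refine tsum_le_sum_add_tsum A (hTs x) (hWs x) fun y hy => ?_
    have hy0 := hη y fun hc => hy (hA hc)
    simp only [hT, hW, hy0, sub_zero]
    have := h.nonneg x y
    apply mul_le_mul_of_nonneg_left _ this
    nlinarith [mul_nonneg (sq_nonneg (η x)) (sq_nonneg (w x))]
  have h2 : ∀ x ∈ A₀, ∑' y, W x y ≤ N * w x := by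
    intro x hx
    have e : ∑' y, W x y = w x * ∑' y, C x y * (w y * (η x - η y) ^ 2) := by
      rw [← tsum_mul_left]
      exact tsum_congr fun y => by simp only [hW]; ring
    rw [e, mul_comm N]
    exact mul_le_mul_of_nonneg_left (hN x hx) (hw x)
  have h3 : ∑ x ∈ A₀, ∑ y ∈ A, (T x y - W x y) ≤
      -(1 / 2) * dirichlet C A (fun x => η x * w x) := by
    have e1 : ∑ x ∈ A₀, ∑ y ∈ A, (T x y - W x y) =
        ∑ x ∈ A, ∑ y ∈ A, if x ∈ A₀ then T x y - W x y else 0 := by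
      rw [← Finset.sum_subset hA]
      · exact Finset.sum_congr rfl fun x hx => by simp [hx]
      · intro x _ hx
        simp [hx]
    have e2 : -(1 / 2) * dirichlet C A (fun x => η x * w x) =
        ∑ x ∈ A, ∑ y ∈ A, -(1 / 2) * (C x y * (η x * w x - η y * w y) ^ 2) := by
      rw [dirichlet, Finset.mul_sum]
      exact Finset.sum_congr rfl fun x _ => by rw [Finset.mul_sum]
    rw [e1, e2]
    refine sum_sum_le_of_symm A _ _ fun x _ y _ => ?_
    have hC := h.nonneg x y
    simp only [hT, hW, h.symm y x]
    by_cases hx : x ∈ A₀ <;> by_cases hy : y ∈ A₀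
    · simp only [hx, hy, if_true]
      nlinarith [mul_nonneg hC (mul_nonneg (mul_nonneg (hw x) (hw y)) (sq_nonneg (η x - η y)))]
    · simp only [hx, hy, if_true, if_false, hη y hy]
      exact le_of_eq (by ring)
    · simp only [hx, hy, if_true, if_false, hη x hx]
      exact le_of_eq (by ring)
    · simp only [hx, hy, if_false, hη x hx, hη y hy]
      exact le_of_eq (by ring)
  calc _ ≤ ∑ x ∈ A₀, (∑ y ∈ A, (T x y - W x y) + N * w x) :=
        Finset.sum_le_sum fun x hx => (h1 x hx).trans (by linarith [h2 x hx])
    _ ≤ _ := by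
        rw [Finset.sum_add_distrib, Finset.mul_sum]
        linarith

end Elliptic

/-- A Lipschitz cutoff: `1` on the box of radius `r₁`, and `0` off the box of radius `r₂`. -/
noncomputable def cutoff {d : ℕ} (z : Lattice d) (r₁ r₂ : ℝ) (x : Lattice d) : ℝ :=
  max 0 (min 1 ((r₂ - ‖x - z‖) / (r₂ - r₁)))

section cutoff

variable {d : ℕ} (z : Lattice d) {r₁ r₂ : ℝ}

lemma cutoff_nonneg (x : Lattice d) : 0 ≤ cutoff z r₁ r₂ x := le_max_left _ _

lemma cutoff_le_one (x : Lattice d) : cutoff z r₁ r₂ x ≤ 1 :=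
  max_le zero_le_one (min_le_left _ _)

lemma abs_cutoff_le_one (x : Lattice d) : |cutoff z r₁ r₂ x| ≤ 1 := by
  rw [abs_of_nonneg (cutoff_nonneg z x)]; exact cutoff_le_one z x

lemma cutoff_sq_le_one (x : Lattice d) : cutoff z r₁ r₂ x ^ 2 ≤ 1 :=
  pow_le_one₀ (cutoff_nonneg z x) (cutoff_le_one z x)

lemma cutoff_eq_one (hr : r₁ < r₂) (h0 : 0 ≤ r₁) {x : Lattice d} (hx : x ∈ box z r₁) :
    cutoff z r₁ r₂ x = 1 := by
  rw [mem_box h0] at hx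
  have h : 1 ≤ (r₂ - ‖x - z‖) / (r₂ - r₁) := by
    rw [le_div_iff₀ (by linarith)]; linarith
  rw [cutoff, min_eq_left h]; simp

lemma cutoff_eq_zero (hr : r₁ < r₂) (h0 : 0 ≤ r₂) {x : Lattice d} (hx : x ∉ box z r₂) :
    cutoff z r₁ r₂ x = 0 := by
  rw [mem_box h0, not_le] at hx
  have h : (r₂ - ‖x - z‖) / (r₂ - r₁) ≤ 0 :=
    div_nonpos_of_nonpos_of_nonneg (by linarith) (by linarith)
  rw [cutoff, max_eq_left]
  exact (min_le_right _ _).trans h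

lemma abs_cutoff_sub_le (hr : r₁ < r₂) (x y : Lattice d) :
    |cutoff z r₁ r₂ x - cutoff z r₁ r₂ y| ≤ ‖y - x‖ / (r₂ - r₁) := by
  have h1 : |cutoff z r₁ r₂ x - cutoff z r₁ r₂ y| ≤
      |(r₂ - ‖x - z‖) / (r₂ - r₁) - (r₂ - ‖y - z‖) / (r₂ - r₁)| := by
    unfold cutoff
    refine (abs_max_sub_max_le_max _ _ _ _).trans ?_
    rw [sub_self, abs_zero, max_eq_right (abs_nonneg _)]
    refine (abs_min_sub_min_le_max _ _ _ _).trans ?_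
    rw [sub_self, abs_zero, max_eq_right (abs_nonneg _)]
  refine h1.trans ?_
  have h2 : (r₂ - ‖x - z‖) / (r₂ - r₁) - (r₂ - ‖y - z‖) / (r₂ - r₁) =
      (‖y - z‖ - ‖x - z‖) / (r₂ - r₁) := by ring
  have h3 : 0 < r₂ - r₁ := by linarith
  rw [h2, abs_div, abs_of_pos h3]
  gcongr
  refine (abs_norm_sub_norm_le _ _).trans ?_
  simp

lemma abs_cutoff_sub_le_one (x y : Lattice d) :
    |cutoff z r₁ r₂ x - cutoff z r₁ r₂ y| ≤ 1 := by
  rw [abs_le]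
  constructor <;> linarith [cutoff_nonneg z (r₁ := r₁) (r₂ := r₂) x,
    cutoff_le_one z (r₁ := r₁) (r₂ := r₂) x, cutoff_nonneg z (r₁ := r₁) (r₂ := r₂) y,
    cutoff_le_one z (r₁ := r₁) (r₂ := r₂) y]

end cutoff

/-- The commutator of the generator with a cutoff, applied to a function of quadratic growth. -/
lemma Elliptic.tsum_cutoff_le {d : ℕ} {C : Lattice d → Lattice d → ℝ} {Λ M : ℝ}
    (h : Elliptic C Λ M) {z x : Lattice d} {r r₁ r₂ ℓ : ℝ} (hr : 0 < r) (h12 : r₁ < r₂)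
    (hℓ : 1 ≤ ℓ) (hℓr : r = ℓ * (r₂ - r₁)) (hx : ‖x - z‖ ≤ r) {w : Lattice d → ℝ}
    (hw : ∀ y, 0 ≤ w y) (hgrow : ∀ y, w y ≤ 1 + ‖y - z‖ ^ 2 / r ^ 2) :
    ∑' y, C x y * (w y * (cutoff z r₁ r₂ x - cutoff z r₁ r₂ y) ^ 2) ≤ 5 * ℓ ^ 2 * Λ / r ^ 2 := by
  have key : ∀ y, C x y * (w y * (cutoff z r₁ r₂ x - cutoff z r₁ r₂ y) ^ 2) ≤
      C x y * ‖y - x‖ ^ 2 * (5 * ℓ ^ 2 / r ^ 2) := by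
    intro y
    rw [mul_assoc]
    refine mul_le_mul_of_nonneg_left ?_ (h.nonneg x y)
    set D := (cutoff z r₁ r₂ x - cutoff z r₁ r₂ y) ^ 2 with hD
    have hD0 : 0 ≤ D := sq_nonneg _
    have hD1 : D ≤ 1 := by
      rw [hD, ← sq_abs]
      exact pow_le_one₀ (abs_nonneg _) (abs_cutoff_sub_le_one z x y)
    have hD2 : D ≤ ℓ ^ 2 * (‖y - x‖ ^ 2 / r ^ 2) := by
      have e : ℓ ^ 2 * (‖y - x‖ ^ 2 / r ^ 2) = (‖y - x‖ / (r₂ - r₁)) ^ 2 := by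
        rw [hℓr]
        have : 0 < r₂ - r₁ := by linarith
        field_simp
      rw [e, hD, ← sq_abs]
      gcongr
      exact abs_cutoff_sub_le z h12 x y
    have hyz : ‖y - z‖ ≤ ‖y - x‖ + r := by
      have : y - z = (y - x) + (x - z) := by abel
      rw [this]
      exact (norm_add_le _ _).trans (by linarith)
    set q := ‖y - x‖ ^ 2 / r ^ 2 with hq
    have hq0 : 0 ≤ q := by positivity
    have hw3 : w y ≤ 3 + 2 * q := by
      refine (hgrow y).trans ?_
      have : ‖y - z‖ ^ 2 / r ^ 2 ≤ 2 * q + 2 := by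
        rw [hq, div_le_iff₀ (by positivity)]
        have e : (2 * (‖y - x‖ ^ 2 / r ^ 2) + 2) * r ^ 2 = 2 * ‖y - x‖ ^ 2 + 2 * r ^ 2 := by
          field_simp
        rw [e]
        have := pow_le_pow_left₀ (norm_nonneg _) hyz 2
        nlinarith [sq_nonneg (‖y - x‖ - r)]
      linarith
    have e : ‖y - x‖ ^ 2 * (5 * ℓ ^ 2 / r ^ 2) = 5 * ℓ ^ 2 * q := by rw [hq]; ring
    rw [e]
    have hℓ2 : 1 ≤ ℓ ^ 2 := one_le_pow₀ hℓ
    calc w y * D ≤ (3 + 2 * q) * D := by gcongr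
      _ = 3 * D + 2 * q * D := by ring
      _ ≤ 3 * (ℓ ^ 2 * q) + 2 * q * 1 := by gcongr
      _ ≤ _ := by nlinarith
  have hs : Summable fun y => C x y * ‖y - x‖ ^ 2 * (5 * ℓ ^ 2 / r ^ 2) :=
    (h.summable_moment x).mul_right _
  have hs' : Summable fun y => C x y * (w y * (cutoff z r₁ r₂ x - cutoff z r₁ r₂ y) ^ 2) :=
    Summable.of_nonneg_of_le
      (fun y => mul_nonneg (h.nonneg x y) (mul_nonneg (hw y) (sq_nonneg _))) key hs
  refine (hs'.tsum_le_tsum key hs).trans ?_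
  rw [tsum_mul_right]
  calc _ ≤ Λ * (5 * ℓ ^ 2 / r ^ 2) := by
        refine mul_le_mul_of_nonneg_right (h.tsum_moment_le x) (by positivity)
    _ = _ := by ring

/-- `v` is a subsolution of the heat equation `∂ₜ v = L v` at the points of `A`, for times in
`[a, b]`. -/
def SubSol {d : ℕ} (C : Lattice d → Lattice d → ℝ) (v : ℝ → Lattice d → ℝ) (a b : ℝ)
    (A : Finset (Lattice d)) : Prop :=
  ∀ x ∈ A, ContinuousOn (fun t => v t x) (Icc a b) ∧
    ∀ t ∈ Ioo a b, ∃ v', HasDerivAt (fun t => v t x) v' t ∧ v' ≤ gen C (v t) x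

lemma SubSol.mono {d : ℕ} {C : Lattice d → Lattice d → ℝ} {v : ℝ → Lattice d → ℝ} {a b a' b' : ℝ}
    {A A' : Finset (Lattice d)} (h : SubSol C v a b A) (ha : a ≤ a') (hb : b' ≤ b) (hA : A' ⊆ A) :
    SubSol C v a' b' A' := fun x hx =>
  ⟨(h x (hA hx)).1.mono (Icc_subset_Icc ha hb), fun t ht =>
    (h x (hA hx)).2 t (Ioo_subset_Ioo ha hb ht)⟩

/-- Energy inequality in differential form for the truncation of a subsolution at level `ℓ`. -/
lemma SubSol.energy_deriv {d : ℕ} {C : Lattice d → Lattice d → ℝ} {Λ M : ℝ} (h : Elliptic C Λ M)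
    {v : ℝ → Lattice d → ℝ} {a b : ℝ} {A₀ A : Finset (Lattice d)} (hv : SubSol C v a b A₀)
    (hA : A₀ ⊆ A) {η : Lattice d → ℝ} (hη : ∀ x, x ∉ A₀ → η x = 0) (hη1 : ∀ x, |η x| ≤ 1)
    {t ℓ B N : ℝ} (ht : t ∈ Ioo a b) (hB : ∀ x, |v t x| ≤ B)
    (hN : ∀ x ∈ A₀, ∑' y, C x y * (max (v t y - ℓ) 0 * (η x - η y) ^ 2) ≤ N) :
    ∃ Φ', HasDerivAt (fun t => ∑ x ∈ A₀, η x ^ 2 * max (v t x - ℓ) 0 ^ 2) Φ' t ∧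
      Φ' ≤ -dirichlet C A (fun x => η x * max (v t x - ℓ) 0)
        + 2 * N * ∑ x ∈ A₀, max (v t x - ℓ) 0 := by
  choose! v' hd hle using fun x (hx : x ∈ A₀) => (hv x hx).2 t ht
  set w : Lattice d → ℝ := fun x => max (v t x - ℓ) 0 with hw
  have hw0 : ∀ x, 0 ≤ w x := fun x => le_max_right _ _
  have hwB : ∀ x, w x ≤ B + |ℓ| := fun x => by
    have := abs_le.1 (hB x)
    have := neg_abs_le ℓ
    exact max_le (by linarith) (by linarith [abs_nonneg ℓ])
  refine ⟨∑ x ∈ A₀, η x ^ 2 * (2 * w x * v' x), ?_, ?_⟩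
  · apply HasDerivAt.fun_sum
    intro x hx
    refine HasDerivAt.const_mul (η x ^ 2) ?_
    have := (hasDerivAt_max_zero_sq (v t x - ℓ)).comp t ((hd x hx).sub_const ℓ)
    exact this
  · have h1 := h.sum_gen_le hA hη hw0 hwB hN hη1
    have h2 : ∑ x ∈ A₀, η x ^ 2 * (2 * w x * v' x) ≤
        2 * ∑ x ∈ A₀, η x ^ 2 * w x * gen C w x := by
      rw [Finset.mul_sum]
      refine Finset.sum_le_sum fun x hx => ?_
      have h3 : w x * v' x ≤ w x * gen C w x := by
        refine (mul_le_mul_of_nonneg_left (hle x hx) (hw0 x)).trans ?_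
        rw [gen, gen, ← tsum_mul_left, ← tsum_mul_left]
        refine Summable.tsum_le_tsum (fun y => ?_) ((h.summable_gen x hB).mul_left _)
          ((h.summable_gen x (f := w) (B := B + |ℓ|) fun y => ?_).mul_left _)
        · have hC := h.nonneg x y
          have : w x * (v t y - v t x) ≤ w x * (w y - w x) := by
            simp only [hw]
            rcases le_total (v t x - ℓ) 0 with h0 | h0
            · rw [max_eq_right h0]; simp
            · rw [max_eq_left h0]
              apply mul_le_mul_of_nonneg_left _ h0
              linarith [le_max_left (v t y - ℓ) 0]
          nlinarith
        · rw [abs_of_nonneg (hw0 y)]; exact hwB y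
      nlinarith [sq_nonneg (η x)]
    linarith

/-! ### De Giorgi iteration -/

lemma continuousOn_cutoff_mul {d : ℕ} {v : ℝ → Lattice d → ℝ} {a b ℓ : ℝ}
    {A₀ : Finset (Lattice d)} (hv : ∀ x ∈ A₀, ContinuousOn (fun t => v t x) (Icc a b))
    {η : Lattice d → ℝ} (hη : ∀ x, x ∉ A₀ → η x = 0) (x : Lattice d) :
    ContinuousOn (fun t => η x * max (v t x - ℓ) 0) (Icc a b) := by
  by_cases hx : x ∈ A₀
  · have := hv x hx
    fun_prop
  · simp only [hη x hx, zero_mul]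
    exact continuousOn_const

/-- Energy inequality for the truncation `w` of a subsolution at level `lev`, with a cutoff between
the radii `r₁ < r₂`. The weight `t - a` in time plays the part of a cutoff at the initial time. -/
lemma SubSol.energy {d : ℕ} {C : Lattice d → Lattice d → ℝ} {Λ M : ℝ} (h : Elliptic C Λ M)
    {v : ℝ → Lattice d → ℝ} {a b : ℝ} {z : Lattice d} {r r₁ r₂ ℓ lev B X : ℝ}
    (hr : 0 < r) (hr₁ : 0 ≤ r₁) (h12 : r₁ < r₂) (h2r : r₂ ≤ r) (hℓ : 1 ≤ ℓ)
    (hℓr : r = ℓ * (r₂ - r₁)) (hlev : 0 ≤ lev)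
    (hv : SubSol C v a b (box z r₂)) (hB : ∀ t ∈ Icc a b, ∀ x, |v t x| ≤ B)
    (hgrow : ∀ t ∈ Icc a b, ∀ x, v t x ≤ 1 + ‖x - z‖ ^ 2 / r ^ 2)
    (hX : (∫ t in a..b, ∑ x ∈ box z r₂, max (v t x - lev) 0 ^ 2) +
      (b - a) * (2 * (5 * ℓ ^ 2 * Λ / r ^ 2)) * ∫ t in a..b, ∑ x ∈ box z r₂, max (v t x - lev) 0
      ≤ X) :
    (∀ t ∈ Icc a b, (t - a) * ∑ x ∈ box z r₁, max (v t x - lev) 0 ^ 2 ≤ X) ∧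
    ∀ T ∈ Icc a b, ∀ A, box z r₂ ⊆ A →
      (T - a) * ∫ t in T..b, dirichlet C A (fun x => cutoff z r₁ r₂ x * max (v t x - lev) 0)
        ≤ X := by
  set N := 5 * ℓ ^ 2 * Λ / r ^ 2 with hN
  have hN0 : 0 ≤ N := by have := h.pos; positivity
  set η := cutoff z r₁ r₂ with hη
  have hη0 : ∀ x, x ∉ box z r₂ → η x = 0 := fun x hx => cutoff_eq_zero z h12 (by linarith) hx
  have hvc : ∀ x ∈ box z r₂, ContinuousOn (fun t => v t x) (Icc a b) := fun x hx => (hv x hx).1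
  have hwc : ∀ x ∈ box z r₂, ContinuousOn (fun t => max (v t x - lev) 0) (Icc a b) :=
    fun x hx => by have := hvc x hx; fun_prop
  set S : ℝ → ℝ := fun t => ∑ x ∈ box z r₂, η x ^ 2 * max (v t x - lev) 0 ^ 2 with hS
  set S1 : ℝ → ℝ := fun t => ∑ x ∈ box z r₂, max (v t x - lev) 0 ^ 2 with hS1
  set W : ℝ → ℝ := fun t => ∑ x ∈ box z r₂, max (v t x - lev) 0 with hW
  have hSc : ContinuousOn S (Icc a b) := continuousOn_finsetSum _ fun x hx => by
    have := hwc x hx; fun_prop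
  have hS1c : ContinuousOn S1 (Icc a b) := continuousOn_finsetSum _ fun x hx => by
    have := hwc x hx; fun_prop
  have hWc : ContinuousOn W (Icc a b) := continuousOn_finsetSum _ fun x hx => hwc x hx
  have hS0 : ∀ t, 0 ≤ S t := fun t => Finset.sum_nonneg fun _ _ => by positivity
  have hS10 : ∀ t, 0 ≤ S1 t := fun t => Finset.sum_nonneg fun _ _ => by positivity
  have hW0 : ∀ t, 0 ≤ W t := fun t => Finset.sum_nonneg fun _ _ => le_max_right _ _
  have hSS1 : ∀ t, S t ≤ S1 t := fun t => Finset.sum_le_sum fun x _ => by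
    have := cutoff_sq_le_one z (r₁ := r₁) (r₂ := r₂) x
    exact mul_le_of_le_one_left (sq_nonneg _) this
  have main : ∀ A, box z r₂ ⊆ A → ∀ t ∈ Icc a b, (t - a) * S t +
      ∫ τ in a..t, (τ - a) * dirichlet C A (fun x => η x * max (v τ x - lev) 0) ≤ X := by
    intro A hA t ht
    have hsub : Icc a t ⊆ Icc a b := Icc_subset_Icc le_rfl ht.2
    set E : ℝ → ℝ := fun τ => dirichlet C A (fun x => η x * max (v τ x - lev) 0) with hE
    have hEc : ContinuousOn E (Icc a b) := by
      refine continuousOn_finsetSum _ fun x _ => continuousOn_finsetSum _ fun y _ => ?_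
      have h1 := continuousOn_cutoff_mul (ℓ := lev) hvc hη0 x
      have h2 := continuousOn_cutoff_mul (ℓ := lev) hvc hη0 y
      exact continuousOn_const.mul ((h1.sub h2).pow 2)
    have hid : ContinuousOn (fun τ : ℝ => τ - a) (Icc a b) := by fun_prop
    have hd : ∀ τ ∈ Ioo a t, ∃ S', HasDerivAt S S' τ ∧ S' ≤ -E τ + 2 * N * W τ := by
      intro τ hτ
      have hτ' : τ ∈ Ioo a b := ⟨hτ.1, hτ.2.trans_le ht.2⟩
      refine hv.energy_deriv h hA hη0 (abs_cutoff_le_one z) hτ' (hB τ (Ioo_subset_Icc_self hτ'))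
        fun x hx => ?_
      have hx' : ‖x - z‖ ≤ r := ((mem_box (by linarith)).1 hx).trans h2r
      refine h.tsum_cutoff_le hr h12 hℓ hℓr hx' (fun _ => le_max_right _ _) fun y => ?_
      refine max_le ?_ (by positivity)
      linarith [hgrow τ (Ioo_subset_Icc_self hτ') y]
    choose! S' hS'd hS'le using hd
    have key := intervalIntegral.sub_le_integral_of_hasDeriv_right_of_le
      (g := fun τ => (τ - a) * S τ) (g' := fun τ => S τ + (τ - a) * S' τ)
      (φ := fun τ => S1 τ + (b - a) * (2 * N) * W τ - (τ - a) * E τ) ht.1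
      ((hid.mul hSc).mono hsub)
      (fun τ hτ => by
        have h1 := ((hasDerivAt_id τ).sub_const a).mul (hS'd τ hτ)
        simp only [one_mul, id] at h1
        exact h1.hasDerivWithinAt)
      (((hS1c.add (continuousOn_const.mul hWc)).sub (hid.mul hEc)).mono hsub).integrableOn_Icc
      (fun τ hτ => by
        have h1 := hS'le τ hτ
        have h2 : 0 ≤ τ - a := by linarith [hτ.1]
        have h3 : τ - a ≤ b - a := by linarith [hτ.2, ht.2]
        have h4 := mul_le_mul_of_nonneg_left h1 h2
        have h5 : (τ - a) * (2 * N * W τ) ≤ (b - a) * (2 * N * W τ) :=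
          mul_le_mul_of_nonneg_right h3 (by have := hW0 τ; positivity)
        linarith [hSS1 τ])
    simp only [sub_self, zero_mul, sub_zero] at key
    have i1 : IntervalIntegrable S1 volume a t :=
      (hS1c.mono (by rw [uIcc_of_le ht.1]; exact hsub)).intervalIntegrable
    have i2 : IntervalIntegrable (fun τ => (b - a) * (2 * N) * W τ) volume a t :=
      ((continuousOn_const.mul hWc).mono (by rw [uIcc_of_le ht.1]; exact hsub)).intervalIntegrable
    have i3 : IntervalIntegrable (fun τ => (τ - a) * E τ) volume a t :=
      ((hid.mul hEc).mono (by rw [uIcc_of_le ht.1]; exact hsub)).intervalIntegrable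
    rw [intervalIntegral.integral_sub (i1.add i2) i3, intervalIntegral.integral_add i1 i2,
      intervalIntegral.integral_const_mul] at key
    have hab : a ≤ b := ht.1.trans ht.2
    have m1 : ∫ τ in a..t, S1 τ ≤ ∫ τ in a..b, S1 τ :=
      intervalIntegral.integral_mono_interval le_rfl ht.1 ht.2 (ae_of_all _ hS10)
        (hS1c.mono (by rw [uIcc_of_le hab])).intervalIntegrable
    have m2 : ∫ τ in a..t, W τ ≤ ∫ τ in a..b, W τ :=
      intervalIntegral.integral_mono_interval le_rfl ht.1 ht.2 (ae_of_all _ hW0)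
        (hWc.mono (by rw [uIcc_of_le hab])).intervalIntegrable
    have m3 : (b - a) * (2 * N) * ∫ τ in a..t, W τ ≤ (b - a) * (2 * N) * ∫ τ in a..b, W τ :=
      mul_le_mul_of_nonneg_left m2 (mul_nonneg (by linarith) (by positivity))
    linarith
  constructor
  · intro t ht
    have h1 := main (box z r₂) subset_rfl t ht
    have h2 : 0 ≤ ∫ τ in a..t, (τ - a) * dirichlet C (box z r₂)
        (fun x => η x * max (v τ x - lev) 0) := by
      refine intervalIntegral.integral_nonneg ht.1 fun τ hτ => ?_
      exact mul_nonneg (by linarith [hτ.1]) (h.dirichlet_nonneg _ _)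
    have h3 : ∑ x ∈ box z r₁, max (v t x - lev) 0 ^ 2 ≤ S t := by
      calc _ = ∑ x ∈ box z r₁, η x ^ 2 * max (v t x - lev) 0 ^ 2 :=
            Finset.sum_congr rfl fun x hx => by rw [hη, cutoff_eq_one z h12 hr₁ hx]; ring
        _ ≤ _ := Finset.sum_le_sum_of_subset_of_nonneg (box_subset_box z hr₁ h12.le)
            fun _ _ _ => by positivity
    have h4 := mul_le_mul_of_nonneg_left h3 (sub_nonneg.2 ht.1)
    linarith
  · intro T hT A hA
    have hab : a ≤ b := hT.1.trans hT.2
    have h1 := main A hA b ⟨hab, le_rfl⟩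
    set E : ℝ → ℝ := fun τ => dirichlet C A (fun x => η x * max (v τ x - lev) 0) with hE
    have hE0 : ∀ τ, 0 ≤ E τ := fun τ => h.dirichlet_nonneg _ _
    have hEc : ContinuousOn E (Icc a b) := by
      refine continuousOn_finsetSum _ fun x _ => continuousOn_finsetSum _ fun y _ => ?_
      have h1 := continuousOn_cutoff_mul (ℓ := lev) hvc hη0 x
      have h2 := continuousOn_cutoff_mul (ℓ := lev) hvc hη0 y
      exact continuousOn_const.mul ((h1.sub h2).pow 2)
    have hid : ContinuousOn (fun τ : ℝ => τ - a) (Icc a b) := by fun_prop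
    have hc := hid.mul hEc
    have m0 : 0 ≤ (b - a) * S b := mul_nonneg (by linarith) (hS0 b)
    have hsub : Icc T b ⊆ Icc a b := Icc_subset_Icc hT.1 le_rfl
    have m1 : ∫ τ in T..b, (τ - a) * E τ ≤ ∫ τ in a..b, (τ - a) * E τ := by
      have i1 : IntervalIntegrable (fun τ => (τ - a) * E τ) volume a T :=
        (hc.mono (by rw [uIcc_of_le hT.1]; exact Icc_subset_Icc le_rfl hT.2)).intervalIntegrable
      have i2 : IntervalIntegrable (fun τ => (τ - a) * E τ) volume T b :=
        (hc.mono (by rw [uIcc_of_le hT.2]; exact hsub)).intervalIntegrable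
      rw [← intervalIntegral.integral_add_adjacent_intervals i1 i2]
      have : 0 ≤ ∫ τ in a..T, (τ - a) * E τ :=
        intervalIntegral.integral_nonneg hT.1 fun τ hτ =>
          mul_nonneg (by linarith [hτ.1]) (hE0 τ)
      linarith
    have m2 : (T - a) * ∫ τ in T..b, E τ ≤ ∫ τ in T..b, (τ - a) * E τ := by
      rw [← intervalIntegral.integral_const_mul]
      refine intervalIntegral.integral_mono_on hT.2 ?_ ?_ fun τ hτ => ?_
      · exact ((continuousOn_const.mul hEc).mono
          (by rw [uIcc_of_le hT.2]; exact hsub)).intervalIntegrable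
      · exact (hc.mono (by rw [uIcc_of_le hT.2]; exact hsub)).intervalIntegrable
      · exact mul_le_mul_of_nonneg_right (by linarith [hτ.1]) (hE0 τ)
    linarith

/-- The nonlinear recursion of the De Giorgi iteration. The parameter `σ` is the scale at which the
Nash inequality is used, relative to the size of the cylinder; it may depend on `k`. -/
lemma exists_le_of_recursion (d : ℕ) {K b : ℝ} (hK : 1 ≤ K) (hb : 1 < b) :
    ∃ δ : ℝ, 0 < δ ∧ ∀ a : ℕ → ℝ, (∀ k, 0 ≤ a k) → a 0 ≤ δ → a 1 ≤ δ →
      (∀ k σ, 0 < σ → a (k + 2) ≤ K * b ^ k * (σ ^ 2 * a (k + 1) + (σ ^ d)⁻¹ * a k ^ 2)) →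
      ∀ ε > 0, ∃ k, a k ≤ ε := by
  have hb0 : 0 < b := by linarith
  have hb1 : 1 ≤ b := hb.le
  set lam : ℝ := (b ^ (d + 1))⁻¹ with hlam
  have hl0 : 0 < lam := by positivity
  have hl1 : lam < 1 := inv_lt_one_of_one_lt₀ (one_lt_pow₀ hb (by omega))
  set D : ℝ := (2 * K * (2 * K / lam) ^ d)⁻¹ * lam ^ 2 with hD
  have hD0 : 0 < D := by positivity
  refine ⟨D * lam, by positivity, fun a ha0 h0 h1 hrec => ?_⟩
  have hDl : D * lam ≤ D := mul_le_of_le_one_right hD0.le hl1.le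
  have hind : ∀ k, a k ≤ D * lam ^ k ∧ a (k + 1) ≤ D * lam ^ (k + 1) := by
    intro k
    induction k with
    | zero => exact ⟨by simpa using h0.trans hDl, by simpa using h1⟩
    | succ k ih =>
      refine ⟨ih.2, ?_⟩
      -- this scale makes each of the two terms of the recursion half of the claimed bound
      set σ : ℝ := lam / (2 * K * b ^ k) with hσ
      have hσ0 : 0 < σ := by positivity
      have hσ1 : σ ≤ 1 := by
        rw [hσ, div_le_one (by positivity)]
        have := one_le_pow₀ hb1 (n := k)
        nlinarith
      have hσ2 : σ ^ 2 ≤ σ := by nlinarith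
      refine (hrec k σ hσ0).trans ?_
      have e1 : K * b ^ k * (σ * (D * lam ^ (k + 1))) = D * lam ^ (k + 2) / 2 := by
        rw [hσ]; field_simp; ring
      have e2 : K * b ^ k * ((σ ^ d)⁻¹ * (D * lam ^ k) ^ 2) = D * lam ^ (k + 2) / 2 := by
        have e3 : lam ^ k * (b ^ k * (b ^ k) ^ d) = 1 := by
          rw [hlam, ← pow_succ', inv_pow, ← pow_mul, ← pow_mul, mul_comm k, inv_mul_cancel₀]
          positivity
        have e4 : (σ ^ d)⁻¹ = (2 * K / lam) ^ d * (b ^ k) ^ d := by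
          rw [hσ, ← inv_pow, ← mul_pow]; congr 1; field_simp
        have e5 : D * (2 * K * (2 * K / lam) ^ d) = lam ^ 2 := by
          rw [hD]; field_simp
        rw [e4]
        calc K * b ^ k * ((2 * K / lam) ^ d * (b ^ k) ^ d * (D * lam ^ k) ^ 2)
            = (D * (2 * K * (2 * K / lam) ^ d)) * (lam ^ k * (b ^ k * (b ^ k) ^ d)) * D
                * lam ^ k / 2 := by ring
          _ = _ := by rw [e5, e3]; ring
      have m1 : σ ^ 2 * a (k + 1) ≤ σ * (D * lam ^ (k + 1)) :=
        mul_le_mul hσ2 ih.2 (ha0 _) hσ0.le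
      have m2 : (σ ^ d)⁻¹ * a k ^ 2 ≤ (σ ^ d)⁻¹ * (D * lam ^ k) ^ 2 :=
        mul_le_mul_of_nonneg_left (pow_le_pow_left₀ (ha0 k) ih.1 2) (by positivity)
      calc _ ≤ K * b ^ k * (σ * (D * lam ^ (k + 1)) + (σ ^ d)⁻¹ * (D * lam ^ k) ^ 2) := by
            gcongr
        _ = D * lam ^ (k + 2) := by rw [mul_add, e1, e2]; ring
  intro ε hε
  obtain ⟨k, hk⟩ := exists_pow_lt_of_lt_one (div_pos hε hD0) hl1
  refine ⟨k, (hind k).1.trans ?_⟩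
  rw [lt_div_iff₀ hD0] at hk
  linarith

lemma SubSol.continuousOn_trunc {d : ℕ} {C : Lattice d → Lattice d → ℝ}
    {v : ℝ → Lattice d → ℝ} {a b : ℝ} {A : Finset (Lattice d)} (hv : SubSol C v a b A) (ℓ : ℝ)
    {x : Lattice d} (hx : x ∈ A) : ContinuousOn (fun t => max (v t x - ℓ) 0) (Icc a b) := by
  have := (hv x hx).1
  fun_prop

/-- Passing to the next level gains a power: a truncation is bounded by the square of the
previous one. -/
lemma trunc_le_sq {v ℓ ℓ' g : ℝ} (hg : 0 < g) (h : ℓ' - ℓ = g) :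
    max (v - ℓ') 0 ≤ g⁻¹ * max (v - ℓ) 0 ^ 2 := by
  rcases le_total (v - ℓ') 0 with h0 | h0
  · rw [max_eq_right h0]; positivity
  · rw [max_eq_left h0, max_eq_left (by linarith), inv_mul_eq_div, le_div_iff₀ hg]
    nlinarith

/-- From local means to local suprema: a subsolution of at most quadratic growth whose positive
part has small square mean on a parabolic cylinder is at most `1/2` on the half cylinder. -/
theorem exists_deGiorgi (d : ℕ) {Λ : ℝ} (hΛ : 1 ≤ Λ) : ∃ δ₀ : ℝ, 0 < δ₀ ∧
    ∀ (C : Lattice d → Lattice d → ℝ) (M : ℝ), Elliptic C Λ M →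
    ∀ (z : Lattice d) (r t₁ : ℝ) (v : ℝ → Lattice d → ℝ) (B : ℝ), 0 < r →
      SubSol C v (t₁ - r ^ 2) t₁ (box z r) →
      (∀ t ∈ Icc (t₁ - r ^ 2) t₁, ∀ x, |v t x| ≤ B) →
      (∀ t ∈ Icc (t₁ - r ^ 2) t₁, ∀ x, v t x ≤ 1 + ‖x - z‖ ^ 2 / r ^ 2) →
      (∫ t in (t₁ - r ^ 2)..t₁, ∑ x ∈ box z r, max (v t x) 0 ^ 2) ≤ δ₀ * r ^ (d + 2) →
      ∀ t ∈ Icc (t₁ - r ^ 2 / 4) t₁, ∀ x ∈ box z (r / 2), v t x ≤ 1 / 2 := by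
  set K₁ : ℝ := 1710 * Λ with hK₁
  set K : ℝ := 1 + 64 * d ^ 2 * Λ * K₁ + 128 * K₁ ^ 2 with hK
  have hK1 : 1 ≤ K := by
    have : 0 ≤ 64 * (d : ℝ) ^ 2 * Λ * K₁ := by positivity
    have : 0 ≤ 128 * K₁ ^ 2 := by positivity
    linarith
  obtain ⟨δ, hδ, hrec⟩ := exists_le_of_recursion d hK1 (b := 1024) (by norm_num)
  refine ⟨δ, hδ, ?_⟩
  intro C M h z r t₁ v B hr hv hB hgrow hsmall
  have hr2 : 0 < r ^ 2 := by positivity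
  -- radii, initial times and levels
  set p : ℕ → ℝ := fun k => (1 / 2) ^ k with hp
  have hp0 : ∀ k, 0 < p k := fun k => by positivity
  have hp1 : ∀ k, p k ≤ 1 := fun k => pow_le_one₀ (by norm_num) (by norm_num)
  have hps : ∀ k, p (k + 1) = p k / 2 := fun k => by simp only [hp, pow_succ]; ring
  have hpi : ∀ k, (p k)⁻¹ = 2 ^ k := fun k => by simp [hp]
  set R : ℕ → ℝ := fun k => r * (1 / 2 + p k / 2) with hR
  set T : ℕ → ℝ := fun k => t₁ - r ^ 2 * (1 / 4 + 3 / 4 * p k) with hT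
  set l : ℕ → ℝ := fun k => (1 - p k) / 2 with hl
  have hR0 : ∀ k, r / 2 ≤ R k := fun k => by
    have := mul_pos hr (hp0 k); simp only [hR]; linarith
  have hRr : ∀ k, R k ≤ r := fun k => by
    have := mul_le_mul_of_nonneg_left (hp1 k) hr.le; simp only [hR]; linarith
  have hRs : ∀ k, R k - R (k + 1) = r * p k / 4 := fun k => by simp only [hR, hps]; ring
  have hRlt : ∀ k, R (k + 1) < R k := fun k => by
    have := hRs k; have := mul_pos hr (hp0 k); linarith
  have hTs : ∀ k, T (k + 1) - T k = r ^ 2 * (3 / 8) * p k := fun k => by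
    simp only [hT, hps]; ring
  have hTle : ∀ k, T k ≤ T (k + 1) := fun k => by
    have := hTs k; have := mul_pos hr2 (hp0 k); linarith
  have hT0 : ∀ k, t₁ - r ^ 2 ≤ T k := fun k => by
    have := mul_le_mul_of_nonneg_left (hp1 k) hr2.le; simp only [hT]; linarith
  have hT1 : ∀ k, T k ≤ t₁ - r ^ 2 / 4 := fun k => by
    have := mul_pos hr2 (hp0 k); simp only [hT]; linarith
  have hT1' : ∀ k, T k ≤ t₁ := fun k => by linarith [hT1 k]
  have hls : ∀ k, l (k + 1) - l k = p k / 4 := fun k => by simp only [hl, hps]; ring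
  have hl0 : ∀ k, 0 ≤ l k := fun k => by have := hp1 k; simp only [hl]; linarith
  have hlle : ∀ k, l k ≤ l (k + 1) := fun k => by have := hls k; linarith [hp0 k]
  have hbox : ∀ k, box z (R (k + 1)) ⊆ box z (R k) := fun k =>
    box_subset_box z (by linarith [hR0 (k + 1)]) (hRlt k).le
  have hboxr : ∀ k, box z (R k) ⊆ box z r := fun k =>
    box_subset_box z (by linarith [hR0 k]) (hRr k)
  -- continuity in time of sums of truncations
  have hcont : ∀ (k j : ℕ) (ℓ : ℝ), ContinuousOn
      (fun t => ∑ x ∈ box z (R k), max (v t x - ℓ) 0 ^ 2) (Icc (T j) t₁) := fun k j ℓ =>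
    continuousOn_finsetSum _ fun x hx =>
      ((hv.continuousOn_trunc ℓ (hboxr k hx)).pow 2).mono (Icc_subset_Icc (hT0 j) le_rfl)
  have hcont1 : ∀ (k j : ℕ) (ℓ : ℝ), ContinuousOn
      (fun t => ∑ x ∈ box z (R k), max (v t x - ℓ) 0) (Icc (T j) t₁) := fun k j ℓ =>
    continuousOn_finsetSum _ fun x hx =>
      (hv.continuousOn_trunc ℓ (hboxr k hx)).mono (Icc_subset_Icc (hT0 j) le_rfl)
  have hint : ∀ {f : ℝ → ℝ} (j : ℕ), ContinuousOn f (Icc (T j) t₁) →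
      IntervalIntegrable f volume (T j) t₁ := fun j hf => by
    refine ContinuousOn.intervalIntegrable ?_
    rwa [uIcc_of_le (hT1' j)]
  set A : ℕ → ℝ := fun k => ∫ t in (T k)..t₁, ∑ x ∈ box z (R k), max (v t x - l k) 0 ^ 2 with hA
  have hA0 : ∀ k, 0 ≤ A k := fun k =>
    intervalIntegral.integral_nonneg (hT1' k) fun t _ =>
      Finset.sum_nonneg fun _ _ => sq_nonneg _
  have htr : ∀ k t x, max (v t x - l (k + 1)) 0 ≤ 4 * 2 ^ k * max (v t x - l k) 0 ^ 2 := by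
    intro k t x
    have := trunc_le_sq (v := v t x) (by have := hp0 k; positivity) (hls k)
    rw [inv_div, div_eq_mul_inv, hpi] at this
    exact this
  have hmono : ∀ k t x, max (v t x - l (k + 1)) 0 ^ 2 ≤ max (v t x - l k) 0 ^ 2 := by
    intro k t x
    have := hlle k
    gcongr
  -- the energy inequality on the `k`-th pair of cylinders
  have hen := fun k => SubSol.energy (X := 641 * Λ * 8 ^ k * A k) (ℓ := 4 * 2 ^ k)
    (lev := l (k + 1)) (B := B) h hr (by linarith [hR0 (k + 1)]) (hRlt k) (hRr k)
    (by have := one_le_pow₀ (n := k) (a := (2 : ℝ)) (by norm_num); linarith)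
    (by rw [hRs, ← hpi]; have := (hp0 k).ne'; field_simp) (hl0 _)
    (hv.mono (hT0 k) le_rfl (hboxr k))
    (fun t ht => hB t ⟨(hT0 k).trans ht.1, ht.2⟩)
    (fun t ht => hgrow t ⟨(hT0 k).trans ht.1, ht.2⟩) (by
      have i1 : (∫ t in (T k)..t₁, ∑ x ∈ box z (R k), max (v t x - l (k + 1)) 0 ^ 2) ≤ A k :=
        intervalIntegral.integral_mono_on (hT1' k) (hint k (hcont k k _)) (hint k (hcont k k _))
          fun t _ => Finset.sum_le_sum fun x _ => hmono k t x
      have i2 : (∫ t in (T k)..t₁, ∑ x ∈ box z (R k), max (v t x - l (k + 1)) 0) ≤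
          4 * 2 ^ k * A k := by
        rw [hA, ← intervalIntegral.integral_const_mul]
        refine intervalIntegral.integral_mono_on (hT1' k) (hint k (hcont1 k k _))
          (hint k (continuousOn_const.mul (hcont k k _))) fun t _ => ?_
        rw [Finset.mul_sum]
        exact Finset.sum_le_sum fun x _ => htr k t x
      have i3 : t₁ - T k ≤ r ^ 2 := by linarith [hT0 k]
      have i4 : 0 ≤ t₁ - T k := by linarith [hT1' k]
      have i5 : 0 ≤ ∫ t in (T k)..t₁, ∑ x ∈ box z (R k), max (v t x - l (k + 1)) 0 :=
        intervalIntegral.integral_nonneg (hT1' k) fun t _ =>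
          Finset.sum_nonneg fun _ _ => le_max_right _ _
      have hAk := hA0 k
      have h8 : (1 : ℝ) ≤ 8 ^ k := one_le_pow₀ (by norm_num)
      have e8 : (8 : ℝ) ^ k = 2 ^ k * 2 ^ k * 2 ^ k := by
        rw [← mul_pow, ← mul_pow]; norm_num
      calc _ ≤ A k + r ^ 2 * (2 * (5 * (4 * 2 ^ k) ^ 2 * Λ / r ^ 2)) * (4 * 2 ^ k * A k) := by
            gcongr
        _ = A k + 640 * Λ * 8 ^ k * A k := by
            rw [e8]; field_simp; ring
        _ ≤ _ := by
            have : A k ≤ Λ * 8 ^ k * A k := by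
              have : 1 ≤ Λ * 8 ^ k := by nlinarith
              nlinarith
            linarith)
  have hsup : ∀ k, ∀ t ∈ Icc (T (k + 1)) t₁,
      ∑ x ∈ box z (R (k + 1)), max (v t x - l (k + 1)) 0 ^ 2 ≤ K₁ * 16 ^ k * A k / r ^ 2 := by
    intro k t ht
    have h1 := (hen k).1 t ⟨(hTle k).trans ht.1, ht.2⟩
    have h2 : r ^ 2 * (3 / 8) * p k ≤ t - T k := by linarith [hTs k, ht.1]
    have h3 : 0 ≤ ∑ x ∈ box z (R (k + 1)), max (v t x - l (k + 1)) 0 ^ 2 :=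
      Finset.sum_nonneg fun _ _ => sq_nonneg _
    have h4 := (mul_le_mul_of_nonneg_right h2 h3).trans h1
    rw [le_div_iff₀ hr2]
    have e16 : (16 : ℝ) ^ k = 8 ^ k * (p k)⁻¹ := by rw [hpi, ← mul_pow]; norm_num
    have h5 : 0 ≤ 8 ^ k * A k * Λ := by have := hA0 k; positivity
    have h6 := mul_le_mul_of_nonneg_left h4 (inv_pos.2 (hp0 k)).le
    have h7 : (p k)⁻¹ * (r ^ 2 * (3 / 8) * p k * ∑ x ∈ box z (R (k + 1)),
        max (v t x - l (k + 1)) 0 ^ 2) = (3 / 8) *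
        ((∑ x ∈ box z (R (k + 1)), max (v t x - l (k + 1)) 0 ^ 2) * r ^ 2) := by
      have := (hp0 k).ne'; field_simp
    rw [h7] at h6
    rw [e16, hK₁]
    have h8 : 0 ≤ (p k)⁻¹ * (8 ^ k * A k * Λ) := mul_nonneg (inv_pos.2 (hp0 k)).le h5
    nlinarith
  have hdir : ∀ k, ∀ A', box z (R k) ⊆ A' → ∫ t in (T (k + 1))..t₁, dirichlet C A'
      (fun x => cutoff z (R (k + 1)) (R k) x * max (v t x - l (k + 1)) 0) ≤
      K₁ * 16 ^ k * A k / r ^ 2 := by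
    intro k A' hA'
    have h1 := (hen k).2 (T (k + 1)) ⟨hTle k, hT1' _⟩ A' hA'
    rw [hTs k] at h1
    set I := ∫ t in (T (k + 1))..t₁, dirichlet C A'
      (fun x => cutoff z (R (k + 1)) (R k) x * max (v t x - l (k + 1)) 0)
    rw [le_div_iff₀ hr2]
    have e16 : (16 : ℝ) ^ k = 8 ^ k * (p k)⁻¹ := by rw [hpi, ← mul_pow]; norm_num
    have h5 : 0 ≤ 8 ^ k * A k * Λ := by have := hA0 k; positivity
    have h6 := mul_le_mul_of_nonneg_left h1 (inv_pos.2 (hp0 k)).le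
    have h7 : (p k)⁻¹ * (r ^ 2 * (3 / 8) * p k * I) = (3 / 8) * (I * r ^ 2) := by
      have := (hp0 k).ne'; field_simp
    rw [h7] at h6
    rw [e16, hK₁]
    have h8 : 0 ≤ (p k)⁻¹ * (8 ^ k * A k * Λ) := mul_nonneg (inv_pos.2 (hp0 k)).le h5
    nlinarith
  -- two steps of the iteration, through the Nash inequality at scale `σ r`
  have hstep : ∀ k σ, 0 < σ → A (k + 2) / r ^ (d + 2) ≤ K * 1024 ^ k *
      (σ ^ 2 * (A (k + 1) / r ^ (d + 2)) + (σ ^ d)⁻¹ * (A k / r ^ (d + 2)) ^ 2) := by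
    intro k σ hσ
    have hRk : 0 ≤ R (k + 1) := by linarith [hR0 (k + 1)]
    set A' := box z (R (k + 1) + σ * r + M) with hA'
    have hAA' : box z (R (k + 1)) ⊆ A' := by
      refine box_subset_box z hRk ?_
      have := h.one_le_range
      have := mul_pos hσ hr
      linarith
    set η := cutoff z (R (k + 2)) (R (k + 1)) with hη
    have hη0 : ∀ x, x ∉ box z (R (k + 1)) → η x = 0 := fun x hx =>
      cutoff_eq_zero z (hRlt _) hRk hx
    set E : ℝ → ℝ := fun t => dirichlet C A' (fun x => η x * max (v t x - l (k + 2)) 0) with hE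
    set Y : ℝ := 8 * 2 ^ k * (K₁ * 16 ^ k * A k / r ^ 2) with hY
    have hY0 : 0 ≤ Y := by have := hA0 k; positivity
    have hsr : 0 < σ * r := mul_pos hσ hr
    have hpt : ∀ t ∈ Icc (T (k + 2)) t₁, ∑ x ∈ box z (R (k + 2)), max (v t x - l (k + 2)) 0 ^ 2 ≤
        2 * (d * (σ * r)) ^ 2 * Λ * E t + 2 * ((σ * r) ^ d)⁻¹ * Y ^ 2 := by
      intro t ht
      have h1 := h.nash z hRk hsr (fun x => η x * max (v t x - l (k + 2)) 0)
        (fun x hx => by rw [hη0 x hx, zero_mul])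
      have h2 : ∑ x ∈ box z (R (k + 2)), max (v t x - l (k + 2)) 0 ^ 2 ≤
          ∑ x ∈ box z (R (k + 1)), (η x * max (v t x - l (k + 2)) 0) ^ 2 := by
        calc _ = ∑ x ∈ box z (R (k + 2)), (η x * max (v t x - l (k + 2)) 0) ^ 2 :=
              Finset.sum_congr rfl fun x hx => by
                rw [hη, cutoff_eq_one z (hRlt _) (by linarith [hR0 (k + 2)]) hx, one_mul]
          _ ≤ _ := Finset.sum_le_sum_of_subset_of_nonneg (hbox _) fun _ _ _ => sq_nonneg _
      have h3 : ∑ x ∈ box z (R (k + 1)), |η x * max (v t x - l (k + 2)) 0| ≤ Y := by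
        calc _ ≤ ∑ x ∈ box z (R (k + 1)), 4 * 2 ^ (k + 1) * max (v t x - l (k + 1)) 0 ^ 2 := by
              refine Finset.sum_le_sum fun x _ => ?_
              rw [abs_mul, abs_of_nonneg (le_max_right (v t x - l (k + 2)) 0)]
              refine le_trans ?_ (htr (k + 1) t x)
              exact mul_le_of_le_one_left (le_max_right _ _) (abs_cutoff_le_one z x)
          _ ≤ Y := by
              rw [← Finset.mul_sum, hY]
              have := hsup k t ⟨(hTle _).trans ht.1, ht.2⟩
              have e : (4 : ℝ) * 2 ^ (k + 1) = 8 * 2 ^ k := by rw [pow_succ]; ring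
              rw [e]
              gcongr
      have h4 : 0 ≤ ∑ x ∈ box z (R (k + 1)), |η x * max (v t x - l (k + 2)) 0| :=
        Finset.sum_nonneg fun _ _ => abs_nonneg _
      refine h2.trans (h1.trans ?_)
      rw [mul_assoc _ Λ]
      gcongr
    have hEc : ContinuousOn E (Icc (T (k + 2)) t₁) := by
      refine continuousOn_finsetSum _ fun x _ => continuousOn_finsetSum _ fun y _ => ?_
      have hvc : ∀ x ∈ box z (R (k + 1)), ContinuousOn (fun t => v t x) (Icc (T (k + 2)) t₁) :=
        fun x hx => ((hv x (hboxr _ hx)).1).mono (Icc_subset_Icc (hT0 _) le_rfl)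
      have h1 := continuousOn_cutoff_mul (ℓ := l (k + 2)) hvc hη0 x
      have h2 := continuousOn_cutoff_mul (ℓ := l (k + 2)) hvc hη0 y
      exact continuousOn_const.mul ((h1.sub h2).pow 2)
    have hI : A (k + 2) ≤ 2 * (d * (σ * r)) ^ 2 * Λ * (K₁ * 16 ^ (k + 1) * A (k + 1) / r ^ 2)
        + r ^ 2 * (2 * ((σ * r) ^ d)⁻¹ * Y ^ 2) := by
      have i0 : IntervalIntegrable (fun t => 2 * (d * (σ * r)) ^ 2 * Λ * E t) volume
          (T (k + 2)) t₁ := hint _ (continuousOn_const.mul hEc)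
      have i1 : A (k + 2) ≤ ∫ t in (T (k + 2))..t₁,
          (2 * (d * (σ * r)) ^ 2 * Λ * E t + 2 * ((σ * r) ^ d)⁻¹ * Y ^ 2) :=
        intervalIntegral.integral_mono_on (hT1' _) (hint _ (hcont _ _ _))
          (i0.add intervalIntegrable_const) hpt
      rw [intervalIntegral.integral_add i0 intervalIntegrable_const,
        intervalIntegral.integral_const_mul, intervalIntegral.integral_const, smul_eq_mul] at i1
      refine i1.trans (add_le_add ?_ ?_)
      · have := hdir (k + 1) A' hAA'
        gcongr
      · refine mul_le_mul_of_nonneg_right ?_ (by positivity)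
        linarith [hT0 (k + 2)]
    rw [div_le_iff₀ (by positivity)]
    refine hI.trans ?_
    have e1 : 2 * (d * (σ * r)) ^ 2 * Λ * (K₁ * 16 ^ (k + 1) * A (k + 1) / r ^ 2) =
        (32 * d ^ 2 * Λ * K₁) * 16 ^ k * (σ ^ 2 * A (k + 1)) := by
      rw [pow_succ (16 : ℝ)]; field_simp; ring
    have e1024 : (1024 : ℝ) ^ k = (2 ^ k) ^ 2 * (16 ^ k) ^ 2 := by
      rw [← pow_mul, ← pow_mul, mul_comm k, pow_mul, pow_mul, ← mul_pow]; norm_num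
    have e2 : r ^ 2 * (2 * ((σ * r) ^ d)⁻¹ * Y ^ 2) =
        (128 * K₁ ^ 2) * 1024 ^ k * ((σ ^ d)⁻¹ * (A k / r ^ (d + 2)) ^ 2) * r ^ (d + 2) := by
      rw [hY, e1024, mul_pow σ r d, pow_add r d 2]; field_simp; ring
    have e3 : K * 1024 ^ k * (σ ^ 2 * (A (k + 1) / r ^ (d + 2)) + (σ ^ d)⁻¹ *
        (A k / r ^ (d + 2)) ^ 2) * r ^ (d + 2) = K * 1024 ^ k * (σ ^ 2 * A (k + 1)) +
        K * 1024 ^ k * ((σ ^ d)⁻¹ * (A k / r ^ (d + 2)) ^ 2) * r ^ (d + 2) := by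
      field_simp
    rw [e1, e2, e3]
    have hAk := hA0 (k + 1)
    have hdp : 0 ≤ (d : ℝ) ^ 2 * Λ * K₁ := by positivity
    have hKp : 0 ≤ K₁ ^ 2 := by positivity
    have hK2 : 32 * d ^ 2 * Λ * K₁ ≤ K := by rw [hK]; linarith
    have hK3 : 128 * K₁ ^ 2 ≤ K := by rw [hK]; linarith
    gcongr
    norm_num
  -- the starting values
  have hA0' : A 0 ≤ δ * r ^ (d + 2) := by
    have e1 : T 0 = t₁ - r ^ 2 := by simp only [hT, hp]; ring
    have e2 : R 0 = r := by simp only [hR, hp]; ring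
    have e3 : l 0 = 0 := by simp [hl, hp]
    simp only [hA, e1, e2, e3, sub_zero]
    exact hsmall
  have hA1 : A 1 ≤ A 0 := by
    have i1 : A 1 ≤ ∫ t in (T 1)..t₁, ∑ x ∈ box z (R 0), max (v t x - l 0) 0 ^ 2 :=
      intervalIntegral.integral_mono_on (hT1' _) (hint _ (hcont _ _ _)) (hint _ (hcont _ _ _))
        fun t _ => (Finset.sum_le_sum fun x _ => hmono 0 t x).trans
          (Finset.sum_le_sum_of_subset_of_nonneg (hbox 0) fun _ _ _ => sq_nonneg _)
    refine i1.trans ?_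
    exact intervalIntegral.integral_mono_interval (hTle 0) (hT1' _) le_rfl
      (ae_of_all _ fun t => Finset.sum_nonneg fun _ _ => sq_nonneg _) (hint _ (hcont _ _ _))
  have hconv := hrec (fun k => A k / r ^ (d + 2)) (fun k => by have := hA0 k; positivity)
    (by rw [div_le_iff₀ (by positivity)]; exact hA0')
    (by rw [div_le_iff₀ (by positivity)]; exact hA1.trans hA0') hstep
  -- if `v` exceeded `1 / 2` somewhere in the limiting cylinder, then `A k` would stay away from `0`
  intro t ht x hx
  by_contra hcon
  push Not at hcon
  have hle : t₁ - r ^ 2 / 4 < t₁ := by linarith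
  have hxr : x ∈ box z r := box_subset_box z (by linarith) (by linarith) hx
  have hgc : ContinuousOn (fun t => max (v t x - 1 / 2) 0 ^ 2) (Icc (t₁ - r ^ 2 / 4) t₁) :=
    ((hv.continuousOn_trunc (1 / 2) hxr).pow 2).mono (Icc_subset_Icc (by linarith) le_rfl)
  have hpos : 0 < ∫ t in (t₁ - r ^ 2 / 4)..t₁, max (v t x - 1 / 2) 0 ^ 2 := by
    refine intervalIntegral.integral_pos hle hgc (fun _ _ => sq_nonneg _) ⟨t, ht, ?_⟩
    have : 0 < max (v t x - 1 / 2) 0 := lt_max_of_lt_left (by linarith)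
    positivity
  obtain ⟨k, hk⟩ := hconv ((∫ t in (t₁ - r ^ 2 / 4)..t₁, max (v t x - 1 / 2) 0 ^ 2) /
    r ^ (d + 2) / 2) (by positivity)
  have hxk : x ∈ box z (R k) := box_subset_box z (by linarith) (hR0 k) hx
  have hfin : (∫ t in (t₁ - r ^ 2 / 4)..t₁, max (v t x - 1 / 2) 0 ^ 2) ≤ A k := by
    have i1 : (∫ t in (t₁ - r ^ 2 / 4)..t₁, max (v t x - 1 / 2) 0 ^ 2) ≤
        ∫ t in (T k)..t₁, max (v t x - 1 / 2) 0 ^ 2 :=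
      intervalIntegral.integral_mono_interval (hT1 k) hle.le le_rfl
        (ae_of_all _ fun t => sq_nonneg _) (hint k
          (((hv.continuousOn_trunc (1 / 2) hxr).pow 2).mono (Icc_subset_Icc (hT0 k) le_rfl)))
    refine i1.trans ?_
    refine intervalIntegral.integral_mono_on (hT1' k) (hint k
          (((hv.continuousOn_trunc (1 / 2) hxr).pow 2).mono (Icc_subset_Icc (hT0 k) le_rfl)))
          (hint k (hcont _ _ _)) fun t _ => ?_
    have : max (v t x - 1 / 2) 0 ^ 2 ≤ max (v t x - l k) 0 ^ 2 := by
      have : l k ≤ 1 / 2 := by have := hp0 k; simp only [hl]; linarith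
      gcongr
    exact this.trans (Finset.single_le_sum (f := fun x => max (v t x - l k) 0 ^ 2)
      (fun _ _ => sq_nonneg _) hxk)
  have : A k / r ^ (d + 2) < A k / r ^ (d + 2) := by
    calc A k / r ^ (d + 2) ≤ _ := hk
      _ < (∫ t in (t₁ - r ^ 2 / 4)..t₁, max (v t x - 1 / 2) 0 ^ 2) / r ^ (d + 2) :=
          half_lt_self (by positivity)
      _ ≤ _ := by gcongr
  exact lt_irrefl _ this

/-! ### The logarithmic estimate -/

/-- The argument of the logarithm in `logPot`: `s + ε` for `0 ≤ s ≤ 1 - ε`, truncated to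
`[ε, 1]`. -/
noncomputable def logArg (ε s : ℝ) : ℝ := min 1 (max s 0 + ε)

/-- A convex, nonnegative and nonincreasing `C¹` function which is `m - 1 - log m` with
`m = s + ε` for `0 ≤ s ≤ 1 - ε`, is `0` to the right of this interval, and is affine to the left. -/
noncomputable def logPot (ε s : ℝ) : ℝ :=
  logArg ε s - 1 - Real.log (logArg ε s) + (1 / ε - 1) * max (-s) 0

/-- The derivative of `logPot`. -/
noncomputable def logSlope (ε s : ℝ) : ℝ := 1 - 1 / logArg ε s

lemma le_logArg {ε : ℝ} (hε1 : ε < 1) (s : ℝ) : ε ≤ logArg ε s :=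
  le_min hε1.le (by linarith [le_max_right s 0])

lemma logArg_pos {ε : ℝ} (hε0 : 0 < ε) (hε1 : ε < 1) (s : ℝ) : 0 < logArg ε s := hε0.trans_le (le_logArg hε1 s)

lemma logArg_le_one {ε : ℝ} (s : ℝ) : logArg ε s ≤ 1 := min_le_left _ _

lemma logSlope_nonpos {ε : ℝ} (hε0 : 0 < ε) (hε1 : ε < 1) (s : ℝ) : logSlope ε s ≤ 0 := by
  have h1 := logArg_pos hε0 hε1 s
  have h2 := logArg_le_one (ε := ε) s
  have : 1 ≤ 1 / logArg ε s := by rw [le_div_iff₀ h1]; linarith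
  rw [logSlope]; linarith

lemma neg_logSlope_le {ε : ℝ} (hε0 : 0 < ε) (hε1 : ε < 1) (s : ℝ) : -logSlope ε s ≤ 1 / ε - 1 := by
  have := one_div_le_one_div_of_le hε0 (le_logArg hε1 s)
  rw [logSlope]; linarith

lemma logSlope_mul_le {ε : ℝ} (hε0 : 0 < ε) (hε1 : ε < 1) (a b : ℝ) :
    logSlope ε a * (b - a) ≤ logPot ε b - logPot ε a := by
  have ha := logArg_pos hε0 hε1 a
  have hb := logArg_pos hε0 hε1 b
  have hlog : Real.log (logArg ε b) - Real.log (logArg ε a) ≤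
      (logArg ε b - logArg ε a) * (1 / logArg ε a) := by
    rw [← Real.log_div hb.ne' ha.ne']
    refine (Real.log_le_sub_one_of_pos (by positivity)).trans (le_of_eq ?_)
    field_simp
  have hg0 := logSlope_nonpos hε0 hε1 a
  have hg1 := neg_logSlope_le hε0 hε1 a
  have hpos : 0 ≤ 1 / ε - 1 := by
    have : 1 ≤ 1 / ε := by rw [le_div_iff₀ hε0]; linarith
    linarith
  have key : 0 ≤ -logSlope ε a * ((b - a) - (logArg ε b - logArg ε a)) +
      (1 / ε - 1) * (max (-b) 0 - max (-a) 0) := by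
    rcases lt_or_ge a 0 with h0 | h0
    · have h1 : logArg ε a = ε := by
        rw [logArg, max_eq_right h0.le, zero_add, min_eq_right hε1.le]
      have h2 : -logSlope ε a = 1 / ε - 1 := by rw [logSlope, h1]; ring
      rw [h2, ← mul_add, max_eq_left (by linarith : 0 ≤ -a), h1]
      refine mul_nonneg hpos ?_
      have h3 : logArg ε b ≤ max b 0 + ε := min_le_right _ _
      have h4 : max b 0 - max (-b) 0 = b := by
        rcases le_total b 0 with hb | hb
        · rw [max_eq_right hb, max_eq_left (by linarith)]; ring
        · rw [max_eq_left hb, max_eq_right (by linarith)]; ring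
      linarith
    · rw [max_eq_right (by linarith : -a ≤ 0), sub_zero]
      have h3 : logArg ε b ≤ max b 0 + ε := min_le_right _ _
      have h4 : max b 0 - max (-b) 0 = b := by
        rcases le_total b 0 with hb | hb
        · rw [max_eq_right hb, max_eq_left (by linarith)]; ring
        · rw [max_eq_left hb, max_eq_right (by linarith)]; ring
      have h5 : 0 ≤ max (-b) 0 := le_max_right _ _
      rcases le_total 1 (a + ε) with h1 | h1
      · have h6 : logSlope ε a = 0 := by
          rw [logSlope, logArg, max_eq_left h0, min_eq_left h1]; norm_num
        rw [h6]
        have := mul_nonneg hpos h5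
        linarith
      · have h6 : logArg ε a = a + ε := by rw [logArg, max_eq_left h0, min_eq_right h1]
        have h7 : -max (-b) 0 ≤ (b - a) - (logArg ε b - logArg ε a) := by rw [h6]; linarith
        have h8 := mul_le_mul_of_nonneg_left h7 (neg_nonneg.2 hg0)
        have h9 := mul_le_mul_of_nonneg_right hg1 h5
        linarith
  have e : (logArg ε b - logArg ε a) * (1 / logArg ε a) =
      (logArg ε b - logArg ε a) - logSlope ε a * (logArg ε b - logArg ε a) := by
    rw [logSlope]; ring
  rw [e] at hlog
  rw [logPot, logPot]
  nlinarith

lemma hasDerivAt_logPot {ε : ℝ} (hε0 : 0 < ε) (hε1 : ε < 1) (a : ℝ) : HasDerivAt (logPot ε) (logSlope ε a) a := by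
  refine hasDerivAt_of_subgradient (logSlope_mul_le hε0 hε1) ?_
  have h1 : Continuous (logArg ε) := by unfold logArg; fun_prop
  have : Continuous (logSlope ε) :=
    continuous_const.sub (continuous_const.div h1 fun s => (logArg_pos hε0 hε1 s).ne')
  exact this.continuousAt

lemma logPot_nonneg {ε : ℝ} (hε0 : 0 < ε) (hε1 : ε < 1) (s : ℝ) : 0 ≤ logPot ε s := by
  have h1 := Real.log_le_sub_one_of_pos (logArg_pos hε0 hε1 s)
  have hpos : 0 ≤ 1 / ε - 1 := by
    have : 1 ≤ 1 / ε := by rw [le_div_iff₀ hε0]; linarith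
    linarith
  have := mul_nonneg hpos (le_max_right (-s) 0)
  rw [logPot]; linarith

lemma logPot_le {ε : ℝ} (hε0 : 0 < ε) (hε1 : ε < 1) (s : ℝ) : logPot ε s ≤ -Real.log ε + max (-s) 0 / ε := by
  have h1 := Real.log_le_log hε0 (le_logArg hε1 s)
  have h2 := logArg_le_one (ε := ε) s
  have h3 : 0 ≤ max (-s) 0 := le_max_right _ _
  have e : (1 / ε - 1) * max (-s) 0 = max (-s) 0 / ε - max (-s) 0 := by ring
  rw [logPot, e]; linarith

lemma logPot_eq_zero {ε : ℝ} (hε0 : 0 < ε) (hε1 : ε < 1) {s : ℝ} (hs : 1 ≤ s) : logPot ε s = 0 := by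
  have : logArg ε s = 1 := by
    rw [logArg, max_eq_left (by linarith), min_eq_left (by linarith)]
  rw [logPot, this, max_eq_right (by linarith)]; simp

lemma le_of_logPot_le {ε : ℝ} (hε0 : 0 < ε) (hε1 : ε < 1) {s : ℝ} (hs : 0 ≤ s) (h : logPot ε s ≤ -Real.log ε / 2) :
    Real.exp (Real.log ε / 2 - 1) - ε ≤ s := by
  have h0 := logArg_pos hε0 hε1 s
  rw [logPot, max_eq_right (by linarith : -s ≤ 0), mul_zero, add_zero] at h
  have h1 : Real.log ε / 2 - 1 ≤ Real.log (logArg ε s) := by linarith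
  have h2 := (Real.le_log_iff_exp_le h0).1 h1
  have h3 : logArg ε s ≤ max s 0 + ε := min_le_right _ _
  rw [max_eq_left hs] at h3
  linarith

/-- The algebraic inequality behind the logarithmic estimate: it holds because
`(b - a) (1 / a - 1 / b) = (b - a)² / (a b)` dominates `(log b - log a)²`. -/
lemma logSlope_pair {ε : ℝ} (hε0 : 0 < ε) (hε1 : ε < 1) {a b : ℝ} (p q : ℝ)
    (ha : 0 ≤ a) (hb : 0 ≤ b) :
    (b - a) * (p ^ 2 * logSlope ε a - q ^ 2 * logSlope ε b) ≤
      -(1 / 8) * min (p ^ 2) (q ^ 2) * (logPot ε a - logPot ε b) ^ 2 + 3 * (p - q) ^ 2 := by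
  wlog hab : a ≤ b generalizing a b p q
  · have := this q p hb ha (le_of_not_ge hab)
    rw [min_comm] at this
    linarith
  set m := logArg ε a with hm
  set n := logArg ε b with hn
  have hm0 : 0 < m := logArg_pos hε0 hε1 a
  have hn0 : 0 < n := logArg_pos hε0 hε1 b
  have hn1 : n ≤ 1 := logArg_le_one b
  have hmn : m ≤ n := by
    rw [hm, hn, logArg, logArg, max_eq_left ha, max_eq_left hb]
    exact min_le_min le_rfl (by linarith)
  have hdiff : n - m ≤ b - a := by
    rw [hm, hn, logArg, logArg, max_eq_left ha, max_eq_left hb]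
    rcases le_total 1 (a + ε) with h | h
    · rw [min_eq_left h, min_eq_left (by linarith)]; linarith
    · rw [min_eq_right h]
      linarith [min_le_right 1 (b + ε)]
  set P := (b - a) * (1 / m - 1 / n) with hP
  set B := (b - a) * (1 / n - 1) with hB
  set H := logPot ε a - logPot ε b with hH
  have hmn' : 0 ≤ 1 / m - 1 / n := by
    have := one_div_le_one_div_of_le hm0 hmn; linarith
  have hP1 : (n - m) ^ 2 / (m * n) ≤ P := by
    have e : (n - m) ^ 2 / (m * n) = (n - m) * (1 / m - 1 / n) := by field_simp
    rw [e]; exact mul_le_mul_of_nonneg_right hdiff hmn'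
  have hP0 : 0 ≤ P := mul_nonneg (by linarith) hmn'
  have hn1' : 0 ≤ 1 / n - 1 := by
    have : 1 ≤ 1 / n := by rw [le_div_iff₀ hn0]; linarith
    linarith
  have hB0 : 0 ≤ B := mul_nonneg (by linarith) hn1'
  have hB1 : B ≤ (n - m) / n := by
    rcases le_or_gt 1 (b + ε) with h | h
    · have : n = 1 := by rw [hn, logArg, max_eq_left hb, min_eq_left h]
      rw [hB, this]; simp; linarith
    · have h1 : n = b + ε := by rw [hn, logArg, max_eq_left hb, min_eq_right h.le]
      have h2 : m = a + ε := by rw [hm, logArg, max_eq_left ha, min_eq_right (by linarith)]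
      have h3 : b - a = n - m := by rw [h1, h2]; ring
      have e : (n - m) / n = (n - m) * (1 / n) := by ring
      rw [hB, h3, e]
      exact mul_le_mul_of_nonneg_left (by linarith) (by linarith)
  have hB2 : B ≤ 1 := hB1.trans (by rw [div_le_one hn0]; linarith)
  have hB3 : B ^ 2 ≤ P := by
    refine (pow_le_pow_left₀ hB0 hB1 2).trans (le_trans ?_ hP1)
    rw [div_pow]
    apply div_le_div_of_nonneg_left (sq_nonneg _) (by positivity)
    nlinarith
  have hH1 : H = Real.log (n / m) - (n - m) := by
    rw [hH, logPot, logPot, max_eq_right (by linarith : -a ≤ 0),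
      max_eq_right (by linarith : -b ≤ 0), Real.log_div hn0.ne' hm0.ne']
    ring
  have hx1 : 1 ≤ n / m := by rw [le_div_iff₀ hm0]; linarith
  have hH0 : 0 ≤ H := by
    have h1 := Real.one_sub_inv_le_log_of_pos (x := n / m) (by positivity)
    have h2 : n - m ≤ 1 - (n / m)⁻¹ := by
      have e : 1 - (n / m)⁻¹ = (n - m) / n := by field_simp
      rw [e, le_div_iff₀ hn0]; nlinarith
    linarith
  have hH2 : H ^ 2 ≤ 4 * P := by
    set y := Real.sqrt (n / m) with hy
    have hy2 : y ^ 2 = n / m := Real.sq_sqrt (by positivity)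
    have hy1 : 1 ≤ y := by rw [hy, Real.one_le_sqrt]; exact hx1
    have h1 : Real.log (n / m) ≤ 2 * (y - 1) := by
      rw [← hy2, Real.log_pow]
      have := Real.log_le_sub_one_of_pos (x := y) (by linarith)
      push_cast; linarith
    have h2 : H ≤ 2 * (y - 1) := by linarith
    have h3 : (y - 1) ^ 2 ≤ (n - m) ^ 2 / (m * n) := by
      have e : (n - m) ^ 2 / (m * n) = (y ^ 2 - 1) ^ 2 / y ^ 2 := by
        rw [hy2]; field_simp
      rw [e, le_div_iff₀ (by positivity)]
      have e2 : (y ^ 2 - 1) ^ 2 = (y - 1) ^ 2 * (y + 1) ^ 2 := by ring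
      rw [e2]
      exact mul_le_mul_of_nonneg_left (pow_le_pow_left₀ (by linarith) (by linarith) 2)
        (sq_nonneg _)
    have h4 := pow_le_pow_left₀ hH0 h2 2
    have h5 : (2 * (y - 1)) ^ 2 = 4 * (y - 1) ^ 2 := by ring
    rw [h5] at h4
    linarith
  have hmin : min (p ^ 2) (q ^ 2) * H ^ 2 ≤ p ^ 2 * H ^ 2 :=
    mul_le_mul_of_nonneg_right (min_le_left _ _) (sq_nonneg _)
  have e : (b - a) * (p ^ 2 * logSlope ε a - q ^ 2 * logSlope ε b) =
      B * (q - p) ^ 2 + 2 * (B * p) * (q - p) - p ^ 2 * P := by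
    rw [hB, hP, logSlope, logSlope]; ring
  rw [e]
  have f1 : B * (q - p) ^ 2 ≤ 1 * (q - p) ^ 2 := mul_le_mul_of_nonneg_right hB2 (sq_nonneg _)
  have f2 : 2 * (B * p) * (q - p) ≤ (1 / 2) * (B * p) ^ 2 + 2 * (q - p) ^ 2 := by
    nlinarith [sq_nonneg (B * p - 2 * (q - p))]
  have f3 : (B * p) ^ 2 ≤ P * p ^ 2 := by
    rw [mul_pow]; exact mul_le_mul_of_nonneg_right hB3 (sq_nonneg _)
  have f4 : p ^ 2 * H ^ 2 ≤ p ^ 2 * (4 * P) := mul_le_mul_of_nonneg_left hH2 (sq_nonneg _)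
  have f5 : (q - p) ^ 2 = (p - q) ^ 2 := by ring
  rw [f5] at f1 f2 ⊢
  linarith

/-- `u` solves the heat equation `∂ₜ u = L u` at the points of `A`, for times in `[a, b]`. -/
def Sol {d : ℕ} (C : Lattice d → Lattice d → ℝ) (u : ℝ → Lattice d → ℝ) (a b : ℝ)
    (A : Finset (Lattice d)) : Prop :=
  ∀ x ∈ A, ContinuousOn (fun t => u t x) (Icc a b) ∧
    ∀ t ∈ Ioo a b, HasDerivAt (fun t => u t x) (gen C (u t) x) t

lemma Sol.mono {d : ℕ} {C : Lattice d → Lattice d → ℝ} {u : ℝ → Lattice d → ℝ} {a b a' b' : ℝ}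
    {A A' : Finset (Lattice d)} (h : Sol C u a b A) (ha : a ≤ a') (hb : b' ≤ b) (hA : A' ⊆ A) :
    Sol C u a' b' A' := fun x hx =>
  ⟨(h x (hA hx)).1.mono (Icc_subset_Icc ha hb), fun t ht =>
    (h x (hA hx)).2 t (Ioo_subset_Ioo ha hb ht)⟩

lemma gen_affine {d : ℕ} {C : Lattice d → Lattice d → ℝ} (f : Lattice d → ℝ) (α β : ℝ)
    (x : Lattice d) : gen C (fun y => α * f y + β) x = α * gen C f x := by
  rw [gen, gen, ← tsum_mul_left]
  exact tsum_congr fun y => by ring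

lemma Sol.affine {d : ℕ} {C : Lattice d → Lattice d → ℝ} {u : ℝ → Lattice d → ℝ} {a b : ℝ}
    {A : Finset (Lattice d)} (h : Sol C u a b A) (α β : ℝ) :
    Sol C (fun t x => α * u t x + β) a b A := fun x hx =>
  ⟨(continuousOn_const.mul (h x hx).1).add continuousOn_const, fun t ht => by
    rw [gen_affine]
    exact (((h x hx).2 t ht).const_mul α).add_const β⟩

lemma Sol.subSol {d : ℕ} {C : Lattice d → Lattice d → ℝ} {u : ℝ → Lattice d → ℝ} {a b : ℝ}
    {A : Finset (Lattice d)} (h : Sol C u a b A) : SubSol C u a b A := fun x hx =>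
  ⟨(h x hx).1, fun t ht => ⟨_, (h x hx).2 t ht, le_rfl⟩⟩

lemma SubSol.const_mul {d : ℕ} {C : Lattice d → Lattice d → ℝ} {u : ℝ → Lattice d → ℝ} {a b : ℝ}
    {A : Finset (Lattice d)} (h : SubSol C u a b A) {α : ℝ} (hα : 0 ≤ α) :
    SubSol C (fun t x => α * u t x) a b A := fun x hx =>
  ⟨continuousOn_const.mul (h x hx).1, fun t ht => by
    obtain ⟨v', h1, h2⟩ := (h x hx).2 t ht
    refine ⟨_, h1.const_mul α, ?_⟩
    have := gen_affine (C := C) (u t) α 0 x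
    simp only [add_zero] at this
    rw [this]
    exact mul_le_mul_of_nonneg_left h2 hα⟩

lemma abs_logPot_le {ε : ℝ} (hε0 : 0 < ε) (hε1 : ε < 1) {s B : ℝ} (hs : |s| ≤ B) :
    |logPot ε s| ≤ -Real.log ε + B / ε := by
  rw [abs_of_nonneg (logPot_nonneg hε0 hε1 s)]
  refine (logPot_le hε0 hε1 s).trans ?_
  have : max (-s) 0 ≤ B := max_le (by linarith [neg_abs_le s]) ((abs_nonneg s).trans hs)
  gcongr

/-- Convex functions of solutions are subsolutions. -/
lemma Sol.subSol_logPot {d : ℕ} {C : Lattice d → Lattice d → ℝ} {Λ M : ℝ} (h : Elliptic C Λ M)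
    {u : ℝ → Lattice d → ℝ} {a b B ε : ℝ} {A : Finset (Lattice d)} (hε0 : 0 < ε) (hε1 : ε < 1)
    (hu : Sol C u a b A) (hB : ∀ t ∈ Icc a b, ∀ x, |u t x| ≤ B) :
    SubSol C (fun t x => logPot ε (u t x)) a b A := fun x hx => by
  have hc : Continuous (logPot ε) := continuous_iff_continuousAt.2 fun s =>
    (hasDerivAt_logPot hε0 hε1 s).continuousAt
  refine ⟨hc.comp_continuousOn (hu x hx).1, fun t ht => ?_⟩
  refine ⟨_, (hasDerivAt_logPot hε0 hε1 _).comp t ((hu x hx).2 t ht), ?_⟩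
  have hBt := hB t (Ioo_subset_Icc_self ht)
  rw [gen, gen, ← tsum_mul_left]
  refine Summable.tsum_le_tsum (fun y => ?_) ((h.summable_gen x hBt).mul_left _)
    (h.summable_gen x (f := fun y => logPot ε (u t y)) fun y => abs_logPot_le hε0 hε1 (hBt y))
  have := mul_le_mul_of_nonneg_left (logSlope_mul_le hε0 hε1 (u t x) (u t y)) (h.nonneg x y)
  linarith

/-- The logarithmic estimate at a fixed time. -/
lemma Elliptic.sum_logSlope_gen_le {d : ℕ} {C : Lattice d → Lattice d → ℝ} {Λ M : ℝ}
    (h : Elliptic C Λ M) {z : Lattice d} {r ε B : ℝ} (hr : 0 < r) (hε0 : 0 < ε) (hε1 : ε < 1)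
    {u : Lattice d → ℝ} (hB : ∀ x, |u x| ≤ B) (hu : ∀ x ∈ box z r, 0 ≤ u x)
    (hgrow : ∀ x, -(ε * (‖x - z‖ ^ 2 / r ^ 2)) ≤ u x) :
    ∑ x ∈ box z r, cutoff z (r / 2) (3 * r / 4) x ^ 2 * (logSlope ε (u x) * gen C u x) ≤
      -(1 / 16) * dirichlet C (box z (r / 2)) (fun x => logPot ε (u x)) +
        65 * Λ / r ^ 2 * (box z r).card := by
  classical
  set ψ := cutoff z (r / 2) (3 * r / 4) with hψ
  set A := box z r with hA
  have h12 : r / 2 < 3 * r / 4 := by linarith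
  set g : Lattice d → Lattice d → ℝ := fun x y =>
    C x y * (ψ x ^ 2 * logSlope ε (u x) * (u y - u x)) with hg
  have hgs : ∀ x, Summable (g x) := fun x =>
    ((h.summable_gen x hB).mul_left (ψ x ^ 2 * logSlope ε (u x))).congr fun y => by
      simp only [hg]; ring
  have hhs : ∀ x, Summable fun y => C x y * ‖y - x‖ ^ 2 * (41 / r ^ 2) := fun x =>
    (h.summable_moment x).mul_right _
  have hfar : ∀ x ∈ A, ∀ y, y ∉ A → g x y ≤ C x y * ‖y - x‖ ^ 2 * (41 / r ^ 2) := by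
    intro x hx y hy
    rw [mul_assoc]
    simp only [hg]
    refine mul_le_mul_of_nonneg_left ?_ (h.nonneg x y)
    by_cases hxs : x ∈ box z (3 * r / 4)
    · have hx3 := (mem_box (by positivity)).1 hxs
      rw [hA, mem_box hr.le, not_le] at hy
      have hyz : ‖y - z‖ ≤ ‖y - x‖ + 3 * r / 4 := by
        have : y - z = (y - x) + (x - z) := by abel
        rw [this]
        exact (norm_add_le _ _).trans (by linarith)
      have hyx : r ≤ 4 * ‖y - x‖ := by linarith
      have hyz5 : ‖y - z‖ ≤ 5 * ‖y - x‖ := by linarith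
      have hq1 : 1 ≤ 16 * (‖y - x‖ ^ 2 / r ^ 2) := by
        rw [← mul_div_assoc, le_div_iff₀ (by positivity)]
        nlinarith
      have hq2 : ‖y - z‖ ^ 2 / r ^ 2 ≤ 25 * (‖y - x‖ ^ 2 / r ^ 2) := by
        rw [← mul_div_assoc]
        gcongr
        nlinarith [norm_nonneg (y - z), norm_nonneg (y - x)]
      have hux := hu x hx
      have hs0 := logSlope_nonpos hε0 hε1 (u x)
      have hs1 := neg_logSlope_le hε0 hε1 (u x)
      -- the slope is at most `1 / ε` and at most `1 / u x` in absolute value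
      have hs2 : -logSlope ε (u x) * u x ≤ 1 := by
        have h1 := logArg_pos hε0 hε1 (u x)
        rcases le_total 1 (u x + ε) with h2 | h2
        · have : logSlope ε (u x) = 0 := by
            rw [logSlope, logArg, max_eq_left hux, min_eq_left h2]; norm_num
          rw [this]; norm_num
        · have e : logArg ε (u x) = u x + ε := by
            rw [logArg, max_eq_left hux, min_eq_right h2]
          have h3 : u x / (u x + ε) ≤ 1 := by rw [div_le_one (by linarith)]; linarith
          rw [logSlope, e]
          have e2 : -(1 - 1 / (u x + ε)) * u x = u x / (u x + ε) - u x := by ring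
          rw [e2]; linarith
      have h3 : logSlope ε (u x) * (u y - u x) ≤ 1 + ‖y - z‖ ^ 2 / r ^ 2 := by
        set Q := ‖y - z‖ ^ 2 / r ^ 2 with hQ
        have hQ0 : 0 ≤ Q := by positivity
        have h4 : -logSlope ε (u x) * (-(u y)) ≤ -logSlope ε (u x) * (ε * Q) :=
          mul_le_mul_of_nonneg_left (by linarith [hgrow y]) (by linarith)
        have h5 : -logSlope ε (u x) * (ε * Q) ≤ (1 / ε) * (ε * Q) :=
          mul_le_mul_of_nonneg_right (by linarith) (by positivity)
        have e : (1 / ε) * (ε * Q) = Q := by field_simp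
        nlinarith
      have h6 : ψ x ^ 2 ≤ 1 := cutoff_sq_le_one z x
      have e : ‖y - x‖ ^ 2 * (41 / r ^ 2) = 41 * (‖y - x‖ ^ 2 / r ^ 2) := by ring
      rw [e, mul_assoc]
      calc _ ≤ ψ x ^ 2 * (1 + ‖y - z‖ ^ 2 / r ^ 2) :=
            mul_le_mul_of_nonneg_left h3 (sq_nonneg _)
        _ ≤ 1 * (1 + ‖y - z‖ ^ 2 / r ^ 2) := mul_le_mul_of_nonneg_right h6 (by positivity)
        _ ≤ _ := by linarith
    · have : ψ x = 0 := cutoff_eq_zero z h12 (by positivity) hxs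
      rw [this]
      simp
      positivity
  have h1 : ∀ x ∈ A, ψ x ^ 2 * (logSlope ε (u x) * gen C u x) ≤
      ∑ y ∈ A, g x y + 41 * Λ / r ^ 2 := by
    intro x hx
    have e : ψ x ^ 2 * (logSlope ε (u x) * gen C u x) = ∑' y, g x y := by
      rw [gen, ← mul_assoc, ← tsum_mul_left]
      exact tsum_congr fun y => by simp only [hg]; ring
    rw [e]
    refine (tsum_le_sum_add_tsum A (hgs x) (hhs x) (hfar x hx)).trans (add_le_add ?_ ?_)
    · refine Finset.sum_le_sum fun y _ => ?_
      have : 0 ≤ C x y * ‖y - x‖ ^ 2 * (41 / r ^ 2) := by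
        have := h.nonneg x y; positivity
      linarith
    · rw [tsum_mul_right]
      calc _ ≤ Λ * (41 / r ^ 2) :=
            mul_le_mul_of_nonneg_right (h.tsum_moment_le x) (by positivity)
        _ = _ := by ring
  have h2 : ∑ x ∈ A, ∑ y ∈ A, g x y ≤ ∑ x ∈ A, ∑ y ∈ A,
      (-(1 / 16) * (C x y * (min (ψ x ^ 2) (ψ y ^ 2) * (logPot ε (u x) - logPot ε (u y)) ^ 2)) +
        3 / 2 * (C x y * (ψ x - ψ y) ^ 2)) := by
    refine sum_sum_le_of_symm A _ _ fun x hx y hy => ?_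
    have hp := mul_le_mul_of_nonneg_left
      (logSlope_pair hε0 hε1 (ψ x) (ψ y) (hu x hx) (hu y hy)) (h.nonneg x y)
    simp only [hg, h.symm y x, min_comm (ψ y ^ 2)]
    nlinarith
  have h3 : ∀ x, ∑ y ∈ A, C x y * (ψ x - ψ y) ^ 2 ≤ 16 * Λ / r ^ 2 := by
    intro x
    have hle : ∀ y, C x y * (ψ x - ψ y) ^ 2 ≤ C x y * ‖y - x‖ ^ 2 * (16 / r ^ 2) := by
      intro y
      rw [mul_assoc]
      refine mul_le_mul_of_nonneg_left ?_ (h.nonneg x y)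
      have e : ‖y - x‖ ^ 2 * (16 / r ^ 2) = (‖y - x‖ / (3 * r / 4 - r / 2)) ^ 2 := by
        have : 3 * r / 4 - r / 2 = r / 4 := by ring
        rw [this]; field_simp; norm_num
      rw [e, ← sq_abs (ψ x - ψ y)]
      exact pow_le_pow_left₀ (abs_nonneg _) (abs_cutoff_sub_le z h12 x y) 2
    refine (Finset.sum_le_sum fun y _ => hle y).trans ?_
    rw [← Finset.sum_mul]
    have := (h.summable_moment x).sum_le_tsum A
      (fun y _ => mul_nonneg (h.nonneg x y) (sq_nonneg _))
    calc _ ≤ Λ * (16 / r ^ 2) :=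
          mul_le_mul_of_nonneg_right (this.trans (h.tsum_moment_le x)) (by positivity)
      _ = _ := by ring
  have h4 : dirichlet C (box z (r / 2)) (fun x => logPot ε (u x)) ≤ ∑ x ∈ A, ∑ y ∈ A,
      C x y * (min (ψ x ^ 2) (ψ y ^ 2) * (logPot ε (u x) - logPot ε (u y)) ^ 2) := by
    have hsub : box z (r / 2) ⊆ A := box_subset_box z (by positivity) (by linarith)
    have hnn : ∀ x y, 0 ≤ C x y *
        (min (ψ x ^ 2) (ψ y ^ 2) * (logPot ε (u x) - logPot ε (u y)) ^ 2) := fun x y =>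
      mul_nonneg (h.nonneg x y)
        (mul_nonneg (le_min (sq_nonneg _) (sq_nonneg _)) (sq_nonneg _))
    calc _ = ∑ x ∈ box z (r / 2), ∑ y ∈ box z (r / 2), C x y *
          (min (ψ x ^ 2) (ψ y ^ 2) * (logPot ε (u x) - logPot ε (u y)) ^ 2) := by
          refine Finset.sum_congr rfl fun x hx => Finset.sum_congr rfl fun y hy => ?_
          rw [hψ, cutoff_eq_one z h12 (by positivity) hx, cutoff_eq_one z h12 (by positivity) hy]
          simp
      _ ≤ ∑ x ∈ box z (r / 2), ∑ y ∈ A, C x y *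
          (min (ψ x ^ 2) (ψ y ^ 2) * (logPot ε (u x) - logPot ε (u y)) ^ 2) :=
          Finset.sum_le_sum fun x _ =>
            Finset.sum_le_sum_of_subset_of_nonneg hsub fun y _ _ => hnn x y
      _ ≤ _ := Finset.sum_le_sum_of_subset_of_nonneg hsub fun x _ _ =>
            Finset.sum_nonneg fun y _ => hnn x y
  calc _ ≤ ∑ x ∈ A, (∑ y ∈ A, g x y + 41 * Λ / r ^ 2) := Finset.sum_le_sum h1
    _ = ∑ x ∈ A, ∑ y ∈ A, g x y + A.card * (41 * Λ / r ^ 2) := by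
        rw [Finset.sum_add_distrib, Finset.sum_const, nsmul_eq_mul]
    _ ≤ (-(1 / 16) * ∑ x ∈ A, ∑ y ∈ A, C x y *
          (min (ψ x ^ 2) (ψ y ^ 2) * (logPot ε (u x) - logPot ε (u y)) ^ 2) +
          3 / 2 * ∑ x ∈ A, ∑ y ∈ A, C x y * (ψ x - ψ y) ^ 2) + A.card * (41 * Λ / r ^ 2) := by
        refine add_le_add (h2.trans (le_of_eq ?_)) le_rfl
        simp only [Finset.sum_add_distrib, Finset.mul_sum]
    _ ≤ (-(1 / 16) * dirichlet C (box z (r / 2)) (fun x => logPot ε (u x)) +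
          3 / 2 * (A.card * (16 * Λ / r ^ 2))) + A.card * (41 * Λ / r ^ 2) := by
        have h5 : ∑ x ∈ A, ∑ y ∈ A, C x y * (ψ x - ψ y) ^ 2 ≤ A.card * (16 * Λ / r ^ 2) := by
          refine (Finset.sum_le_sum fun x _ => h3 x).trans (le_of_eq ?_)
          rw [Finset.sum_const, nsmul_eq_mul]
        linarith
    _ = _ := by ring

/-! ### Growth lemma -/

/-- If a nonnegative solution is at least `1/2` on half of a box, then for a short time it remains
at least `1/16` on a fixed portion of it. -/
lemma Sol.card_le {d : ℕ} {C : Lattice d → Lattice d → ℝ} {Λ M : ℝ} (h : Elliptic C Λ M)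
    {z : Lattice d} {r a b B : ℝ} {u : ℝ → Lattice d → ℝ} (hr : 2 ≤ r)
    (hu : Sol C u a b (box z r)) (hB : ∀ t ∈ Icc a b, ∀ x, |u t x| ≤ B)
    (h0 : ∀ t ∈ Icc a b, ∀ x ∈ box z r, 0 ≤ u t x)
    (hgrow : ∀ t ∈ Icc a b, ∀ x, -(‖x - z‖ ^ 2 / r ^ 2) ≤ u t x)
    (hab : 40000 * (Λ * 8 ^ d) ^ 2 * (b - a) ≤ r ^ 2)
    (hhalf : (∑ x ∈ box z (r / 4), cutoff z (r / 8) (r / 4) x ^ 2) / 2 ≤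
      ∑ x ∈ box z (r / 4) with 1 / 2 ≤ u a x, cutoff z (r / 8) (r / 4) x ^ 2)
    {t : ℝ} (ht : t ∈ Icc a b) :
    (r / 8) ^ d / 4 ≤ ((box z (r / 4)).filter fun x => 1 / 16 ≤ u t x).card := by
  have hr0 : 0 < r := by linarith
  have hΛ := h.one_le
  set η := cutoff z (r / 8) (r / 4) with hη
  set A := box z (r / 4) with hA
  have h12 : r / 8 < r / 4 := by linarith
  have hsub : A ⊆ box z r := box_subset_box z (by positivity) (by linarith)
  have hη0 : ∀ x, x ∉ A → η x = 0 := fun x hx => cutoff_eq_zero z h12 (by positivity) hx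
  set w : ℝ → Lattice d → ℝ := fun t x => (-1) * u t x + 1 / 2 with hw
  have hws : Sol C w a b A := (hu.mono le_rfl le_rfl hsub).affine (-1) (1 / 2)
  have hwB : ∀ t ∈ Icc a b, ∀ x, |w t x| ≤ B + 1 / 2 := fun t ht x => by
    have := abs_le.1 (hB t ht x)
    rw [abs_le]; constructor <;> simp only [hw] <;> linarith
  set Φ : ℝ → ℝ := fun t => ∑ x ∈ A, η x ^ 2 * max (w t x - 0) 0 ^ 2 with hΦ
  have hΦc : ContinuousOn Φ (Icc a b) := continuousOn_finsetSum _ fun x hx =>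
    continuousOn_const.mul ((hws.subSol.continuousOn_trunc 0 hx).pow 2)
  set N := 5 * 8 ^ 2 * Λ / r ^ 2 with hN
  have hwle : ∀ t ∈ Icc a b, ∀ x ∈ A, max (w t x - 0) 0 ≤ 1 / 2 := fun t ht x hx => by
    have := h0 t ht x (hsub hx)
    exact max_le (by simp only [hw]; linarith) (by norm_num)
  have hd : ∀ τ ∈ Ioo a b, ∃ Φ', HasDerivAt Φ Φ' τ ∧ Φ' ≤ N * A.card := by
    intro τ hτ
    have hτ' := Ioo_subset_Icc_self hτ
    obtain ⟨Φ', h1, h2⟩ := hws.subSol.energy_deriv h subset_rfl hη0 (abs_cutoff_le_one z) hτ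
      (N := N) (ℓ := 0) (hwB τ hτ') (fun x hx => by
        have hx' : ‖x - z‖ ≤ r := (mem_box hr0.le).1 (hsub hx)
        refine h.tsum_cutoff_le hr0 h12 (by norm_num) (by ring) hx' (fun _ => le_max_right _ _)
          fun y => max_le ?_ (by positivity)
        have := hgrow τ hτ' y
        simp only [hw]; linarith)
    refine ⟨Φ', h1, h2.trans ?_⟩
    have h3 : ∑ x ∈ A, max (w τ x - 0) 0 ≤ A.card * (1 / 2) := by
      refine (Finset.sum_le_sum fun x hx => hwle τ hτ' x hx).trans (le_of_eq ?_)
      rw [Finset.sum_const, nsmul_eq_mul]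
    have h4 := h.dirichlet_nonneg A (fun x => η x * max (w τ x - 0) 0)
    have hN0 : 0 ≤ N := by have := h.pos; positivity
    nlinarith
  choose! Φ' hΦd hΦle using hd
  have hgr : Φ t - Φ a ≤ (t - a) * (N * A.card) := by
    have := intervalIntegral.sub_le_integral_of_hasDeriv_right_of_le
      (g := Φ) (g' := Φ') (φ := fun _ => N * A.card) ht.1
      (hΦc.mono (Icc_subset_Icc le_rfl ht.2))
      (fun τ hτ => (hΦd τ ⟨hτ.1, hτ.2.trans_le ht.2⟩).hasDerivWithinAt)
      continuousOn_const.integrableOn_Icc (fun τ hτ => hΦle τ ⟨hτ.1, hτ.2.trans_le ht.2⟩)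
    rwa [intervalIntegral.integral_const, smul_eq_mul] at this
  set S := ∑ x ∈ A, η x ^ 2 with hS
  have hS8 : (r / 8) ^ d ≤ S := by
    calc (r / 8) ^ d ≤ ((box z (r / 8)).card : ℝ) := le_card_box z (by positivity)
      _ = ∑ x ∈ box z (r / 8), η x ^ 2 := by
          rw [Finset.sum_congr rfl (fun x hx => by
            rw [hη, cutoff_eq_one z h12 (by positivity) hx]; norm_num : ∀ x ∈ box z (r / 8),
              η x ^ 2 = 1)]
          simp
      _ ≤ S := Finset.sum_le_sum_of_subset_of_nonneg
          (box_subset_box z (by positivity) h12.le) fun _ _ _ => sq_nonneg _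
  have hS0 : 0 < S := lt_of_lt_of_le (by positivity) hS8
  have hcard : (A.card : ℝ) ≤ 8 ^ d * S := by
    calc (A.card : ℝ) ≤ (2 * (r / 4) + 1) ^ d := card_box_le z (by positivity)
      _ ≤ r ^ d := by gcongr; linarith
      _ = 8 ^ d * (r / 8) ^ d := by rw [← mul_pow]; congr 1; ring
      _ ≤ _ := by gcongr
  have hinc : (t - a) * (N * A.card) ≤ S / 100 := by
    have h1 : t - a ≤ b - a := by linarith [ht.2]
    have h8 : (1 : ℝ) ≤ 8 ^ d := one_le_pow₀ (by norm_num)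
    have hq : 1 ≤ Λ * 8 ^ d := by nlinarith
    calc (t - a) * (N * A.card) ≤ (b - a) * (N * (8 ^ d * S)) := by
          have := h.pos
          have : 0 ≤ b - a := by linarith [ht.1, ht.2]
          gcongr
      _ = 320 * (Λ * 8 ^ d) * (b - a) / r ^ 2 * S := by rw [hN]; ring
      _ ≤ (1 / 100) * S := by
          refine mul_le_mul_of_nonneg_right ?_ hS0.le
          rw [div_le_iff₀ (by positivity)]
          have : 0 ≤ b - a := by linarith [ht.1, ht.2]
          have : 0 ≤ (Λ * 8 ^ d) * (b - a) := by positivity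
          nlinarith
      _ = S / 100 := by ring
  have hstart : Φ a ≤ S / 8 := by
    have ha : a ∈ Icc a b := ⟨le_rfl, ht.1.trans ht.2⟩
    have h1 : Φ a ≤ 1 / 4 * ∑ x ∈ A with ¬ (1 / 2 ≤ u a x), η x ^ 2 := by
      rw [hΦ]
      simp only
      rw [← Finset.sum_filter_add_sum_filter_not A (fun x => 1 / 2 ≤ u a x)]
      have e : ∑ x ∈ A with 1 / 2 ≤ u a x, η x ^ 2 * max (w a x - 0) 0 ^ 2 = 0 := by
        refine Finset.sum_eq_zero fun x hx => ?_
        have := (Finset.mem_filter.1 hx).2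
        rw [max_eq_right (by simp only [hw]; linarith)]; ring
      rw [e, zero_add, Finset.mul_sum]
      refine Finset.sum_le_sum fun x hx => ?_
      have h2 := hwle a ha x (Finset.mem_filter.1 hx).1
      have h3 := pow_le_pow_left₀ (le_max_right _ _) h2 2
      nlinarith [sq_nonneg (η x)]
    have h2 := Finset.sum_filter_add_sum_filter_not A (fun x => 1 / 2 ≤ u a x) (fun x => η x ^ 2)
    linarith
  have hend : (49 / 256) * ∑ x ∈ A with ¬ (1 / 16 ≤ u t x), η x ^ 2 ≤ Φ t := by
    calc _ ≤ ∑ x ∈ A with ¬ (1 / 16 ≤ u t x), η x ^ 2 * max (w t x - 0) 0 ^ 2 := by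
          rw [Finset.mul_sum]
          refine Finset.sum_le_sum fun x hx => ?_
          have h1 := (Finset.mem_filter.1 hx).2
          have h2 : 7 / 16 ≤ max (w t x - 0) 0 := le_max_of_le_left (by simp only [hw]; linarith)
          have h3 := pow_le_pow_left₀ (by norm_num) h2 2
          nlinarith [sq_nonneg (η x)]
      _ ≤ Φ t := Finset.sum_le_sum_of_subset_of_nonneg (Finset.filter_subset _ _)
          fun _ _ _ => by positivity
  have hfin := Finset.sum_filter_add_sum_filter_not A (fun x => 1 / 16 ≤ u t x) (fun x => η x ^ 2)
  have hle : ∑ x ∈ A with 1 / 16 ≤ u t x, η x ^ 2 ≤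
      ((A.filter fun x => 1 / 16 ≤ u t x).card : ℝ) := by
    refine (Finset.sum_le_sum fun x _ => cutoff_sq_le_one z x).trans (le_of_eq ?_)
    simp
  rw [← hS] at hfin
  linarith

/-- The logarithmic estimate, integrated in time. -/
lemma Sol.integral_dirichlet_logPot_le {d : ℕ} {C : Lattice d → Lattice d → ℝ} {Λ M : ℝ}
    (h : Elliptic C Λ M) {z : Lattice d} {r a b B ε : ℝ} {u : ℝ → Lattice d → ℝ} (hr : 0 < r)
    (hε0 : 0 < ε) (hε1 : ε < 1) (hab : a ≤ b) (habr : b - a ≤ r ^ 2)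
    (hu : Sol C u a b (box z r)) (hB : ∀ t ∈ Icc a b, ∀ x, |u t x| ≤ B)
    (h0 : ∀ t ∈ Icc a b, ∀ x ∈ box z r, 0 ≤ u t x)
    (hgrow : ∀ t ∈ Icc a b, ∀ x, -(ε * (‖x - z‖ ^ 2 / r ^ 2)) ≤ u t x) :
    ∫ t in a..b, dirichlet C (box z (r / 2)) (fun x => logPot ε (u t x)) ≤
      16 * ((box z r).card * (-Real.log ε + 65 * Λ)) := by
  set A := box z r with hA
  set ψ := cutoff z (r / 2) (3 * r / 4) with hψ
  have hc : Continuous (logPot ε) := continuous_iff_continuousAt.2 fun s =>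
    (hasDerivAt_logPot hε0 hε1 s).continuousAt
  have hvc : ∀ x ∈ A, ContinuousOn (fun t => logPot ε (u t x)) (Icc a b) := fun x hx =>
    hc.comp_continuousOn (hu x hx).1
  set Φ : ℝ → ℝ := fun t => ∑ x ∈ A, ψ x ^ 2 * logPot ε (u t x) with hΦ
  set E : ℝ → ℝ := fun t => dirichlet C (box z (r / 2)) (fun x => logPot ε (u t x)) with hE
  have hsub : box z (r / 2) ⊆ A := box_subset_box z (by positivity) (by linarith)
  have hΦc : ContinuousOn Φ (Icc a b) := continuousOn_finsetSum _ fun x hx =>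
    continuousOn_const.mul (hvc x hx)
  have hEc : ContinuousOn E (Icc a b) := continuousOn_finsetSum _ fun x hx =>
    continuousOn_finsetSum _ fun y hy =>
      continuousOn_const.mul (((hvc x (hsub hx)).sub (hvc y (hsub hy))).pow 2)
  have key := intervalIntegral.sub_le_integral_of_hasDeriv_right_of_le
    (g := Φ) (g' := fun t => ∑ x ∈ A, ψ x ^ 2 * (logSlope ε (u t x) * gen C (u t) x))
    (φ := fun t => 65 * Λ / r ^ 2 * A.card - 1 / 16 * E t) hab hΦc
    (fun t ht => by
      refine HasDerivAt.hasDerivWithinAt (HasDerivAt.fun_sum fun x hx => ?_)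
      exact ((hasDerivAt_logPot hε0 hε1 _).comp t ((hu x hx).2 t ht)).const_mul _)
    (continuousOn_const.sub (continuousOn_const.mul hEc)).integrableOn_Icc
    (fun t ht => by
      have ht' := Ioo_subset_Icc_self ht
      have := h.sum_logSlope_gen_le hr hε0 hε1 (hB t ht') (h0 t ht') (hgrow t ht')
      linarith)
  have iE : IntervalIntegrable E volume a b :=
    ContinuousOn.intervalIntegrable (by rwa [uIcc_of_le hab])
  rw [intervalIntegral.integral_sub intervalIntegrable_const (iE.const_mul _),
    intervalIntegral.integral_const, intervalIntegral.integral_const_mul, smul_eq_mul] at key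
  have h1 : 0 ≤ Φ b := Finset.sum_nonneg fun x _ =>
    mul_nonneg (sq_nonneg _) (logPot_nonneg hε0 hε1 _)
  have h2 : Φ a ≤ A.card * -Real.log ε := by
    refine (Finset.sum_le_sum (g := fun _ => -Real.log ε) fun x hx => ?_).trans (le_of_eq ?_)
    · have h3 := logPot_le hε0 hε1 (u a x)
      rw [max_eq_right (by linarith [h0 a ⟨le_rfl, hab⟩ x hx]), zero_div, add_zero] at h3
      have h4 := cutoff_sq_le_one z (r₁ := r / 2) (r₂ := 3 * r / 4) x
      exact (mul_le_of_le_one_left (logPot_nonneg hε0 hε1 _) h4).trans h3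
    · rw [Finset.sum_const, nsmul_eq_mul]
  have h3 : (b - a) * (65 * Λ / r ^ 2 * A.card) ≤ A.card * (65 * Λ) := by
    calc _ ≤ r ^ 2 * (65 * Λ / r ^ 2 * A.card) := by
          have := h.pos
          gcongr
      _ = _ := by field_simp
  linarith

set_option maxHeartbeats 1000000 in
/-- Growth lemma: a solution that is nonnegative in a cylinder, not too negative elsewhere, and
large on half of a box at the initial time is bounded below in a smaller cylinder. -/
theorem exists_growth (d : ℕ) {Λ : ℝ} (hΛ : 1 ≤ Λ) (M : ℝ) : ∃ L ρ₀ ε ε' : ℝ, 4 ≤ L ∧ 1 ≤ ρ₀ ∧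
    0 < ε ∧ 0 < ε' ∧
    ∀ C : Lattice d → Lattice d → ℝ, Elliptic C Λ M →
    ∀ (z : Lattice d) (ρ t₁ : ℝ) (u : ℝ → Lattice d → ℝ) (B : ℝ), ρ₀ ≤ ρ →
      Sol C u (t₁ - ρ ^ 2) t₁ (box z (L * ρ)) →
      (∀ t ∈ Icc (t₁ - ρ ^ 2) t₁, ∀ x, |u t x| ≤ B) →
      (∀ t ∈ Icc (t₁ - ρ ^ 2) t₁, ∀ x ∈ box z (L * ρ), 0 ≤ u t x) →
      (∀ t ∈ Icc (t₁ - ρ ^ 2) t₁, ∀ x, -(ε * (‖x - z‖ ^ 2 / (L * ρ) ^ 2)) ≤ u t x) →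
      (∑ x ∈ box z (L * ρ / 4), cutoff z (L * ρ / 8) (L * ρ / 4) x ^ 2) / 2 ≤
        ∑ x ∈ box z (L * ρ / 4) with 1 / 2 ≤ u (t₁ - ρ ^ 2) x,
          cutoff z (L * ρ / 8) (L * ρ / 4) x ^ 2 →
      ∀ t ∈ Icc (t₁ - ρ ^ 2 / 4) t₁, ∀ x ∈ box z (ρ / 2), ε' ≤ u t x := by
  obtain ⟨δ₀, hδ₀, hDG⟩ := exists_deGiorgi d hΛ
  have h8 : (1 : ℝ) ≤ 8 ^ d := one_le_pow₀ (by norm_num)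
  have hq : 1 ≤ Λ * 8 ^ d := by nlinarith
  -- `L` makes the time `ρ ^ 2` short compared with `(L * ρ) ^ 2`, so that `Sol.card_le` applies; then
  -- `K = -log ε` is chosen so large that the a priori bound for the energy of the logarithm, which
  -- grows like `K`, is small when the logarithm is divided by `K`
  set L : ℝ := 200 * (Λ * 8 ^ d) with hL
  have hL200 : 200 ≤ L := by linarith
  have hL0 : 0 < L := by linarith
  set c₁ : ℝ := 16 ^ d * d ^ 2 * Λ * (16 * 66 * Λ * 3 ^ d) with hc₁
  have hc₁0 : 0 ≤ c₁ := by positivity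
  set K : ℝ := max 3 (c₁ * L ^ (d + 2) / δ₀) with hK
  have hK3 : 3 ≤ K := le_max_left _ _
  have hK0 : 0 < K := by linarith
  set ε : ℝ := Real.exp (-K) with hε
  have hε0 : 0 < ε := Real.exp_pos _
  have hε1 : ε < 1 := by rw [hε, Real.exp_lt_one_iff]; linarith
  have hlogε : Real.log ε = -K := Real.log_exp _
  have hgap : 0 < Real.exp (Real.log ε / 2 - 1) - ε := by
    rw [hlogε, hε, sub_pos, Real.exp_lt_exp]; linarith
  refine ⟨L, max 1 (4 * M), ε / 16, (Real.exp (Real.log ε / 2 - 1) - ε) / 16, by linarith,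
    le_max_left _ _, by positivity, by positivity, ?_⟩
  intro C h z ρ t₁ u B hρ hu hB h0 hgrow hhalf t ht x hx
  have hρ1 : 1 ≤ ρ := (le_max_left _ _).trans hρ
  have hρM : 4 * M ≤ ρ := (le_max_right _ _).trans hρ
  have hM := h.one_le_range
  have hρ0 : 0 < ρ := by linarith
  set r := L * ρ with hr
  set a := t₁ - ρ ^ 2 with ha
  have hLρ : 200 * ρ ≤ r := by rw [hr]; nlinarith
  have hr0 : 0 < r := by positivity
  have hab : a ≤ t₁ := by rw [ha]; nlinarith
  have hba : t₁ - a = ρ ^ 2 := by rw [ha]; ring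
  -- persistence in time
  have hcard : ∀ t ∈ Icc a t₁, (r / 8) ^ d / 4 ≤
      (((box z (r / 4)).filter fun x => 1 / 16 ≤ u t x).card : ℝ) := fun t ht =>
    hu.card_le h (by linarith) hB h0 (fun t ht x => by
      refine le_trans ?_ (hgrow t ht x)
      have : ε / 16 ≤ 1 := by linarith
      have h2 : 0 ≤ ‖x - z‖ ^ 2 / r ^ 2 := by positivity
      nlinarith)
      (by rw [hba, hr, hL]; apply le_of_eq; ring) hhalf ht
  -- the logarithm of the solution
  set U : ℝ → Lattice d → ℝ := fun t x => 16 * u t x + 0 with hU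
  have hUs : Sol C U a t₁ (box z r) := hu.affine 16 0
  have hUB : ∀ t ∈ Icc a t₁, ∀ x, |U t x| ≤ 16 * B := fun t ht x => by
    simp only [hU, add_zero]
    rw [abs_mul, abs_of_pos (by norm_num : (0 : ℝ) < 16)]
    linarith [hB t ht x]
  have hU0 : ∀ t ∈ Icc a t₁, ∀ x ∈ box z r, 0 ≤ U t x := fun t ht x hx => by
    simp only [hU]; linarith [h0 t ht x hx]
  have hUg : ∀ t ∈ Icc a t₁, ∀ x, -(ε * (‖x - z‖ ^ 2 / r ^ 2)) ≤ U t x := fun t ht x => by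
    simp only [hU]; linarith [hgrow t ht x]
  set v : ℝ → Lattice d → ℝ := fun t x => logPot ε (U t x) with hv
  have hvs : SubSol C v a t₁ (box z r) := hUs.subSol_logPot h hε0 hε1 hUB
  have hlog := hUs.integral_dirichlet_logPot_le h hr0 hε0 hε1 hab
    (by rw [hba]; nlinarith) hUB hU0 hUg
  have hv0 : ∀ t x, 0 ≤ v t x := fun t x => logPot_nonneg hε0 hε1 _
  -- Poincaré inequality, using that `v` vanishes where `u ≥ 1 / 16`
  have hpoin : ∀ t ∈ Icc a t₁, ∑ x ∈ box z (r / 4), v t x ^ 2 ≤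
      16 ^ d * d ^ 2 * Λ * r ^ 2 * dirichlet C (box z (r / 2)) (v t) := by
    intro t ht
    have h1 := poincare_zero_set z (r := r / 4) (by positivity) (v t)
      ((box z (r / 4)).filter fun x => 1 / 16 ≤ u t x) (Finset.filter_subset _ _)
      (fun x hx => logPot_eq_zero hε0 hε1 (by
        have := (Finset.mem_filter.1 hx).2
        simp only [hU]; linarith))
    have h2 : edgeEnergy (box z (r / 4)) (v t) ≤ Λ * dirichlet C (box z (r / 2)) (v t) := by
      refine (h.edge_le z (r / 4) (by positivity) (v t)).trans ?_
      refine mul_le_mul_of_nonneg_left ?_ h.pos.le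
      have hs : box z (r / 4 + M) ⊆ box z (r / 2) :=
        box_subset_box z (by positivity) (by linarith)
      have hnn : ∀ x y, 0 ≤ C x y * (v t x - v t y) ^ 2 := fun x y =>
        mul_nonneg (h.nonneg x y) (sq_nonneg _)
      calc _ ≤ ∑ x ∈ box z (r / 4 + M), ∑ y ∈ box z (r / 2), C x y * (v t x - v t y) ^ 2 :=
            Finset.sum_le_sum fun x _ =>
              Finset.sum_le_sum_of_subset_of_nonneg hs fun y _ _ => hnn x y
        _ ≤ _ := Finset.sum_le_sum_of_subset_of_nonneg hs fun x _ _ =>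
            Finset.sum_nonneg fun y _ => hnn x y
    have hE0 := edgeEnergy_nonneg (box z (r / 4)) (v t)
    have hs0 : 0 ≤ ∑ x ∈ box z (r / 4), v t x ^ 2 := Finset.sum_nonneg fun _ _ => sq_nonneg _
    have h3 : (r / 8) ^ d / 4 * ∑ x ∈ box z (r / 4), v t x ^ 2 ≤
        (2 * r) ^ d * ((d * r) ^ 2 / 4 * (Λ * dirichlet C (box z (r / 2)) (v t))) := by
      calc _ ≤ (((box z (r / 4)).filter fun x => 1 / 16 ≤ u t x).card : ℝ) *
            ∑ x ∈ box z (r / 4), v t x ^ 2 := mul_le_mul_of_nonneg_right (hcard t ht) hs0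
        _ ≤ _ := h1
        _ ≤ (2 * r) ^ d * ((2 * d * (r / 4)) ^ 2 * edgeEnergy (box z (r / 4)) (v t)) := by
            gcongr; linarith
        _ = (2 * r) ^ d * ((d * r) ^ 2 / 4 * edgeEnergy (box z (r / 4)) (v t)) := by ring
        _ ≤ _ := by gcongr
    have e1 : (2 * r) ^ d = 16 ^ d * (r / 8) ^ d := by rw [← mul_pow]; congr 1; ring
    rw [e1] at h3
    have e2 : 16 ^ d * (r / 8) ^ d * ((d * r) ^ 2 / 4 * (Λ * dirichlet C (box z (r / 2)) (v t))) =
        (r / 8) ^ d / 4 * (16 ^ d * d ^ 2 * Λ * r ^ 2 * dirichlet C (box z (r / 2)) (v t)) := by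
      ring
    rw [e2] at h3
    exact le_of_mul_le_mul_left h3 (by positivity)
  -- hence the normalized logarithm has small square mean
  have hvc : ∀ x ∈ box z r, ContinuousOn (fun t => v t x) (Icc a t₁) := fun x hx => (hvs x hx).1
  have hsubρ : box z ρ ⊆ box z (r / 4) := box_subset_box z hρ0.le (by linarith)
  have hsub4 : box z (r / 4) ⊆ box z r := box_subset_box z (by positivity) (by linarith)
  have hsub2 : box z (r / 2) ⊆ box z r := box_subset_box z (by positivity) (by linarith)
  have hmean : (∫ t in a..t₁, ∑ x ∈ box z ρ, max (K⁻¹ * v t x) 0 ^ 2) ≤ δ₀ * ρ ^ (d + 2) := by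
    have i0 : IntervalIntegrable (fun t => dirichlet C (box z (r / 2)) (v t)) volume a t₁ := by
      refine ContinuousOn.intervalIntegrable ?_
      rw [uIcc_of_le hab]
      exact continuousOn_finsetSum _ fun x hx => continuousOn_finsetSum _ fun y hy =>
        continuousOn_const.mul (((hvc x (hsub2 hx)).sub (hvc y (hsub2 hy))).pow 2)
    have i1 : IntervalIntegrable (fun t => ∑ x ∈ box z ρ, max (K⁻¹ * v t x) 0 ^ 2)
        volume a t₁ := by
      refine ContinuousOn.intervalIntegrable ?_
      rw [uIcc_of_le hab]
      refine continuousOn_finsetSum _ fun x hx => ?_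
      have := hvc x (hsub4 (hsubρ hx))
      fun_prop
    calc _ ≤ ∫ t in a..t₁, (K⁻¹) ^ 2 * (16 ^ d * d ^ 2 * Λ * r ^ 2) *
          dirichlet C (box z (r / 2)) (v t) := by
          refine intervalIntegral.integral_mono_on hab i1 (i0.const_mul _) fun t ht => ?_
          calc _ = (K⁻¹) ^ 2 * ∑ x ∈ box z ρ, v t x ^ 2 := by
                rw [Finset.mul_sum]
                refine Finset.sum_congr rfl fun x _ => ?_
                rw [max_eq_left (mul_nonneg (by positivity) (hv0 t x))]; ring
            _ ≤ (K⁻¹) ^ 2 * ∑ x ∈ box z (r / 4), v t x ^ 2 := by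
                refine mul_le_mul_of_nonneg_left ?_ (by positivity)
                exact Finset.sum_le_sum_of_subset_of_nonneg hsubρ fun _ _ _ => sq_nonneg _
            _ ≤ _ := by
                rw [mul_assoc ((K⁻¹) ^ 2)]
                exact mul_le_mul_of_nonneg_left (hpoin t ht) (by positivity)
      _ = (K⁻¹) ^ 2 * (16 ^ d * d ^ 2 * Λ * r ^ 2) *
          ∫ t in a..t₁, dirichlet C (box z (r / 2)) (v t) :=
          intervalIntegral.integral_const_mul _ _
      _ ≤ (K⁻¹) ^ 2 * (16 ^ d * d ^ 2 * Λ * r ^ 2) * (16 * ((3 * r) ^ d * (66 * Λ * K))) := by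
          have h1 : ((box z r).card : ℝ) ≤ (3 * r) ^ d :=
            (card_box_le z hr0.le).trans (by gcongr; linarith)
          have h2 : -Real.log ε + 65 * Λ ≤ 66 * Λ * K := by
            rw [hlogε]; nlinarith
          have h3 : 0 ≤ -Real.log ε + 65 * Λ := by rw [hlogε]; nlinarith
          refine mul_le_mul_of_nonneg_left (hlog.trans ?_) (by positivity)
          gcongr
      _ = c₁ * L ^ (d + 2) / K * ρ ^ (d + 2) := by
          rw [hc₁, mul_pow 3 r d, pow_add L, pow_add ρ, hr, mul_pow L ρ d]
          field_simp
      _ ≤ δ₀ * ρ ^ (d + 2) := by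
          refine mul_le_mul_of_nonneg_right ?_ (by positivity)
          have h1 : c₁ * L ^ (d + 2) / δ₀ ≤ K := le_max_right _ _
          rw [div_le_iff₀ hδ₀] at h1
          rw [div_le_iff₀ hK0]
          linarith
  have hfin := hDG C M h z ρ t₁ (fun t x => K⁻¹ * v t x) (K⁻¹ * (-Real.log ε + 16 * B / ε)) hρ0
    ((hvs.mono le_rfl le_rfl (hsubρ.trans hsub4)).const_mul (by positivity))
    (fun t ht x => by
      rw [abs_mul, abs_of_pos (by positivity : 0 < K⁻¹)]
      exact mul_le_mul_of_nonneg_left (abs_logPot_le hε0 hε1 (hUB t ht x)) (by positivity))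
    (fun t ht x => by
      have h1 := logPot_le hε0 hε1 (U t x)
      have hq0 : 0 ≤ ‖x - z‖ ^ 2 / r ^ 2 := by positivity
      have h2 : max (-U t x) 0 / ε ≤ ‖x - z‖ ^ 2 / r ^ 2 := by
        rw [div_le_iff₀ hε0]
        exact max_le (by linarith [hUg t ht x]) (by positivity)
      have h3 : ‖x - z‖ ^ 2 / r ^ 2 ≤ ‖x - z‖ ^ 2 / ρ ^ 2 := by
        gcongr; linarith
      rw [inv_mul_le_iff₀ hK0]
      rw [hlogε] at h1
      have h4 : 0 ≤ ‖x - z‖ ^ 2 / ρ ^ 2 := by positivity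
      nlinarith)
    hmean t ht x hx
  have htt : t ∈ Icc a t₁ := ⟨by rw [ha]; nlinarith [ht.1], ht.2⟩
  have hxr : x ∈ box z r := box_subset_box z (by positivity) (by linarith) hx
  have hUx := hU0 t htt x hxr
  have := le_of_logPot_le hε0 hε1 hUx (by
    rw [hlogε]
    rw [inv_mul_le_iff₀ hK0] at hfin
    simp only [hv] at hfin
    linarith)
  simp only [hU] at this
  linarith

/-! ### Decay of oscillation and Hölder continuity -/

/-- The growth lemma at bounded scales, at a single point: it follows from `u' ≥ -Λ u - const`. -/
lemma Sol.le_of_half_le {d : ℕ} {C : Lattice d → Lattice d → ℝ} {Λ M : ℝ} (h : Elliptic C Λ M)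
    {z : Lattice d} {r a b B ε s : ℝ} {u : ℝ → Lattice d → ℝ} {A : Finset (Lattice d)}
    (hz : z ∈ A) (hr : 0 < r)
    (hu : Sol C u a b A) (hB : ∀ t ∈ Icc a b, ∀ x, |u t x| ≤ B)
    (h0 : ∀ t ∈ Icc a b, 0 ≤ u t z)
    (hgrow : ∀ t ∈ Icc a b, ∀ x, -(ε * (‖x - z‖ ^ 2 / r ^ 2)) ≤ u t x)
    (hε : 0 ≤ ε) (hs : b - a ≤ s) (hεs : 4 * (Real.exp (Λ * s) * Λ * ε * (b - a)) ≤ r ^ 2)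
    (hhalf : 1 / 2 ≤ u a z) {t : ℝ} (ht : t ∈ Icc a b) :
    Real.exp (-(Λ * s)) / 4 ≤ u t z := by
  have hΛ := h.pos
  have hgen : ∀ τ ∈ Ioo a b, -(Λ * u τ z) - Λ * ε / r ^ 2 ≤ gen C (u τ) z := by
    intro τ hτ
    have hτ' := Ioo_subset_Icc_self hτ
    have s1 : Summable fun y => C z y * u τ z := (h.summable z).mul_right _
    have s2 : Summable fun y => C z y * ‖y - z‖ ^ 2 * (ε / r ^ 2) :=
      (h.summable_moment z).mul_right _
    have h1 : ∑' y, (-(C z y * u τ z) - C z y * ‖y - z‖ ^ 2 * (ε / r ^ 2)) ≤ gen C (u τ) z := by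
      refine Summable.tsum_le_tsum (fun y => ?_) (s1.neg.sub s2) (h.summable_gen z (hB τ hτ'))
      have h2 := mul_le_mul_of_nonneg_left (hgrow τ hτ' y) (h.nonneg z y)
      have e : C z y * -(ε * (‖y - z‖ ^ 2 / r ^ 2)) = -(C z y * ‖y - z‖ ^ 2 * (ε / r ^ 2)) := by
        ring
      linarith
    rw [s1.neg.tsum_sub s2, tsum_neg, tsum_mul_right, tsum_mul_right] at h1
    have h3 := mul_le_mul_of_nonneg_right (h.tsum_le z) (h0 τ hτ')
    have h4 := mul_le_mul_of_nonneg_right (h.tsum_moment_le z)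
      (by positivity : 0 ≤ ε / r ^ 2)
    have e : Λ * ε / r ^ 2 = Λ * (ε / r ^ 2) := by ring
    linarith
  set c := Real.exp (Λ * s) * (Λ * ε / r ^ 2) with hc
  have key := intervalIntegral.sub_le_integral_of_hasDeriv_right_of_le
    (g := fun τ => -(Real.exp (Λ * (τ - a)) * u τ z))
    (g' := fun τ => -(Real.exp (Λ * (τ - a)) * Λ * u τ z +
      Real.exp (Λ * (τ - a)) * gen C (u τ) z))
    (φ := fun _ => c) ht.1
    (by
      have := (hu z hz).1.mono (Icc_subset_Icc le_rfl ht.2)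
      fun_prop)
    (fun τ hτ => by
      have h1 : HasDerivAt (fun τ => Real.exp (Λ * (τ - a))) (Real.exp (Λ * (τ - a)) * Λ) τ := by
        have := (((hasDerivAt_id τ).sub_const a).const_mul Λ).exp
        simpa using this
      exact (h1.mul ((hu z hz).2 τ ⟨hτ.1, hτ.2.trans_le ht.2⟩)).neg.hasDerivWithinAt)
    continuousOn_const.integrableOn_Icc
    (fun τ hτ => by
      have hτ' : τ ∈ Ioo a b := ⟨hτ.1, hτ.2.trans_le ht.2⟩
      have h1 := mul_le_mul_of_nonneg_left (hgen τ hτ') (Real.exp_pos (Λ * (τ - a))).le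
      have h2 : Real.exp (Λ * (τ - a)) ≤ Real.exp (Λ * s) := by
        apply Real.exp_le_exp.2
        exact mul_le_mul_of_nonneg_left (by linarith [hτ'.2]) hΛ.le
      have h3 : Real.exp (Λ * (τ - a)) * (Λ * ε / r ^ 2) ≤ c :=
        mul_le_mul_of_nonneg_right h2 (by positivity)
      linarith)
  simp only [sub_self, mul_zero, Real.exp_zero, one_mul] at key
  rw [intervalIntegral.integral_const, smul_eq_mul] at key
  have h1 : (t - a) * c ≤ 1 / 4 := by
    have h2 : (t - a) * c ≤ (b - a) * c :=
      mul_le_mul_of_nonneg_right (by linarith [ht.2]) (by positivity)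
    have e : (b - a) * c = Real.exp (Λ * s) * Λ * ε * (b - a) / r ^ 2 := by rw [hc]; ring
    have h3 : (b - a) * c ≤ 1 / 4 := by
      rw [e, div_le_iff₀ (by positivity)]; linarith
    linarith
  have h2 : 1 / 4 ≤ Real.exp (Λ * (t - a)) * u t z := by linarith
  have h3 : Real.exp (Λ * (t - a)) ≤ Real.exp (Λ * s) := by
    apply Real.exp_le_exp.2
    exact mul_le_mul_of_nonneg_left (by linarith [ht.2]) hΛ.le
  have h4 := mul_le_mul_of_nonneg_right h3 (h0 t ht)
  rw [Real.exp_neg, div_le_iff₀ (by norm_num), inv_le_iff_one_le_mul₀ (Real.exp_pos _)]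
  linarith

/-- Oscillation alternative, at all scales. -/
theorem exists_oscillation (d : ℕ) {Λ : ℝ} (hΛ : 1 ≤ Λ) (M : ℝ) : ∃ L κ ε ε' : ℝ,
    4 ≤ L ∧ 0 < κ ∧ κ ≤ 1 / 8 ∧ 0 < ε ∧ ε ≤ 1 ∧ 0 < ε' ∧ ε' ≤ ε / 4 ∧
    ∀ C : Lattice d → Lattice d → ℝ, Elliptic C Λ M →
    ∀ (z : Lattice d) (ρ t₁ : ℝ) (u : ℝ → Lattice d → ℝ) (B : ℝ), 0 < ρ →
      Sol C u (t₁ - ρ ^ 2) t₁ (box z (L * ρ)) →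
      (∀ t ∈ Icc (t₁ - ρ ^ 2) t₁, ∀ x, |u t x| ≤ B) →
      (∀ t ∈ Icc (t₁ - ρ ^ 2) t₁, ∀ x ∈ box z (L * ρ), 0 ≤ u t x ∧ u t x ≤ 1) →
      (∀ t ∈ Icc (t₁ - ρ ^ 2) t₁, ∀ x, -(ε * (‖x - z‖ ^ 2 / (L * ρ) ^ 2)) ≤ u t x ∧
        u t x ≤ 1 + ε * (‖x - z‖ ^ 2 / (L * ρ) ^ 2)) →
      (∀ t ∈ Icc (t₁ - (κ * ρ) ^ 2) t₁, ∀ x ∈ box z (L * (κ * ρ)), ε' ≤ u t x) ∨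
      (∀ t ∈ Icc (t₁ - (κ * ρ) ^ 2) t₁, ∀ x ∈ box z (L * (κ * ρ)), u t x ≤ 1 - ε') := by
  obtain ⟨L, ρ₀, εg, εg', hL, hρ₀, hεg, hεg', hG⟩ := exists_growth d hΛ M
  have hL0 : 0 < L := by linarith
  have hΛ0 : 0 < Λ := by linarith
  set E := Real.exp (-(Λ * ρ₀ ^ 2)) with hE
  have hE0 : 0 < E := Real.exp_pos _
  have hEE : Real.exp (Λ * ρ₀ ^ 2) * E = 1 := by rw [hE, ← Real.exp_add]; simp
  set ε := min 1 (min εg (E / Λ)) with hε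
  have hε0 : 0 < ε := lt_min one_pos (lt_min hεg (by positivity))
  have hε1 : ε ≤ 1 := min_le_left _ _
  have hεεg : ε ≤ εg := (min_le_right _ _).trans (min_le_left _ _)
  have hεE : ε ≤ E / Λ := (min_le_right _ _).trans (min_le_right _ _)
  set ε' := min (ε / 4) (min εg' (E / 4)) with hε'
  have hε'0 : 0 < ε' := lt_min (by positivity) (lt_min hεg' (by positivity))
  have hε'g : ε' ≤ εg' := (min_le_right _ _).trans (min_le_left _ _)
  have hε'E : ε' ≤ E / 4 := (min_le_right _ _).trans (min_le_right _ _)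
  set κ := 1 / (4 * L * ρ₀) with hκ
  have hκ0 : 0 < κ := by positivity
  have hκL : κ * (4 * L) ≤ 1 := by
    rw [hκ, div_mul_eq_mul_div, one_mul, div_le_one (by positivity)]
    nlinarith
  have hκ8 : κ ≤ 1 / 8 := by nlinarith
  refine ⟨L, κ, ε, ε', hL, hκ0, hκ8, hε0, hε1, hε'0, min_le_left _ _, ?_⟩
  intro C h z ρ t₁ u B hρ hu hB h01 hgrow
  have hκρ : (κ * ρ) ^ 2 ≤ ρ ^ 2 / 4 := by
    rw [mul_pow]
    have : κ ^ 2 ≤ 1 / 4 := by nlinarith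
    nlinarith [sq_nonneg ρ]
  have hsubt : Icc (t₁ - (κ * ρ) ^ 2) t₁ ⊆ Icc (t₁ - ρ ^ 2 / 4) t₁ :=
    Icc_subset_Icc (by linarith) le_rfl
  have hsubt' : Icc (t₁ - (κ * ρ) ^ 2) t₁ ⊆ Icc (t₁ - ρ ^ 2) t₁ :=
    Icc_subset_Icc (by nlinarith [sq_nonneg ρ]) le_rfl
  have ha : t₁ - ρ ^ 2 ∈ Icc (t₁ - ρ ^ 2) t₁ := ⟨le_rfl, by nlinarith [sq_nonneg ρ]⟩
  -- the reflected solution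
  set w : ℝ → Lattice d → ℝ := fun t x => (-1) * u t x + 1 with hw
  have hws : Sol C w (t₁ - ρ ^ 2) t₁ (box z (L * ρ)) := hu.affine (-1) 1
  have hwB : ∀ t ∈ Icc (t₁ - ρ ^ 2) t₁, ∀ x, |w t x| ≤ B + 1 := fun t ht x => by
    have := abs_le.1 (hB t ht x)
    rw [abs_le]; constructor <;> simp only [hw] <;> linarith
  have hzA : z ∈ box z (L * ρ) := by rw [mem_box (by positivity)]; simp; positivity
  rcases le_or_gt ρ₀ ρ with hcase | hcase
  · have hsubx : box z (L * (κ * ρ)) ⊆ box z (ρ / 2) :=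
      box_subset_box z (by positivity) (by nlinarith)
    -- either `u` or `1 - u` is at least `1 / 2` on half of the initial time slice
    by_cases hhalf : (∑ x ∈ box z (L * ρ / 4), cutoff z (L * ρ / 8) (L * ρ / 4) x ^ 2) / 2 ≤
        ∑ x ∈ box z (L * ρ / 4) with 1 / 2 ≤ u (t₁ - ρ ^ 2) x,
          cutoff z (L * ρ / 8) (L * ρ / 4) x ^ 2
    · left
      intro t ht x hx
      refine hε'g.trans (hG C h z ρ t₁ u B hcase hu hB (fun t ht x hx => (h01 t ht x hx).1)
        (fun t ht x => le_trans ?_ (hgrow t ht x).1) hhalf t (hsubt ht) x (hsubx hx))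
      have : 0 ≤ ‖x - z‖ ^ 2 / (L * ρ) ^ 2 := by positivity
      have := mul_le_mul_of_nonneg_right hεεg this
      linarith
    · right
      intro t ht x hx
      have := hε'g.trans (hG C h z ρ t₁ w (B + 1) hcase hws hwB
        (fun t ht x hx => by have := (h01 t ht x hx).2; simp only [hw]; linarith)
        (fun t ht x => ?_) ?_ t (hsubt ht) x (hsubx hx))
      · simp only [hw] at this; linarith
      · have h1 := (hgrow t ht x).2
        have h2 : 0 ≤ ‖x - z‖ ^ 2 / (L * ρ) ^ 2 := by positivity
        have h3 := mul_le_mul_of_nonneg_right hεεg h2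
        simp only [hw]; linarith
      · push Not at hhalf
        have h1 := Finset.sum_filter_add_sum_filter_not (box z (L * ρ / 4))
          (fun x => 1 / 2 ≤ u (t₁ - ρ ^ 2) x)
          (fun x => cutoff z (L * ρ / 8) (L * ρ / 4) x ^ 2)
        have h2 : ∑ x ∈ box z (L * ρ / 4) with ¬ 1 / 2 ≤ u (t₁ - ρ ^ 2) x,
            cutoff z (L * ρ / 8) (L * ρ / 4) x ^ 2 ≤
            ∑ x ∈ box z (L * ρ / 4) with 1 / 2 ≤ w (t₁ - ρ ^ 2) x,
            cutoff z (L * ρ / 8) (L * ρ / 4) x ^ 2 := by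
          refine Finset.sum_le_sum_of_subset_of_nonneg (fun x hx => ?_) fun _ _ _ => sq_nonneg _
          rw [Finset.mem_filter] at hx ⊢
          refine ⟨hx.1, ?_⟩
          have := hx.2
          push Not at this
          simp only [hw]; linarith
        linarith
  · -- the box has a single point
    have hz : ∀ x ∈ box z (L * (κ * ρ)), x = z := by
      intro x hx
      rw [mem_box (by positivity)] at hx
      have h1 : L * (κ * ρ) < 1 := by
        have e : L * (κ * ρ) = ρ / (4 * ρ₀) := by rw [hκ]; field_simp
        rw [e, div_lt_one (by positivity)]; linarith
      have h2 : ‖x - z‖ < 1 := hx.trans_lt h1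
      rw [pi_norm_lt_iff one_pos] at h2
      funext i
      have h3 := h2 i
      rw [Pi.sub_apply, Int.norm_eq_abs, ← Int.cast_abs] at h3
      have h4 : |x i - z i| < 1 := by exact_mod_cast h3
      rw [Int.abs_lt_one_iff] at h4
      linarith
    have hs : t₁ - (t₁ - ρ ^ 2) ≤ ρ₀ ^ 2 := by nlinarith
    have hεs : 4 * (Real.exp (Λ * ρ₀ ^ 2) * Λ * ε * (t₁ - (t₁ - ρ ^ 2))) ≤ (L * ρ) ^ 2 := by
      rw [le_div_iff₀ hΛ0] at hεE
      have h1 : Real.exp (Λ * ρ₀ ^ 2) * (ε * Λ) ≤ 1 := by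
        rw [← hEE]; exact mul_le_mul_of_nonneg_left hεE (Real.exp_pos _).le
      have h2 : 4 ≤ L ^ 2 := by nlinarith
      rw [mul_pow, sub_sub_cancel]
      have h3 := mul_le_mul_of_nonneg_right h1 (sq_nonneg ρ)
      have h4 := mul_le_mul_of_nonneg_right h2 (sq_nonneg ρ)
      linarith
    rcases le_total (1 / 2) (u (t₁ - ρ ^ 2) z) with hhalf | hhalf
    · left
      intro t ht x hx
      rw [hz x hx]
      exact hε'E.trans (hu.le_of_half_le h hzA (by positivity : 0 < L * ρ) hB
        (fun t ht => (h01 t ht z hzA).1) (fun t ht x => (hgrow t ht x).1) hε0.le hs hεs hhalf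
        (hsubt' ht))
    · right
      intro t ht x hx
      rw [hz x hx]
      have := hε'E.trans (hws.le_of_half_le h hzA (by positivity : 0 < L * ρ) hwB
        (fun t ht => by have := (h01 t ht z hzA).2; simp only [hw]; linarith)
        (fun t ht x => by have := (hgrow t ht x).2; simp only [hw]; linarith) hε0.le hs hεs
        (by simp only [hw]; linarith) (hsubt' ht))
      simp only [hw] at this; linarith

set_option maxHeartbeats 1000000 in
/-- Interior Hölder estimate for solutions in a cylinder that are bounded on the whole lattice. -/
theorem exists_holder (d : ℕ) {Λ : ℝ} (hΛ : 1 ≤ Λ) (M : ℝ) : ∃ c β : ℝ, 0 < c ∧ 0 < β ∧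
    ∀ C : Lattice d → Lattice d → ℝ, Elliptic C Λ M →
    ∀ (z : Lattice d) (r t₁ : ℝ) (u : ℝ → Lattice d → ℝ) (B : ℝ), 0 < r →
      Sol C u (t₁ - r ^ 2) t₁ (box z r) →
      (∀ t ∈ Icc (t₁ - r ^ 2) t₁, ∀ x, |u t x| ≤ B) →
      ∀ t ∈ Icc (t₁ - r ^ 2) t₁, ∀ x,
        |u t x - u t₁ z| ≤ c * B * ((Real.sqrt (t₁ - t) + ‖x - z‖) / r) ^ β := by
  obtain ⟨L, κ, ε, ε', hL, hκ0, hκ8, hε0, hε1, hε'0, hε'ε, hO⟩ := exists_oscillation d hΛ M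
  have hL0 : 0 < L := by linarith
  set μ := 1 - ε' with hμ
  have hμ0 : 3 / 4 ≤ μ := by linarith
  have hμ0' : 0 < μ := by linarith
  have hμ1 : μ < 1 := by linarith
  have hlogκ : Real.log κ < 0 := Real.log_neg hκ0 (by linarith)
  have hlogμ : Real.log μ < 0 := Real.log_neg hμ0' hμ1
  -- one step of the iteration shrinks lengths by `κ` and oscillations by `μ`
  set β := Real.log μ / Real.log κ with hβ
  have hβ0 : 0 < β := div_pos_of_neg_of_neg hlogμ hlogκ
  have hκβ : κ ^ β = μ := by
    rw [Real.rpow_def_of_pos hκ0, hβ, mul_div_cancel₀ _ hlogκ.ne, Real.exp_log hμ0']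
  refine ⟨2 * μ⁻¹ * L ^ β, β, by positivity, hβ0, ?_⟩
  intro C h z r t₁ u B hr hu hB t ht x
  have ht₁ : t₁ ∈ Icc (t₁ - r ^ 2) t₁ := ⟨by nlinarith [sq_nonneg r], le_rfl⟩
  have hB0 : 0 ≤ B := (abs_nonneg _).trans (hB t ht x)
  rcases hB0.eq_or_lt with hB0 | hB0
  · have h1 := hB t ht x
    have h2 := hB t₁ ht₁ z
    rw [← hB0] at h1 h2
    rw [abs_nonpos_iff.1 h1, abs_nonpos_iff.1 h2, ← hB0]
    simp
  set ρ₀ := r / L with hρ₀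
  have hρ₀0 : 0 < ρ₀ := by positivity
  have hLρ : L * ρ₀ = r := by rw [hρ₀]; field_simp
  have hρ₀r : ρ₀ ≤ r := by rw [hρ₀, div_le_iff₀ hL0]; nlinarith
  have hκ1 : ∀ n, κ ^ n ≤ 1 := fun n => pow_le_one₀ hκ0.le (by linarith)
  have hsq : ∀ n, (κ ^ n * ρ₀) ^ 2 ≤ r ^ 2 := fun n => by
    refine pow_le_pow_left₀ (by positivity) ?_ 2
    exact (mul_le_of_le_one_left hρ₀0.le (hκ1 n)).trans hρ₀r
  -- at scale `κ ^ n * ρ₀`, oscillation at most `2 * B * μ ^ n` inside the box, and beyond it a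
  -- quadratic excess, so that the hypotheses of `exists_oscillation` reproduce themselves
  have hind : ∀ n : ℕ, ∃ m : ℝ, ∀ t ∈ Icc (t₁ - (κ ^ n * ρ₀) ^ 2) t₁, ∀ x,
      (x ∈ box z (L * (κ ^ n * ρ₀)) → m ≤ u t x ∧ u t x ≤ m + 2 * B * μ ^ n) ∧
      (m - 2 * B * μ ^ n * (ε * (‖x - z‖ ^ 2 / (L * (κ ^ n * ρ₀)) ^ 2)) ≤ u t x ∧
       u t x ≤ m + 2 * B * μ ^ n
        + 2 * B * μ ^ n * (ε * (‖x - z‖ ^ 2 / (L * (κ ^ n * ρ₀)) ^ 2))) := by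
    intro n
    induction n with
    | zero =>
      refine ⟨-B, fun t ht x => ?_⟩
      have h1 := abs_le.1 (hB t ⟨(by linarith [ht.1, hsq 0] : t₁ - r ^ 2 ≤ t), ht.2⟩ x)
      have h2 : 0 ≤ 2 * B * μ ^ 0 * (ε * (‖x - z‖ ^ 2 / (L * (κ ^ 0 * ρ₀)) ^ 2)) := by
        positivity
      have h3 : 2 * B * μ ^ 0 = 2 * B := by rw [pow_zero, mul_one]
      rw [h3] at h2 ⊢
      exact ⟨fun _ => ⟨h1.1, by linarith⟩, by linarith, by linarith⟩
    | succ n ih =>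
      obtain ⟨m, hm⟩ := ih
      set ρ := κ ^ n * ρ₀ with hρ
      have hρ0 : 0 < ρ := by positivity
      set ω := 2 * B * μ ^ n with hω
      have hω0 : 0 < ω := by positivity
      have hκρ : κ ^ (n + 1) * ρ₀ = κ * ρ := by rw [hρ, pow_succ]; ring
      have hωs : 2 * B * μ ^ (n + 1) = μ * ω := by rw [hω, pow_succ]; ring
      rw [hκρ, hωs]
      have hρr : ρ ^ 2 ≤ r ^ 2 := hsq n
      have hsubx : box z (L * ρ) ⊆ box z r := by
        refine box_subset_box z (by positivity) ?_
        rw [← hLρ]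
        exact mul_le_mul_of_nonneg_left (mul_le_of_le_one_left hρ₀0.le (hκ1 n)) hL0.le
      have hκρ2 : (κ * ρ) ^ 2 ≤ ρ ^ 2 := by
        refine pow_le_pow_left₀ (by positivity) (mul_le_of_le_one_left hρ0.le (by linarith)) 2
      have hsubt : Icc (t₁ - (κ * ρ) ^ 2) t₁ ⊆ Icc (t₁ - ρ ^ 2) t₁ :=
        Icc_subset_Icc (by linarith) le_rfl
      have halt := hO C h z ρ t₁ (fun t x => ω⁻¹ * u t x + -(ω⁻¹ * m))
        (ω⁻¹ * B + |ω⁻¹ * m|) hρ0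
        ((hu.mono (by linarith) le_rfl hsubx).affine _ _)
        (fun t ht x => by
          refine (abs_add_le _ _).trans ?_
          rw [abs_neg, abs_mul, abs_of_pos (inv_pos.2 hω0)]
          have := hB t ⟨by linarith [ht.1], ht.2⟩ x
          gcongr)
        (fun t ht x hx => by
          have h1 := (hm t ht x).1 hx
          have e : ω⁻¹ * u t x + -(ω⁻¹ * m) = (u t x - m) / ω := by ring
          rw [e, le_div_iff₀ hω0, div_le_iff₀ hω0]
          constructor <;> linarith)
        (fun t ht x => by
          have h1 := (hm t ht x).2
          have e : ω⁻¹ * u t x + -(ω⁻¹ * m) = (u t x - m) / ω := by ring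
          rw [e, le_div_iff₀ hω0, div_le_iff₀ hω0]
          constructor <;> linarith)
      have hq : ∀ x, ‖x - z‖ ^ 2 / (L * ρ) ^ 2 = κ ^ 2 * (‖x - z‖ ^ 2 / (L * (κ * ρ)) ^ 2) := by
        intro x; field_simp
      have hκ2 : κ ^ 2 ≤ 1 / 64 := by nlinarith
      -- the bounds off the smaller box follow from the growth of the weight there
      have hgr : ∀ x, x ∉ box z (L * (κ * ρ)) →
          ε' * ω + ω * (ε * (‖x - z‖ ^ 2 / (L * ρ) ^ 2)) ≤
            μ * ω * (ε * (‖x - z‖ ^ 2 / (L * (κ * ρ)) ^ 2)) := by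
        intro x hx
        rw [mem_box (by positivity), not_le] at hx
        set Q := ‖x - z‖ ^ 2 / (L * (κ * ρ)) ^ 2 with hQ
        have hQ1 : 1 ≤ Q := by
          rw [hQ, le_div_iff₀ (by positivity), one_mul]
          exact pow_le_pow_left₀ (by positivity) hx.le 2
        rw [hq x]
        have h1 : ε' ≤ ε / 4 * Q := by nlinarith
        have h2 : κ ^ 2 * Q ≤ 1 / 64 * Q := mul_le_mul_of_nonneg_right hκ2 (by linarith)
        have h3 : ε * (κ ^ 2 * Q) ≤ ε * (1 / 64 * Q) := mul_le_mul_of_nonneg_left h2 hε0.le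
        have h4 : 3 / 4 * (ε * Q) ≤ μ * (ε * Q) :=
          mul_le_mul_of_nonneg_right hμ0 (by positivity)
        have h5 : 0 ≤ ε * Q := by positivity
        have h6 : ε' + ε * (κ ^ 2 * Q) ≤ μ * (ε * Q) := by linarith
        have h7 := mul_le_mul_of_nonneg_left h6 hω0.le
        linarith
      have hnn : ∀ x, 0 ≤ μ * ω * (ε * (‖x - z‖ ^ 2 / (L * (κ * ρ)) ^ 2)) := fun x => by
        positivity
      have hsubbox : box z (L * (κ * ρ)) ⊆ box z (L * ρ) :=
        box_subset_box z (by positivity)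
          (mul_le_mul_of_nonneg_left (mul_le_of_le_one_left hρ0.le (by linarith)) hL0.le)
      have hε'ω : 0 ≤ ε' * ω := by positivity
      have hμω : μ * ω = ω - ε' * ω := by rw [hμ]; ring
      rcases halt with hlow | hup
      · refine ⟨m + ε' * ω, fun t ht x => ?_⟩
        have h1 := hm t (hsubt ht) x
        have hin : x ∈ box z (L * (κ * ρ)) → m + ε' * ω ≤ u t x ∧
            u t x ≤ m + ε' * ω + μ * ω := by
          intro hx
          have h2 := hlow t ht x hx
          have e : ω⁻¹ * u t x + -(ω⁻¹ * m) = (u t x - m) / ω := by ring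
          rw [e, le_div_iff₀ hω0] at h2
          have h3 := (h1.1 (hsubbox hx)).2
          constructor <;> linarith
        refine ⟨hin, ?_⟩
        by_cases hx : x ∈ box z (L * (κ * ρ))
        · have h2 := hin hx
          have h3 := hnn x
          constructor <;> linarith
        · have h2 := hgr x hx
          constructor <;> linarith [h1.2.1, h1.2.2]
      · refine ⟨m, fun t ht x => ?_⟩
        have h1 := hm t (hsubt ht) x
        have hin : x ∈ box z (L * (κ * ρ)) → m ≤ u t x ∧ u t x ≤ m + μ * ω := by
          intro hx
          have h2 := hup t ht x hx
          have e : ω⁻¹ * u t x + -(ω⁻¹ * m) = (u t x - m) / ω := by ring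
          rw [e, div_le_iff₀ hω0] at h2
          have h3 := (h1.1 (hsubbox hx)).1
          constructor <;> linarith
        refine ⟨hin, ?_⟩
        by_cases hx : x ∈ box z (L * (κ * ρ))
        · have h2 := hin hx
          have h3 := hnn x
          constructor <;> linarith
        · have h2 := hgr x hx
          constructor <;> linarith [h1.2.1, h1.2.2]
  -- choose the scale `κ ^ n * ρ₀` of the size of the parabolic distance `D`
  set D := Real.sqrt (t₁ - t) + ‖x - z‖ with hD
  have hD0 : 0 ≤ D := by positivity
  have hsqrt : Real.sqrt (t₁ - t) ≤ D := by rw [hD]; linarith [norm_nonneg (x - z)]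
  have hnorm : ‖x - z‖ ≤ D := by rw [hD]; linarith [Real.sqrt_nonneg (t₁ - t)]
  have htD : t₁ - t ≤ D ^ 2 := by
    have := Real.sq_sqrt (by linarith [ht.2] : 0 ≤ t₁ - t)
    have := pow_le_pow_left₀ (Real.sqrt_nonneg _) hsqrt 2
    linarith
  have hDr : L ^ β * (D / r) ^ β = (D / ρ₀) ^ β := by
    rw [← Real.mul_rpow hL0.le (by positivity), hρ₀]; congr 1; field_simp
  have hgoal : 2 * μ⁻¹ * L ^ β * B * (D / r) ^ β = 2 * B * (μ⁻¹ * (D / ρ₀) ^ β) := by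
    rw [← hDr]; ring
  rw [hgoal]
  rcases hD0.eq_or_lt with hD0 | hD0
  · have hx : x = z := by
      have : ‖x - z‖ = 0 := le_antisymm (by linarith) (norm_nonneg _)
      exact sub_eq_zero.1 (norm_eq_zero.1 this)
    have htt : t = t₁ := by
      rw [← hD0] at htD
      linarith [ht.2]
    rw [hx, htt, sub_self, abs_zero]
    positivity
  rcases le_or_gt ρ₀ D with hcase | hcase
  · have h1 : 1 ≤ (D / ρ₀) ^ β := Real.one_le_rpow (by rwa [le_div_iff₀ hρ₀0, one_mul]) hβ0.le
    have h2 : 1 ≤ μ⁻¹ := (one_le_inv₀ hμ0').2 hμ1.le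
    have h3 : 1 ≤ μ⁻¹ * (D / ρ₀) ^ β := one_le_mul_of_one_le_of_one_le h2 h1
    have h4 := abs_sub (u t x) (u t₁ z)
    have h5 := hB t ht x
    have h6 := hB t₁ ht₁ z
    nlinarith
  · obtain ⟨n, hn1, hn2⟩ := exists_nat_pow_near_of_lt_one (div_pos hD0 hρ₀0)
      ((div_le_one hρ₀0).2 hcase.le) hκ0 (by linarith : κ < 1)
    obtain ⟨m, hm⟩ := hind n
    have hDn : D ≤ κ ^ n * ρ₀ := (div_le_iff₀ hρ₀0).1 hn2
    have hκn : 0 < κ ^ n * ρ₀ := by positivity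
    have hLn : κ ^ n * ρ₀ ≤ L * (κ ^ n * ρ₀) := le_mul_of_one_le_left hκn.le (by linarith)
    have a1 := (hm t ⟨by nlinarith [pow_le_pow_left₀ hD0.le hDn 2], ht.2⟩ x).1
      ((mem_box (by positivity)).2 (by linarith))
    have a2 := (hm t₁ ⟨by linarith [sq_nonneg (κ ^ n * ρ₀)], le_rfl⟩ z).1
      ((mem_box (by positivity)).2 (by simp; positivity))
    have h1 : |u t x - u t₁ z| ≤ 2 * B * μ ^ n := by
      rw [abs_le]; constructor <;> linarith
    refine h1.trans (mul_le_mul_of_nonneg_left ?_ (by positivity))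
    have h2 : μ ^ (n + 1) ≤ (D / ρ₀) ^ β := by
      rw [← hκβ, ← Real.rpow_natCast, ← Real.rpow_mul hκ0.le, mul_comm β, Real.rpow_mul hκ0.le,
        Real.rpow_natCast]
      exact Real.rpow_le_rpow (by positivity) hn1.le hβ0.le
    rw [inv_mul_eq_div, le_div_iff₀ hμ0', ← pow_succ]
    exact h2

/-! ### Ellipticity of the conductances -/

/-- The sup norm of a lattice point, as a natural number. -/
def natNorm {d : ℕ} (x : Lattice d) : ℕ := Finset.univ.sup fun i => (x i).natAbs

lemma natNorm_eq {d : ℕ} (x : Lattice d) : (natNorm x : ℝ) = ‖x‖ := by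
  apply le_antisymm
  · by_cases h : (Finset.univ : Finset (Fin d)).Nonempty
    · obtain ⟨i, _, hi⟩ := Finset.exists_mem_eq_sup _ h fun i => (x i).natAbs
      rw [natNorm, hi]
      have := norm_le_pi_norm x i
      rwa [Int.norm_eq_abs, ← Int.cast_abs, Int.abs_eq_natAbs, Int.cast_natCast] at this
    · rw [Finset.not_nonempty_iff_eq_empty] at h
      simp [natNorm, h]
  · rw [pi_norm_le_iff_of_nonneg (Nat.cast_nonneg _)]
    intro i
    rw [Int.norm_eq_abs, ← Int.cast_abs, Int.abs_eq_natAbs, Int.cast_natCast]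
    exact_mod_cast Finset.le_sup (f := fun i => (x i).natAbs) (Finset.mem_univ i)

lemma mul_pow_sub_pow_le {a b : ℝ} (hb : 0 ≤ b) (hab : b ≤ a) (d : ℕ) :
    a * (a ^ d - b ^ d) ≤ d * (a - b) * a ^ d := by
  induction d with
  | zero => simp
  | succ d ih =>
    have ha : 0 ≤ a := hb.trans hab
    have h1 := mul_le_mul_of_nonneg_left ih ha
    have h2 : a * (a - b) * b ^ d ≤ a * (a - b) * a ^ d :=
      mul_le_mul_of_nonneg_left (pow_le_pow_left₀ hb hab d) (mul_nonneg ha (by linarith))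
    have e : a * (a ^ (d + 1) - b ^ (d + 1)) = a * (a * (a ^ d - b ^ d)) + a * (a - b) * b ^ d := by
      ring
    rw [e]
    push_cast
    have e2 : (d + 1 : ℝ) * (a - b) * a ^ (d + 1) = a * (d * (a - b) * a ^ d) +
      a * (a - b) * a ^ d := by ring
    linarith

/-- The number of lattice points at distance `n` is of order `n ^ (d - 1)`. -/
lemma card_sphere_mul_le {d : ℕ} (S : Finset (Lattice d)) (x : Lattice d) {n : ℕ} (hn : 1 ≤ n)
    (hS : ∀ y ∈ S, natNorm (y - x) = n) :
    (S.card : ℝ) * n ≤ d * 3 ^ d * (n : ℝ) ^ d := by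
  have hn1 : (1 : ℝ) ≤ n := by exact_mod_cast hn
  have hsub : box x ((n : ℝ) - 1) ⊆ box x n := box_subset_box x (by linarith) (by linarith)
  have hS' : S ⊆ box x n \ box x ((n : ℝ) - 1) := by
    intro y hy
    have h1 := hS y hy
    have h2 := natNorm_eq (y - x)
    rw [h1] at h2
    rw [Finset.mem_sdiff, mem_box (by linarith), mem_box (by linarith), ← h2]
    exact ⟨le_rfl, by linarith⟩
  have h1 : (S.card : ℝ) ≤ (2 * (n : ℝ) + 1) ^ d - (2 * (n : ℝ) - 1) ^ d := by
    have h2 : S.card ≤ (box x n \ box x ((n : ℝ) - 1)).card := Finset.card_le_card hS'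
    rw [Finset.card_sdiff_of_subset hsub] at h2
    have h3 : (S.card : ℝ) ≤ ((box x n).card : ℝ) - (box x ((n : ℝ) - 1)).card := by
      rw [← Nat.cast_sub (Finset.card_le_card hsub)]; exact_mod_cast h2
    rw [card_box x (by linarith), card_box x (by linarith)] at h3
    have e1 : ⌊(n : ℝ)⌋ = (n : ℤ) := by simp
    have e2 : ⌊(n : ℝ) - 1⌋ = (n : ℤ) - 1 := by simp
    rw [e1, e2] at h3
    push_cast at h3
    convert h3 using 3
    ring
  have h2 := mul_pow_sub_pow_le (a := 2 * (n : ℝ) + 1) (b := 2 * (n : ℝ) - 1) (by linarith)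
    (by linarith) d
  have h3 : (2 * (n : ℝ) + 1) ^ d ≤ 3 ^ d * (n : ℝ) ^ d := by
    rw [← mul_pow]; exact pow_le_pow_left₀ (by linarith) (by linarith) d
  have h4 : (S.card : ℝ) * (2 * n) ≤
      (2 * n + 1) * ((2 * (n : ℝ) + 1) ^ d - (2 * (n : ℝ) - 1) ^ d) := by
    have h0 : (0 : ℝ) ≤ S.card := Nat.cast_nonneg _
    nlinarith
  have h5 : (d : ℝ) * (2 * (n : ℝ) + 1 - (2 * n - 1)) * (2 * (n : ℝ) + 1) ^ d ≤
      d * 2 * (3 ^ d * (n : ℝ) ^ d) := by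
    have e : (2 * (n : ℝ) + 1 - (2 * n - 1)) = 2 := by ring
    rw [e]; gcongr
  linarith

lemma norm_sub_le_edist2 {d : ℕ} (x y : Lattice d) : ‖y - x‖ ≤ edist2 x y := by
  have h0 : 0 ≤ edist2 x y := dist_nonneg
  rw [pi_norm_le_iff_of_nonneg h0]
  intro i
  rw [edist2, dist_comm, dist_eq_norm]
  have := PiLp.norm_apply_le (toE y - toE x) i
  refine le_trans (le_of_eq ?_) this
  simp [toE, Int.norm_eq_abs]

lemma edist2_le {d : ℕ} (x y : Lattice d) : edist2 x y ≤ d * ‖y - x‖ := by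
  have h0 : 0 ≤ (d : ℝ) * ‖y - x‖ := by positivity
  rw [edist2, EuclideanSpace.dist_eq]
  refine Real.sqrt_le_iff.2 ⟨h0, ?_⟩
  have h1 : ∀ i ∈ (Finset.univ : Finset (Fin d)),
      dist ((toE x) i) ((toE y) i) ^ 2 ≤ ‖y - x‖ ^ 2 := by
    intro i _
    refine pow_le_pow_left₀ dist_nonneg ?_ 2
    have := norm_le_pi_norm (y - x) i
    rw [Pi.sub_apply, Int.norm_eq_abs] at this
    rw [dist_comm, Real.dist_eq]
    simpa [toE] using this
  refine (Finset.sum_le_sum h1).trans ?_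
  rw [Finset.sum_const, Finset.card_univ, Fintype.card_fin, nsmul_eq_mul, mul_pow]
  rcases Nat.eq_zero_or_pos d with hd | hd
  · subst hd; simp
  · have : (1 : ℝ) ≤ d := by exact_mod_cast hd
    have : (d : ℝ) ≤ d ^ 2 := by nlinarith
    gcongr

/-- The second moment of the conductances is finite: summing `φ(n) n²` over spheres gives the series
`∑ n^{d+1} φ(n)`. -/
lemma Conductances.A3.sum_moment_le {d : ℕ} {G : Conductances d} {φ : ℕ → ℝ} (h : G.A3 φ)
    (x : Lattice d) (S : Finset (Lattice d)) :
    ∑ y ∈ S, (G.C x y : ℝ) * ‖y - x‖ ^ 2 ≤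
      d * 3 ^ d * ∑' n : ℕ, (n : ℝ) ^ (d + 1) * φ n := by
  obtain ⟨hanti, hφ0, hsum, _, hC⟩ := h
  have h1 : ∀ y ∈ S, (G.C x y : ℝ) * ‖y - x‖ ^ 2 ≤
      φ (natNorm (y - x)) * (natNorm (y - x) : ℝ) ^ 2 := by
    intro y _
    rw [natNorm_eq]
    refine mul_le_mul_of_nonneg_right ((hC x y).trans (hanti ?_)) (sq_nonneg _)
    apply Nat.le_floor
    rw [natNorm_eq]
    exact norm_sub_le_edist2 x y
  refine (Finset.sum_le_sum h1).trans ?_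
  rw [Finset.sum_comp (fun n : ℕ => φ n * (n : ℝ) ^ 2) (fun y => natNorm (y - x))]
  rw [← tsum_mul_left]
  refine le_trans (Finset.sum_le_sum fun n _ => ?_)
    ((hsum.mul_left ((d : ℝ) * 3 ^ d)).sum_le_tsum (S.image fun y => natNorm (y - x))
      fun n _ => mul_nonneg (by positivity) (mul_nonneg (by positivity) (hφ0 n)))
  rw [nsmul_eq_mul]
  rcases Nat.eq_zero_or_pos n with hn | hn
  · subst hn; simp
  · have h2 := card_sphere_mul_le {y ∈ S | natNorm (y - x) = n} x hn
      (fun y hy => (Finset.mem_filter.1 hy).2)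
    have h3 : 0 ≤ φ n * n := mul_nonneg (hφ0 n) (Nat.cast_nonneg n)
    have h4 := mul_le_mul_of_nonneg_right h2 h3
    calc _ = (({y ∈ S | natNorm (y - x) = n}.card : ℝ) * n) * (φ n * n) := by ring
      _ ≤ _ := h4
      _ = _ := by ring

/-- A chain of points of a set with `n` elements, along which `f` changes by at most `ℓ` in each
step, changes `f` by at most `n ℓ` altogether: loops can be erased. -/
lemma abs_sub_le_of_chain {X : Type*} [DecidableEq X] (z : ℕ → X) (f : X → ℝ) {ℓ : ℝ}
    (hℓ : 0 ≤ ℓ) {b : ℕ} (n : ℕ) : ∀ (S : Finset X) (a : ℕ), S.card ≤ n → a ≤ b →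
      (∀ i, a ≤ i → i ≤ b → z i ∈ S) →
      (∀ i, a ≤ i → i < b → |f (z i) - f (z (i + 1))| ≤ ℓ) → |f (z a) - f (z b)| ≤ n * ℓ := by
  induction n with
  | zero =>
    intro S a hS hab hz _
    rw [Nat.le_zero, Finset.card_eq_zero] at hS
    have := hz a le_rfl hab
    rw [hS] at this
    exact absurd this (Finset.notMem_empty _)
  | succ n ih =>
    intro S a hS hab hz hstep
    -- the last visit to the starting point
    obtain ⟨j, ⟨hj1, hj2⟩, hj3⟩ : ∃ j, (a ≤ j ∧ j ≤ b ∧ z j = z a ) ∧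
        ∀ i, j < i → i ≤ b → z i ≠ z a := by
      let T := (Finset.Icc a b).filter fun i => z i = z a
      have hT : T.Nonempty := ⟨a, by simp [T, hab]⟩
      have hm := Finset.max'_mem T hT
      simp only [T, Finset.mem_filter, Finset.mem_Icc] at hm
      refine ⟨T.max' hT, ⟨hm.1.1, hm.1.2, hm.2⟩, fun i hi hib hc => ?_⟩
      have : i ∈ T := by
        simp only [T, Finset.mem_filter, Finset.mem_Icc]
        exact ⟨⟨hm.1.1.trans hi.le, hib⟩, hc⟩
      exact absurd (Finset.le_max' T i this) (not_le.2 hi)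
    rcases hj2.1.eq_or_lt with hjb | hjb
    · have : z b = z a := hjb ▸ hj2.2
      rw [this, sub_self, abs_zero]
      positivity
    · have h1 := ih (S.erase (z a)) (j + 1)
        (by rw [Finset.card_erase_of_mem (hz a le_rfl hab)]; omega) hjb
        (fun i hi hib => Finset.mem_erase.2 ⟨hj3 i (by omega) hib, hz i (by omega) hib⟩)
        (fun i hi hib => hstep i (by omega) hib)
      have h2 := hstep j hj1 hjb
      rw [hj2.2] at h2
      have := abs_sub_le (f (z a)) (f (z (j + 1))) (f (z b))
      push_cast
      linarith

lemma edist2_add_single {d : ℕ} (x : Lattice d) (i : Fin d) :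
    edist2 x (x + Pi.single i 1) = 1 := by
  rw [edist2, dist_comm, dist_eq_norm]
  have : toE (x + Pi.single i 1) - toE x = EuclideanSpace.single i (1 : ℝ) := by
    ext j
    by_cases hj : j = i
    · subst hj; simp [toE]
    · simp [toE, hj]
  rw [this]; simp

/-- The chain in `A2` joining neighbours stays in a box of bounded size, so a single increment is
controlled by the energy in that box. -/
lemma Conductances.A2.sq_sub_le {d : ℕ} {G : Conductances d} {M₀ δ : ℝ} (h : G.A2 M₀ δ)
    (f : Lattice d → ℝ) (x : Lattice d) (i : Fin d) :
    (f (x + Pi.single i 1) - f x) ^ 2 ≤ ((box (0 : Lattice d) M₀).card : ℝ) ^ 2 / δ *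
      dirichlet (fun x y => (G.C x y : ℝ)) (box x M₀) f := by
  obtain ⟨hM, hδ, hz⟩ := h
  obtain ⟨N, hN, z, hz1, hzN, hin, hstep⟩ := hz x (x + Pi.single i 1) (edist2_add_single x i)
  set E := dirichlet (fun x y => (G.C x y : ℝ)) (box x M₀) f with hE
  have hnn : ∀ a b, 0 ≤ (G.C a b : ℝ) * (f a - f b) ^ 2 := fun a b => by positivity
  have hE0 : 0 ≤ E := Finset.sum_nonneg fun _ _ => Finset.sum_nonneg fun _ _ => hnn _ _
  have hmem : ∀ j, 1 ≤ j → j ≤ N → z j ∈ box x M₀ := fun j h1 h2 => by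
    rw [mem_box (by linarith)]
    exact (norm_sub_le_edist2 _ _).trans (hin j h1 h2).le
  have hs : ∀ j, 1 ≤ j → j < N → |f (z j) - f (z (j + 1))| ≤ Real.sqrt (E / δ) := by
    intro j h1 h2
    apply Real.abs_le_sqrt
    rw [le_div_iff₀ hδ]
    calc (f (z j) - f (z (j + 1))) ^ 2 * δ ≤
          (G.C (z j) (z (j + 1)) : ℝ) * (f (z j) - f (z (j + 1))) ^ 2 := by
          rw [mul_comm]; exact mul_le_mul_of_nonneg_right (hstep j h1 h2) (sq_nonneg _)
      _ ≤ ∑ b ∈ box x M₀, (G.C (z j) b : ℝ) * (f (z j) - f b) ^ 2 :=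
          Finset.single_le_sum (f := fun b => (G.C (z j) b : ℝ) * (f (z j) - f b) ^ 2)
            (fun b _ => hnn _ b) (hmem (j + 1) (by omega) h2)
      _ ≤ E := Finset.single_le_sum
            (f := fun a => ∑ b ∈ box x M₀, (G.C a b : ℝ) * (f a - f b) ^ 2)
            (fun a _ => Finset.sum_nonneg fun b _ => hnn a b) (hmem j h1 h2.le)
  have hcard : (box x M₀).card = (box (0 : Lattice d) M₀).card := by
    have : ((box x M₀).card : ℝ) = (box (0 : Lattice d) M₀).card := by
      rw [card_box x (by linarith), card_box 0 (by linarith)]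
    exact_mod_cast this
  have key := abs_sub_le_of_chain z f (Real.sqrt_nonneg _) _ (box x M₀) 1 le_rfl
    (by omega : 1 ≤ N) (fun j h1 h2 => hmem j h1 h2) hs
  rw [hz1, hzN, hcard, abs_sub_comm] at key
  have h2 := pow_le_pow_left₀ (abs_nonneg _) key 2
  rw [sq_abs, mul_pow, Real.sq_sqrt (by positivity)] at h2
  refine h2.trans (le_of_eq (by ring))

/-- Comparison of the nearest neighbour energy with the energy of the conductances: each pair of
points is used by the chains of boundedly many edges. -/
lemma Conductances.A2.edgeEnergy_le {d : ℕ} {G : Conductances d} {M₀ δ : ℝ} (h : G.A2 M₀ δ)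
    (f : Lattice d → ℝ) (z : Lattice d) {r : ℝ} (hr : 0 ≤ r) :
    edgeEnergy (box z r) f ≤ d * ((box (0 : Lattice d) M₀).card : ℝ) ^ 3 / δ *
      dirichlet (fun x y => (G.C x y : ℝ)) (box z (r + M₀)) f := by
  have hM : 1 ≤ M₀ := h.1
  have hδ : 0 < δ := h.2.1
  set m : ℝ := ((box (0 : Lattice d) M₀).card : ℝ) with hm
  set A := box z (r + M₀) with hA
  have hnn : ∀ a b, 0 ≤ (G.C a b : ℝ) * (f a - f b) ^ 2 := fun a b => by positivity
  have hsum : ∑ x ∈ box z r, dirichlet (fun x y => (G.C x y : ℝ)) (box x M₀) f ≤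
      m * dirichlet (fun x y => (G.C x y : ℝ)) A f := by
    have hsub : ∀ x ∈ box z r, box x M₀ ⊆ A := by
      intro x hx y hy
      rw [mem_box hr] at hx
      rw [mem_box (by linarith)] at hy
      rw [hA, mem_box (by linarith)]
      have : y - z = (y - x) + (x - z) := by abel
      rw [this]
      exact (norm_add_le _ _).trans (by linarith)
    calc _ ≤ ∑ x ∈ box z r, ∑ a ∈ A, if a ∈ box x M₀ then
          ∑ b ∈ A, (G.C a b : ℝ) * (f a - f b) ^ 2 else 0 := by
          refine Finset.sum_le_sum fun x hx => ?_
          rw [← Finset.sum_filter, dirichlet]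
          have e : A.filter (fun a => a ∈ box x M₀) = box x M₀ := by
            rw [Finset.filter_mem_eq_inter]; exact Finset.inter_eq_right.2 (hsub x hx)
          rw [e]
          exact Finset.sum_le_sum fun a _ =>
            Finset.sum_le_sum_of_subset_of_nonneg (hsub x hx) fun b _ _ => hnn a b
      _ = ∑ a ∈ A, ((box z r).filter fun x => a ∈ box x M₀).card *
            ∑ b ∈ A, (G.C a b : ℝ) * (f a - f b) ^ 2 := by
          rw [Finset.sum_comm]
          refine Finset.sum_congr rfl fun a _ => ?_
          rw [← Finset.sum_filter, Finset.sum_const, nsmul_eq_mul]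
      _ ≤ ∑ a ∈ A, m * ∑ b ∈ A, (G.C a b : ℝ) * (f a - f b) ^ 2 := by
          refine Finset.sum_le_sum fun a _ => ?_
          refine mul_le_mul_of_nonneg_right ?_ (Finset.sum_nonneg fun b _ => hnn a b)
          have h1 : (box z r).filter (fun x => a ∈ box x M₀) ⊆ box a M₀ := by
            intro x hx
            have := (Finset.mem_filter.1 hx).2
            rw [mem_box (by linarith)] at this ⊢
            rwa [norm_sub_rev]
          have h2 : (((box z r).filter fun x => a ∈ box x M₀).card : ℝ) ≤ (box a M₀).card := by
            exact_mod_cast Finset.card_le_card h1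
          refine h2.trans (le_of_eq ?_)
          rw [hm, card_box a (by linarith), card_box 0 (by linarith)]
      _ = _ := by rw [dirichlet, Finset.mul_sum]
  calc edgeEnergy (box z r) f ≤ ∑ i : Fin d, ∑ x ∈ box z r, m ^ 2 / δ *
        dirichlet (fun x y => (G.C x y : ℝ)) (box x M₀) f := by
        refine Finset.sum_le_sum fun i _ => ?_
        refine (Finset.sum_le_sum fun x _ => h.sq_sub_le f x i).trans ?_
        refine Finset.sum_le_sum_of_subset_of_nonneg (Finset.filter_subset _ _) fun x _ _ => ?_
        exact mul_nonneg (by positivity)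
          (Finset.sum_nonneg fun _ _ => Finset.sum_nonneg fun _ _ => hnn _ _)
    _ = d * (m ^ 2 / δ) * ∑ x ∈ box z r, dirichlet (fun x y => (G.C x y : ℝ)) (box x M₀) f := by
        rw [Finset.sum_const, Finset.card_univ, Fintype.card_fin, nsmul_eq_mul, ← Finset.mul_sum]
        ring
    _ ≤ d * (m ^ 2 / δ) * (m * dirichlet (fun x y => (G.C x y : ℝ)) A f) :=
        mul_le_mul_of_nonneg_left hsum (by positivity)
    _ = _ := by ring

/-- The hypotheses on the conductances give uniform ellipticity, with constants that depend only
on the data. -/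
theorem exists_elliptic (d : ℕ) (c₁ c₂ M₀ δ : ℝ) (φ : ℕ → ℝ) : ∃ Λ : ℝ, 1 ≤ Λ ∧
    ∀ G : Conductances d, G.A1 c₁ c₂ → G.A2 M₀ δ → G.A3 φ →
      Elliptic (fun x y => (G.C x y : ℝ)) Λ M₀ := by
  set m : ℝ := ((box (0 : Lattice d) M₀).card : ℝ) with hm
  set Λ := max 1 (max c₂ (max (d * 3 ^ d * ∑' n : ℕ, (n : ℝ) ^ (d + 1) * φ n)
    (d * m ^ 3 / δ))) with hΛ
  refine ⟨Λ, le_max_left _ _, fun G h1 h2 h3 => ?_⟩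
  have e1 : c₂ ≤ Λ := (le_max_left _ _).trans (le_max_right _ _)
  have e2 : d * 3 ^ d * ∑' n : ℕ, (n : ℝ) ^ (d + 1) * φ n ≤ Λ :=
    (le_max_left _ _).trans ((le_max_right _ _).trans (le_max_right _ _))
  have e3 : d * m ^ 3 / δ ≤ Λ :=
    (le_max_right _ _).trans ((le_max_right _ _).trans (le_max_right _ _))
  have hnn : ∀ x y, 0 ≤ (G.C x y : ℝ) * ‖y - x‖ ^ 2 := fun x y => by positivity
  refine ⟨le_max_left _ _, h2.1, fun x y => (G.C x y).2, fun x y => ?_, fun x => ?_, fun x => ?_,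
    fun x => ?_, fun x => ?_, fun z r hr f => ?_⟩
  · rw [G.symm]
  · exact NNReal.summable_coe.2 (G.summable x)
  · rw [← NNReal.coe_tsum]
    exact (h1.2.2 x).2.trans e1
  · exact summable_of_sum_le (hnn x) (h3.sum_moment_le x)
  · exact Real.tsum_le_of_sum_le (hnn x) fun S => (h3.sum_moment_le x S).trans e2
  · refine (h2.edgeEnergy_le f z hr).trans ?_
    refine mul_le_mul_of_nonneg_right e3 ?_
    exact Finset.sum_nonneg fun _ _ => Finset.sum_nonneg fun _ _ => by positivity

/-! ### On-diagonal decay of summable solutions -/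

/-- If a solution of total mass at most one is bounded by `S ≥ r^{-d} / δ₀`, then a time `r²` later
it is bounded by `S / 2`: its mean square over a cylinder of size `r` is at most `S r^{-d}`, so
the De Giorgi estimate applies to the solution divided by `S`. -/
lemma le_half_of_le {d : ℕ} {C : Lattice d → Lattice d → ℝ} {δ₀ : ℝ} (hδ₀ : 0 < δ₀)
    (hDG : ∀ (z : Lattice d) (r t₁ : ℝ) (v : ℝ → Lattice d → ℝ) (B : ℝ), 0 < r →
      SubSol C v (t₁ - r ^ 2) t₁ (box z r) →
      (∀ t ∈ Icc (t₁ - r ^ 2) t₁, ∀ x, |v t x| ≤ B) →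
      (∀ t ∈ Icc (t₁ - r ^ 2) t₁, ∀ x, v t x ≤ 1 + ‖x - z‖ ^ 2 / r ^ 2) →
      (∫ t in (t₁ - r ^ 2)..t₁, ∑ x ∈ box z r, max (v t x) 0 ^ 2) ≤ δ₀ * r ^ (d + 2) →
      ∀ t ∈ Icc (t₁ - r ^ 2 / 4) t₁, ∀ x ∈ box z (r / 2), v t x ≤ 1 / 2)
    {u : ℝ → Lattice d → ℝ} (hu : ∀ a b A, 0 ≤ a → Sol C u a b A)
    (h0 : ∀ t, 0 ≤ t → ∀ x, 0 ≤ u t x)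
    (hsum : ∀ t, 0 ≤ t → ∀ A : Finset (Lattice d), ∑ x ∈ A, u t x ≤ 1)
    {S r T : ℝ} (hT : 0 ≤ T) (hr : 0 < r) (hS : δ₀⁻¹ * (r ^ d)⁻¹ ≤ S)
    (hle : ∀ t, T ≤ t → ∀ x, u t x ≤ S) : ∀ t, T + r ^ 2 ≤ t → ∀ x, u t x ≤ S / 2 := by
  intro t ht x
  have hS0 : 0 < S := lt_of_lt_of_le (by positivity) hS
  have ht0 : ∀ s ∈ Icc (t - r ^ 2) t, T ≤ s := fun s hs => by linarith [hs.1]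
  have key := hDG x r t (fun s y => S⁻¹ * u s y) 1 hr
    (SubSol.const_mul (Sol.subSol (hu _ _ _ (by linarith))) (by positivity)) ?_ ?_ ?_ t
    ⟨by linarith [sq_nonneg r], le_rfl⟩ x ((mem_box (by positivity)).2 (by simp; positivity))
  · rw [inv_mul_le_iff₀ hS0] at key; linarith
  · intro s hs y
    have h1 := h0 s (hT.trans (ht0 s hs)) y
    rw [abs_of_nonneg (by positivity), inv_mul_le_iff₀ hS0]
    linarith [hle s (ht0 s hs) y]
  · intro s hs y
    have h2 : S⁻¹ * u s y ≤ 1 := by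
      rw [inv_mul_le_iff₀ hS0]; linarith [hle s (ht0 s hs) y]
    have : 0 ≤ ‖y - x‖ ^ 2 / r ^ 2 := by positivity
    linarith
  · have hb := intervalIntegral.norm_integral_le_of_norm_le_const (a := t - r ^ 2) (b := t)
      (f := fun s => ∑ y ∈ box x r, max (S⁻¹ * u s y) 0 ^ 2) (C := S⁻¹) ?_
    · refine (le_trans (le_abs_self _) hb).trans ?_
      have e : |t - (t - r ^ 2)| = r ^ 2 := by rw [sub_sub_cancel]; exact abs_of_nonneg (sq_nonneg r)
      rw [e]
      have h3 : S⁻¹ ≤ δ₀ * r ^ d := by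
        rw [← mul_inv] at hS
        exact inv_le_of_inv_le₀ (by positivity) hS
      calc S⁻¹ * r ^ 2 ≤ δ₀ * r ^ d * r ^ 2 := by gcongr
        _ = δ₀ * r ^ (d + 2) := by ring
    · intro s hs
      rw [uIoc_of_le (by linarith [sq_nonneg r])] at hs
      have hs' := ht0 s ⟨hs.1.le, hs.2⟩
      have h1 := h0 s (hT.trans hs')
      rw [Real.norm_of_nonneg (Finset.sum_nonneg fun _ _ => sq_nonneg _)]
      have h4 : ∀ y ∈ box x r, max (S⁻¹ * u s y) 0 ^ 2 ≤ S⁻¹ * u s y := by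
        intro y _
        have h5 : 0 ≤ S⁻¹ * u s y := mul_nonneg (by positivity) (h1 y)
        have h6 : S⁻¹ * u s y ≤ 1 := by rw [inv_mul_le_iff₀ hS0]; linarith [hle s hs' y]
        rw [max_eq_left h5]; nlinarith
      refine (Finset.sum_le_sum h4).trans ?_
      rw [← Finset.mul_sum]
      have := hsum s (hT.trans hs') (box x r)
      have h7 : 0 < S⁻¹ := by positivity
      nlinarith

/-- A nonnegative solution of total mass at most one at all times decays like `t^{-d/2}`. -/
theorem exists_onDiagonal (d : ℕ) (hd : 0 < d) {Λ : ℝ} (hΛ : 1 ≤ Λ) : ∃ c : ℝ, 0 < c ∧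
    ∀ (C : Lattice d → Lattice d → ℝ) (M : ℝ), Elliptic C Λ M →
      ∀ u : ℝ → Lattice d → ℝ, (∀ a b A, 0 ≤ a → Sol C u a b A) →
      (∀ t, 0 ≤ t → ∀ x, 0 ≤ u t x) →
      (∀ t, 0 ≤ t → ∀ A : Finset (Lattice d), ∑ x ∈ A, u t x ≤ 1) →
      ∀ t, 0 < t → ∀ x, u t x ≤ c * t ^ (-(d : ℝ) / 2) := by
  obtain ⟨δ₀, hδ₀, hDG⟩ := exists_deGiorgi d hΛ
  have hd' : (0 : ℝ) < d := by exact_mod_cast hd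
  set A : ℝ := δ₀⁻¹ * 2 ^ d + 1 with hA
  have hA1 : 1 ≤ A := by rw [hA]; have : 0 ≤ δ₀⁻¹ * 2 ^ d := by positivity
                         linarith
  refine ⟨A * (4 * d : ℝ) ^ ((d : ℝ) / 2), by positivity, ?_⟩
  intro C M hC u hu h0 hsum t ht x
  have hDG' := hDG C M hC
  have hone : ∀ t, 0 ≤ t → ∀ x, u t x ≤ 1 := fun t ht x => by simpa using hsum t ht {x}
  have step : ∀ j : ℕ, ∀ t, (d : ℝ) * 4 ^ j ≤ t → ∀ x, u t x ≤ A * ((2 ^ j) ^ d)⁻¹ := by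
    intro j
    induction j with
    | zero =>
      intro t ht x
      have := hone t (by have : (0:ℝ) ≤ d * 4 ^ 0 := by positivity
                         linarith) x
      simp; linarith
    | succ j ih =>
      -- `d` halvings, each taking time `(2 ^ j) ^ 2`, pass from the scale `2 ^ j` to `2 ^ (j + 1)`
      have inner : ∀ i : ℕ, i ≤ d → ∀ t, (d : ℝ) * 4 ^ j + i * (2 ^ j) ^ 2 ≤ t → ∀ x,
          u t x ≤ A * ((2 ^ j) ^ d)⁻¹ / 2 ^ i := by
        intro i
        induction i with
        | zero => intro _ t ht x; simpa using ih t (by simpa using ht) x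
        | succ i ihi =>
          intro hi t ht x
          have := le_half_of_le hδ₀ hDG' hu h0 hsum (S := A * ((2 ^ j) ^ d)⁻¹ / 2 ^ i)
            (r := 2 ^ j) (T := (d : ℝ) * 4 ^ j + i * (2 ^ j) ^ 2) (by positivity) (by positivity)
            ?_ (ihi (by omega)) t (by push_cast at ht; linarith) x
          · rw [pow_succ, ← div_div]; exact this
          · rw [le_div_iff₀ (by positivity)]
            have h2 : (2 : ℝ) ^ i ≤ 2 ^ d := pow_le_pow_right₀ (by norm_num) (by omega)
            have h3 : δ₀⁻¹ * 2 ^ i ≤ A := by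
              have : δ₀⁻¹ * 2 ^ i ≤ δ₀⁻¹ * 2 ^ d := by gcongr
              linarith
            calc δ₀⁻¹ * ((2 ^ j) ^ d)⁻¹ * 2 ^ i = (δ₀⁻¹ * 2 ^ i) * ((2 ^ j) ^ d)⁻¹ := by ring
              _ ≤ A * ((2 ^ j) ^ d)⁻¹ := by gcongr
      intro t ht x
      have e4 : ((2 : ℝ) ^ j) ^ 2 = 4 ^ j := by rw [← pow_mul, mul_comm, pow_mul]; norm_num
      have := inner d le_rfl t (by
        rw [e4]
        have : (0 : ℝ) ≤ d * 4 ^ j := by positivity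
        rw [pow_succ] at ht; nlinarith) x
      refine this.trans (le_of_eq ?_)
      rw [pow_succ, mul_pow, mul_inv]; field_simp
  have e1 : A * (4 * d : ℝ) ^ ((d : ℝ) / 2) * t ^ (-(d : ℝ) / 2) =
      A * ((4 * d : ℝ) / t) ^ ((d : ℝ) / 2) := by
    rw [Real.div_rpow (by positivity) ht.le, neg_div, Real.rpow_neg ht.le]; ring
  rw [e1]
  rcases lt_or_ge t d with htd | htd
  · have h1 : 1 ≤ ((4 * d : ℝ) / t) ^ ((d : ℝ) / 2) := by
      refine Real.one_le_rpow ?_ (by positivity)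
      rw [le_div_iff₀ ht]; linarith
    have := hone t ht.le x
    nlinarith
  · obtain ⟨j, hj1, hj2⟩ := exists_nat_pow_near (x := t / d) (y := 4)
      ((one_le_div hd').2 htd) (by norm_num)
    rw [le_div_iff₀ hd'] at hj1
    rw [div_lt_iff₀ hd'] at hj2
    refine (step j t (by linarith) x).trans ?_
    gcongr
    have h2 : ((2 ^ j : ℝ) ^ d)⁻¹ = ((4 ^ j : ℝ)⁻¹) ^ ((d : ℝ) / 2) := by
      have : (4 : ℝ) ^ j = (2 ^ j) ^ (2 : ℝ) := by
        rw [Real.rpow_two, ← pow_mul, mul_comm, pow_mul]; norm_num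
      rw [Real.inv_rpow (by positivity), this, ← Real.rpow_mul (by positivity),
        mul_div_cancel₀ _ (by norm_num : (2 : ℝ) ≠ 0), Real.rpow_natCast]
    rw [h2]
    gcongr
    rw [le_div_iff₀ ht, inv_mul_le_iff₀ (by positivity)]
    rw [pow_succ] at hj2; linarith

/-! ### The first step of the chain -/

lemma setOf_forall_le_eq {E : Type*} (n : ℕ) (a : ℕ → E) :
    {w : ℕ → E | ∀ i ≤ n, w i = a i} = Preorder.frestrictLe (π := fun _ : ℕ => E) n ⁻¹'
      ({fun i : Finset.Iic n => a i} : Set ((i : Finset.Iic n) → E)) := by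
  ext w
  constructor
  · intro h
    funext ⟨i, hi⟩
    exact h i (Finset.mem_Iic.1 hi)
  · intro h i hi
    exact congrFun (h : Preorder.frestrictLe (π := fun _ : ℕ => E) n w = _)
      ⟨i, Finset.mem_Iic.2 hi⟩

/-- Finite measures on sequences in a countable space are determined by the probabilities of the
initial segments. -/
lemma measure_seq_ext {E : Type*} [MeasurableSpace E] [Countable E] [MeasurableSingletonClass E]
    {μ ν : Measure (ℕ → E)} [IsFiniteMeasure μ] [IsFiniteMeasure ν]
    (h : ∀ (n : ℕ) (a : ℕ → E), μ {w | ∀ i ≤ n, w i = a i} = ν {w | ∀ i ≤ n, w i = a i}) :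
    μ = ν := by
  have hI : ∀ n : ℕ, μ.map (Finset.Iic n).restrict = ν.map (Finset.Iic n).restrict := by
    intro n
    refine Measure.ext_of_singleton fun b => ?_
    rw [Measure.map_apply (Finset.measurable_restrict _) (measurableSet_singleton _),
      Measure.map_apply (Finset.measurable_restrict _) (measurableSet_singleton _)]
    have he : (Finset.Iic n).restrict (π := fun _ : ℕ => E) ⁻¹' ({b} : Set (Finset.Iic n → E)) =
        {w : ℕ → E | ∀ i ≤ n, w i = (fun i => if hi : i ∈ Finset.Iic n then b ⟨i, hi⟩
          else b ⟨0, by simp⟩) i} := by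
      ext w
      simp only [mem_preimage, mem_singleton_iff, mem_ofPred_eq]
      constructor
      · rintro rfl i hi
        simp [Finset.mem_Iic.2 hi]
      · intro hw
        funext ⟨i, hi⟩
        simpa [hi] using hw i (Finset.mem_Iic.1 hi)
    rw [he, h]
  have hμ : IsProjectiveLimit μ (fun I : Finset ℕ => μ.map I.restrict) := fun _ => rfl
  refine hμ.unique fun I => ?_
  obtain ⟨n, hn⟩ : ∃ n, I ⊆ Finset.Iic n :=
    ⟨I.sup id, fun i hi => Finset.mem_Iic.2 (Finset.le_sup (f := id) hi)⟩
  have hr : I.restrict (π := fun _ : ℕ => E) =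
      Finset.restrict₂ hn ∘ (Finset.Iic n).restrict := rfl
  change ν.map I.restrict = μ.map I.restrict
  rw [hr, ← Measure.map_map (Finset.measurable_restrict₂ _) (Finset.measurable_restrict _),
    ← Measure.map_map (Finset.measurable_restrict₂ _) (Finset.measurable_restrict _), hI n]

/-- One coordinate of a product measure is independent of the family of the remaining ones. -/
lemma infinitePi_map_prod {ι ι' : Type*} (μ : ι → Measure ℝ) [∀ i, IsProbabilityMeasure (μ i)]
    (i₀ : ι) (e : ι' → ι) (he : Function.Injective e) (hi₀ : ∀ j, e j ≠ i₀) :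
    (Measure.infinitePi μ).map (fun u => (u i₀, fun j => u (e j))) =
      (μ i₀).prod (Measure.infinitePi fun j => μ (e j)) := by
  classical
  have hm : Measurable (fun u : ι → ℝ => (u i₀, fun j => u (e j))) :=
    (measurable_pi_apply _).prodMk (measurable_pi_lambda _ fun j => measurable_pi_apply _)
  symm
  refine Measure.prod_eq_generateFrom (C := {s | MeasurableSet s})
    (D := squareCylinders fun _ => {s : Set ℝ | MeasurableSet s})
    MeasurableSpace.generateFrom_measurableSet generateFrom_squareCylinders
    MeasurableSpace.isPiSystem_measurableSet
    (isPiSystem_squareCylinders (fun _ => MeasurableSpace.isPiSystem_measurableSet) (by simp))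
    ⟨fun _ => univ, fun _ => MeasurableSet.univ, fun _ => by simp, by simp [iUnion_const]⟩
    ⟨fun _ => univ, fun _ => ⟨∅, fun _ => univ, by simp, by simp⟩, fun _ => by simp,
      by simp [iUnion_const]⟩ ?_
  rintro s hs _ ⟨J, t, ht, rfl⟩
  have ht' : ∀ j, MeasurableSet (t j) := fun j => ht j (mem_univ j)
  rw [Measure.map_apply hm (MeasurableSet.prod hs
    (MeasurableSet.pi J.countable_toSet fun j _ => ht' j)),
    Measure.infinitePi_pi _ fun j _ => ht' j]
  let t' : ι → Set ℝ := fun i => if i = i₀ then s else if h : ∃ j, e j = i then t h.choose else univ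
  have ht'e : ∀ j, t' (e j) = t j := by
    intro j
    have h : ∃ j', e j' = e j := ⟨j, rfl⟩
    simp only [t', hi₀ j, if_false, h, dif_pos]
    rw [he h.choose_spec]
  have ht'0 : t' i₀ = s := by simp [t']
  have hpre : (fun u : ι → ℝ => (u i₀, fun j => u (e j))) ⁻¹' (s ×ˢ (J : Set ι').pi t) =
      ((insert i₀ (J.image e) : Finset ι) : Set ι).pi t' := by
    ext u
    simp only [mem_preimage, mem_prod, mem_pi, Finset.mem_coe, Finset.mem_insert,
      Finset.mem_image, forall_eq_or_imp, ht'0, forall_exists_index, and_imp,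
      forall_apply_eq_imp_iff₂, ht'e]
  rw [hpre, Measure.infinitePi_pi, Finset.prod_insert, ht'0, Finset.prod_image he.injOn]
  · simp_rw [ht'e]
  · simp only [Finset.mem_image, not_exists, not_and]
    exact fun j _ => hi₀ j
  · intro i _
    simp only [t']
    split_ifs with h1 h2
    · exact hs
    · exact ht' _
    · exact MeasurableSet.univ

namespace Conductances

variable {d : ℕ} (G : Conductances d)

lemma nu_pos (x : Lattice d) : 0 < G.nu x := G.pos x

instance (x : Lattice d) : IsProbabilityMeasure (expMeasure (G.nu x : ℝ)) :=
  isProbabilityMeasure_expMeasure (by exact_mod_cast G.nu_pos x)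

instance (x : Lattice d) : IsProbabilityMeasure (G.chainLaw x) := by
  unfold chainLaw; infer_instance

instance (x : Lattice d) : IsProbabilityMeasure (G.law x) := by
  unfold law; infer_instance

lemma stepPMF_apply (x y : Lattice d) :
    G.stepPMF x y = (G.C x y : ℝ≥0∞) * (G.nu x : ℝ≥0∞)⁻¹ := by
  rw [stepPMF, PMF.normalize_apply, G.tsum_coe]

lemma chainLaw_cylinder (x : Lattice d) (n : ℕ) (a : ℕ → Lattice d) :
    G.chainLaw x {w | ∀ i ≤ n, w i = a i} =
      (if a 0 = x then 1 else 0) * ∏ i ∈ Finset.range n, G.stepPMF (a i) (a (i + 1)) := by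
  induction n with
  | zero =>
    have h0 : (G.chainLaw x).map (Preorder.frestrictLe 0) = Measure.dirac (fun _ => x) := by
      rw [chainLaw, Kernel.traj_map_frestrictLe_apply, Kernel.partialTraj_self, Kernel.id_apply]
    rw [setOf_forall_le_eq, ← Measure.map_apply (Preorder.measurable_frestrictLe 0)
      (measurableSet_singleton _), h0,
      Measure.dirac_apply' _ (measurableSet_singleton _)]
    simp only [Finset.range_zero, Finset.prod_empty, mul_one, indicator, mem_singleton_iff,
      Pi.one_apply]
    refine if_congr ?_ rfl rfl
    constructor
    · intro h; exact (congrFun h ⟨0, by simp⟩).symm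
    · intro h
      funext ⟨i, hi⟩
      obtain rfl : i = 0 := by simpa using hi
      exact h.symm
  | succ n ih =>
    have h1 : {w : ℕ → Lattice d | ∀ i ≤ n + 1, w i = a i} =
        (fun w : ℕ → Lattice d =>
          (Preorder.frestrictLe (π := fun _ : ℕ => Lattice d) n w, w (n + 1))) ⁻¹'
          (({fun i : Finset.Iic n => a i} : Set ((i : Finset.Iic n) → Lattice d)) ×ˢ
            {a (n + 1)}) := by
      have h2 := setOf_forall_le_eq n a
      ext w
      have h3 : (∀ i ≤ n, w i = a i) ↔ Preorder.frestrictLe (π := fun _ : ℕ => Lattice d) n w ∈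
          ({fun i : Finset.Iic n => a i} : Set ((i : Finset.Iic n) → Lattice d)) :=
        Set.ext_iff.1 h2 w
      simp only [mem_ofPred_eq, mem_preimage, mem_prod, ← h3, mem_singleton_iff]
      constructor
      · intro h; exact ⟨fun i hi => h i (by omega), h _ le_rfl⟩
      · rintro ⟨h, h'⟩ i hi
        rcases Nat.lt_or_ge n i with hn | hn
        · obtain rfl : i = n + 1 := by omega
          exact h'
        · exact h i hn
    have hs : MeasurableSet (({fun i : Finset.Iic n => a i} :
        Set ((i : Finset.Iic n) → Lattice d)) ×ˢ ({a (n + 1)} : Set (Lattice d))) :=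
      (measurableSet_singleton _).prod (measurableSet_singleton _)
    rw [setOf_forall_le_eq, ← Measure.map_apply (Preorder.measurable_frestrictLe n)
      (measurableSet_singleton _), chainLaw, Kernel.traj_map_frestrictLe_apply] at ih
    rw [h1, ← Measure.map_apply ((Preorder.measurable_frestrictLe n).prodMk
      (measurable_pi_apply _)) hs, chainLaw,
      ← Kernel.partialTraj_compProd_eq_map_traj (Nat.zero_le n),
      Measure.compProd_apply_prod (measurableSet_singleton _) (measurableSet_singleton _),
      Measure.restrict_singleton, lintegral_smul_measure, lintegral_dirac, ih,
      Finset.prod_range_succ, ← mul_assoc, smul_eq_mul]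
    congr 1
    exact PMF.toMeasure_apply_singleton _ _ (measurableSet_singleton _)

lemma chainLaw_zero (x : Lattice d) : ∀ᵐ w ∂G.chainLaw x, w 0 = x := by
  have := G.chainLaw_cylinder x 0 (fun _ => x)
  simp only [if_true, Finset.range_zero, Finset.prod_empty, mul_one] at this
  rw [ae_iff]
  have h : MeasurableSet {w : ℕ → Lattice d | w 0 = x} :=
    measurable_pi_apply 0 (measurableSet_singleton _)
  exact (prob_compl_eq_zero_iff (μ := G.chainLaw x) h).2 (by rw [← this]; congr 1; ext w; simp)

/-- The Markov property of the discrete chain at time one. -/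
lemma chainLaw_map_shift (x : Lattice d) :
    (G.chainLaw x).map (fun w n => w (n + 1)) =
      Measure.sum fun y => G.stepPMF x y • G.chainLaw y := by
  have hms : Measurable (fun (w : ℕ → Lattice d) n => w (n + 1)) :=
    measurable_pi_lambda _ fun n => measurable_pi_apply _
  have hfin : IsFiniteMeasure (Measure.sum fun y => G.stepPMF x y • G.chainLaw y) := by
    constructor
    rw [Measure.sum_apply _ MeasurableSet.univ]
    simp [(G.stepPMF x).tsum_coe]
  have hfin' : IsProbabilityMeasure ((G.chainLaw x).map (fun w n => w (n + 1))) :=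
    Measure.isProbabilityMeasure_map hms.aemeasurable
  refine measure_seq_ext fun n a => ?_
  have hmeas : ∀ (m : ℕ) (b : ℕ → Lattice d), MeasurableSet {w : ℕ → Lattice d | ∀ i ≤ m, w i = b i} := by
    intro m b
    have : {w : ℕ → Lattice d | ∀ i ≤ m, w i = b i} = ⋂ i ∈ {i | i ≤ m}, {w | w i = b i} := by
      ext w; simp
    rw [this]
    exact MeasurableSet.biInter (to_countable _) fun i _ =>
      measurable_pi_apply i (measurableSet_singleton _)
  rw [Measure.map_apply hms (hmeas n a), Measure.sum_apply _ (hmeas n a)]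
  simp only [Measure.smul_apply, smul_eq_mul, chainLaw_cylinder]
  rw [tsum_eq_single (a 0) (by intro y hy; simp [hy.symm])]
  obtain ⟨b, hb0, hb⟩ : ∃ b : ℕ → Lattice d, b 0 = x ∧ ∀ i, b (i + 1) = a i :=
    ⟨fun i => Nat.casesOn i x a, rfl, fun _ => rfl⟩
  have h1 : G.chainLaw x ((fun w n => w (n + 1)) ⁻¹' {w | ∀ i ≤ n, w i = a i}) =
      G.chainLaw x {w | ∀ i ≤ n + 1, w i = b i} := by
    refine measure_congr ?_
    filter_upwards [G.chainLaw_zero x] with w hw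
    refine propext ⟨fun h i hi => ?_, fun h i hi => ?_⟩
    · cases i with
      | zero => exact hw.trans hb0.symm
      | succ i => exact (h i (by omega)).trans (hb i).symm
    · exact (h (i + 1) (by omega)).trans (hb i)
  rw [h1, chainLaw_cylinder, Finset.prod_range_succ']
  simp only [hb0, hb, if_true, one_mul]
  rw [mul_comm]

end Conductances

open Conductances (Omega)

/-- The sample point seen after the first jump. -/
def shift {d : ℕ} (ω : Omega d) : Omega d := (fun n => ω.1 (n + 1), fun i => ω.2 (i.1 + 1, i.2))

lemma measurable_shift {d : ℕ} : Measurable (shift (d := d)) := by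
  unfold shift
  refine Measurable.prodMk (measurable_pi_lambda _ fun n => ?_) (measurable_pi_lambda _ fun i => ?_)
  · exact (measurable_pi_apply _).comp measurable_fst
  · exact (measurable_pi_apply _).comp measurable_snd

namespace Conductances

variable {d : ℕ} (G : Conductances d)

lemma law_zero (x : Lattice d) : ∀ᵐ ω ∂G.law x, ω.1 0 = x :=
  Measure.quasiMeasurePreserving_fst.ae (G.chainLaw_zero x)

/-- The first clock and the sample point after the first jump are independent, and the latter
starts from a point chosen by the one-step law. -/
lemma law_map_shift (x : Lattice d) :
    (G.law x).map (fun ω => (ω.2 (0, x), shift ω)) =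
      (expMeasure (G.nu x : ℝ)).prod (Measure.sum fun y => G.stepPMF x y • G.law y) := by
  set clocks : Measure (ℕ × Lattice d → ℝ) :=
    Measure.infinitePi (fun i : ℕ × Lattice d => expMeasure (G.nu i.2 : ℝ)) with hclocks
  have hc := infinitePi_map_prod (fun i : ℕ × Lattice d => expMeasure (G.nu i.2 : ℝ)) (0, x)
    (fun i : ℕ × Lattice d => (i.1 + 1, i.2))
    (fun i j h => by
      simp only [Prod.mk.injEq, add_left_inj] at h; exact Prod.ext h.1 h.2)
    (fun j h => by simp at h)
  simp only at hc
  rw [← hclocks] at hc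
  have hms : Measurable (fun (w : ℕ → Lattice d) n => w (n + 1)) :=
    measurable_pi_lambda _ fun n => measurable_pi_apply _
  have hmc : Measurable (fun u : ℕ × Lattice d → ℝ =>
      (u (0, x), fun i : ℕ × Lattice d => u (i.1 + 1, i.2))) :=
    (measurable_pi_apply _).prodMk (measurable_pi_lambda _ fun j => measurable_pi_apply _)
  have h1 := Measure.map_prod_map (G.chainLaw x) clocks hms hmc
  rw [hc, chainLaw_map_shift] at h1
  have hr : Measurable (fun p : (ℕ → Lattice d) × ℝ × (ℕ × Lattice d → ℝ) =>
      (p.2.1, (p.1, p.2.2))) := by fun_prop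
  have h2 : (fun ω : Omega d => (ω.2 (0, x), shift ω)) =
      (fun p : (ℕ → Lattice d) × ℝ × (ℕ × Lattice d → ℝ) => (p.2.1, (p.1, p.2.2))) ∘
        Prod.map (fun (w : ℕ → Lattice d) n => w (n + 1)) (fun u : ℕ × Lattice d → ℝ =>
          (u (0, x), fun i : ℕ × Lattice d => u (i.1 + 1, i.2))) := rfl
  rw [law, ← hclocks, h2, ← Measure.map_map hr (hms.prodMap hmc), ← h1]
  have hfin : ∀ y, IsFiniteMeasure (G.stepPMF x y • G.chainLaw y) := fun y => by
    have := (G.stepPMF x).coe_le_one y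
    constructor
    simpa using lt_of_le_of_lt this ENNReal.one_lt_top
  refine (Measure.ext_of_lintegral _ fun f hf => ?_)
  rw [lintegral_map hf hr, lintegral_prod (fun p : (ℕ → Lattice d) × ℝ × (ℕ × Lattice d → ℝ) => f (p.2.1, (p.1, p.2.2)))
      (hf.comp hr).aemeasurable,
    lintegral_prod _ hf.aemeasurable, lintegral_sum_measure]
  simp_rw [lintegral_sum_measure]
  rw [lintegral_tsum (fun y => ?_)]
  · refine tsum_congr fun y => ?_
    rw [lintegral_smul_measure]
    simp_rw [lintegral_smul_measure]
    have hm2 : Measurable fun s : ℝ => ∫⁻ ω, f (s, ω) ∂(G.law y) :=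
      Measurable.lintegral_prod_right hf
    simp only [smul_eq_mul]
    rw [lintegral_const_mul _ hm2]
    congr 1
    have e1 : ∀ w : ℕ → Lattice d,
        ∫⁻ p, f (p.1, (w, p.2)) ∂((expMeasure (G.nu x : ℝ)).prod clocks) =
          ∫⁻ s, ∫⁻ u, f (s, (w, u)) ∂clocks ∂(expMeasure (G.nu x : ℝ)) := fun w =>
      lintegral_prod _ (hf.comp (by fun_prop :
        Measurable fun p : ℝ × (ℕ × Lattice d → ℝ) => (p.1, (w, p.2)))).aemeasurable
    have e2 : ∀ s : ℝ, ∫⁻ ω, f (s, ω) ∂(G.law y) =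
        ∫⁻ w, ∫⁻ u, f (s, (w, u)) ∂clocks ∂(G.chainLaw y) := fun s =>
      lintegral_prod _ (hf.comp (by fun_prop : Measurable fun p : Omega d => (s, p))).aemeasurable
    simp_rw [e1, e2]
    refine lintegral_lintegral_swap ?_
    refine (Measurable.lintegral_prod_right' (ν := clocks) (f := fun q : ((ℕ → Lattice d) × ℝ) ×
      (ℕ × Lattice d → ℝ) => f (q.1.2, (q.1.1, q.2))) (hf.comp (by fun_prop :
        Measurable fun q : ((ℕ → Lattice d) × ℝ) × (ℕ × Lattice d → ℝ) =>
          (q.1.2, (q.1.1, q.2))))).aemeasurable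
  · exact (Measurable.lintegral_prod_right' (ν := G.stepPMF x y • G.law y) hf).aemeasurable

/-- First step decomposition of an expectation. -/
lemma lintegral_first_step (x : Lattice d) {F : ℝ → Omega d → ℝ≥0∞}
    (hF : Measurable (fun p : ℝ × Omega d => F p.1 p.2)) :
    ∫⁻ ω, F (ω.2 (0, x)) (shift ω) ∂(G.law x) =
      ∫⁻ s in Ioi (0 : ℝ), ENNReal.ofReal (Real.exp (-(G.nu x * s))) *
        ∑' y, (G.C x y : ℝ≥0∞) * ∫⁻ ω, F s ω ∂(G.law y) := by
  have hm : Measurable (fun ω : Omega d => (ω.2 (0, x), shift ω)) :=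
    Measurable.prodMk ((measurable_pi_apply _).comp measurable_snd) measurable_shift
  have hν : 0 < (G.nu x : ℝ) := by exact_mod_cast G.nu_pos x
  have h1 : ∫⁻ ω, F (ω.2 (0, x)) (shift ω) ∂(G.law x) =
      ∫⁻ p, F p.1 p.2 ∂((G.law x).map (fun ω => (ω.2 (0, x), shift ω))) :=
    (lintegral_map hF hm).symm
  have hinner : ∀ y, Measurable fun s : ℝ => ∫⁻ ω, F s ω ∂(G.law y) := fun y =>
    Measurable.lintegral_prod_right hF
  have hsf : SFinite (Measure.sum fun y => G.stepPMF x y • G.law y) := by infer_instance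
  rw [h1, law_map_shift, lintegral_prod _ hF.aemeasurable]
  simp_rw [lintegral_sum_measure, lintegral_smul_measure]
  rw [expMeasure, gammaMeasure, lintegral_withDensity_eq_lintegral_mul _
    (show Measurable (gammaPDF 1 (G.nu x : ℝ)) from
      (measurable_exponentialPDFReal _).ennreal_ofReal)
    (show Measurable fun s : ℝ => ∑' y, G.stepPMF x y • ∫⁻ ω, F s ω ∂(G.law y) from
      Measurable.tsum fun y => (hinner y).const_mul _),
    ← lintegral_indicator measurableSet_Ioi]
  refine lintegral_congr_ae ?_
  have hne : ∀ᵐ s : ℝ, s ≠ 0 := by simp [ae_iff]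
  filter_upwards [hne] with s hs
  rcases lt_or_gt_of_ne hs with h | h
  · rw [indicator_of_notMem (by simp [h.le])]
    simp only [Pi.mul_apply]
    have : gammaPDF 1 (G.nu x : ℝ) s = 0 := gammaPDF_of_neg h
    rw [this, zero_mul]
  · rw [indicator_of_mem (by exact h)]
    have e : gammaPDF 1 (G.nu x : ℝ) s = ENNReal.ofReal (G.nu x * Real.exp (-(G.nu x * s))) :=
      exponentialPDF_of_nonneg h.le
    simp only [Pi.mul_apply, smul_eq_mul, stepPMF_apply]
    rw [e, ENNReal.ofReal_mul hν.le, mul_assoc, mul_left_comm, ← ENNReal.tsum_mul_left]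
    congr 1
    refine tsum_congr fun y => ?_
    have e2 : ENNReal.ofReal (G.nu x : ℝ) = (G.nu x : ℝ≥0∞) := ENNReal.ofReal_coe_nnreal
    rw [e2]
    have e3 : (G.nu x : ℝ≥0∞) * (G.nu x : ℝ≥0∞)⁻¹ = 1 :=
      ENNReal.mul_inv_cancel (by exact_mod_cast (G.nu_pos x).ne') ENNReal.coe_ne_top
    calc _ = ((G.nu x : ℝ≥0∞) * (G.nu x : ℝ≥0∞)⁻¹) *
        ((G.C x y : ℝ≥0∞) * ∫⁻ ω, F s ω ∂(G.law y)) := by ring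
      _ = _ := by rw [e3, one_mul]

end Conductances

/-! ### Transition probabilities with a prescribed number of jumps -/

open Conductances (Omega)

lemma measurable_clock {d : ℕ} (k : ℕ) : Measurable fun ω : Omega d => ω.2 (k, ω.1 k) := by
  have h : Measurable fun p : Lattice d × (ℕ × Lattice d → ℝ) => p.2 (k, p.1) :=
    measurable_from_prod_countable_right fun z => measurable_pi_apply (k, z)
  have h' : Measurable fun ω : Omega d => (ω.1 k, ω.2) :=
    ((measurable_pi_apply k).comp measurable_fst).prodMk measurable_snd
  exact h.comp h'

lemma measurable_jumpTime {d : ℕ} (n : ℕ) : Measurable fun ω : Omega d => jumpTime ω n := by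
  unfold jumpTime
  exact Finset.measurable_sum _ fun k _ => measurable_clock k

lemma measurable_chain {d : ℕ} (n : ℕ) : Measurable fun ω : Omega d => ω.1 n :=
  (measurable_pi_apply n).comp measurable_fst

lemma jumpTime_zero {d : ℕ} (ω : Omega d) : jumpTime ω 0 = 0 := by simp [jumpTime]

lemma jumpTime_succ {d : ℕ} (ω : Omega d) (n : ℕ) :
    jumpTime ω (n + 1) = ω.2 (0, ω.1 0) + jumpTime (shift ω) n := by
  rw [jumpTime, Finset.sum_range_succ', add_comm]; rfl

namespace Conductances

variable {d : ℕ} (G : Conductances d)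

/-- The probability `e^{-ν_x s}` of no jump from `x` before time `s`, as a function on the line
vanishing at negative times. -/
noncomputable def noJump (x : Lattice d) (s : ℝ) : ℝ≥0∞ :=
  if 0 ≤ s then ENNReal.ofReal (Real.exp (-(G.nu x * s))) else 0

lemma measurable_noJump (x : Lattice d) : Measurable (G.noJump x) :=
  Measurable.ite measurableSet_Ici (by fun_prop) measurable_const

lemma law_first_step (x : Lattice d) {A : Set (ℝ × Omega d)} (hA : MeasurableSet A) :
    G.law x {ω | (ω.2 (0, x), shift ω) ∈ A} =
      ∫⁻ s, G.noJump x s * ∑' y, (G.C x y : ℝ≥0∞) * G.law y {ω | (s, ω) ∈ A} := by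
  have hm : Measurable (fun ω : Omega d => (ω.2 (0, x), shift ω)) :=
    Measurable.prodMk ((measurable_pi_apply _).comp measurable_snd) measurable_shift
  have h := G.lintegral_first_step x (F := fun s ω => A.indicator 1 (s, ω))
    (measurable_one.indicator hA)
  have e1 : ∫⁻ ω, A.indicator 1 (ω.2 (0, x), shift ω) ∂(G.law x) =
      G.law x {ω | (ω.2 (0, x), shift ω) ∈ A} := by
    exact lintegral_indicator_one (hm hA)
  have e2 : ∀ s y, ∫⁻ ω, A.indicator 1 (s, ω) ∂(G.law y) = G.law y {ω | (s, ω) ∈ A} := by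
    intro s y
    exact lintegral_indicator_one (measurable_prodMk_left hA)
  rw [e1] at h
  simp_rw [e2] at h
  rw [h, ← lintegral_indicator measurableSet_Ioi]
  refine lintegral_congr_ae ?_
  have hne : ∀ᵐ s : ℝ, s ≠ 0 := by simp [ae_iff]
  filter_upwards [hne] with s hs
  rcases lt_or_gt_of_ne hs with h | h
  · rw [indicator_of_notMem (by simp [h.le]), noJump, if_neg (by linarith), zero_mul]
  · rw [indicator_of_mem (by exact h), noJump, if_pos h.le]

/-- `ℙ^x(X_n = y, T_n ≤ t < T_{n+1})`. -/
noncomputable def nStep (n : ℕ) (t : ℝ) (x y : Lattice d) : ℝ≥0∞ :=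
  G.law x {ω | ω.1 n = y ∧ jumpTime ω n ≤ t ∧ t < jumpTime ω (n + 1)}

lemma measurableSet_nStep (n : ℕ) (y : Lattice d) : MeasurableSet
    {p : ℝ × Omega d | p.2.1 n = y ∧ jumpTime p.2 n ≤ p.1 ∧ p.1 < jumpTime p.2 (n + 1)} := by
  refine MeasurableSet.inter ?_ (MeasurableSet.inter ?_ ?_)
  · exact ((measurable_chain n).comp measurable_snd) (measurableSet_singleton y)
  · exact measurableSet_le ((measurable_jumpTime n).comp measurable_snd) measurable_fst
  · exact measurableSet_lt measurable_fst ((measurable_jumpTime (n + 1)).comp measurable_snd)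

lemma measurable_nStep (n : ℕ) (x y : Lattice d) : Measurable fun t => G.nStep n t x y :=
  measurable_measure_prodMk_left (measurableSet_nStep n y)

lemma law_lt_clock (x : Lattice d) {t : ℝ} (ht : 0 ≤ t) :
    G.law x {ω | t < ω.2 (0, x)} = ENNReal.ofReal (Real.exp (-(G.nu x * t))) := by
  have hν : 0 < (G.nu x : ℝ) := by exact_mod_cast G.nu_pos x
  have h1 := G.law_first_step x (A := {p | t < p.1}) (measurableSet_lt measurable_const measurable_fst)
  have e : ∀ s : ℝ, G.noJump x s * ∑' y, (G.C x y : ℝ≥0∞) * G.law y {_ω | t < s} =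
      (Ioi t).indicator (fun s => ENNReal.ofReal (G.nu x * Real.exp (-(G.nu x) * s))) s := by
    intro s
    rcases lt_or_ge t s with h | h
    · simp only [h, indicator_of_mem (show s ∈ Ioi t from h), ofPred_true, measure_univ, mul_one]
      rw [G.tsum_coe, noJump, if_pos (by linarith), mul_comm, ENNReal.ofReal_mul hν.le,
        ENNReal.ofReal_coe_nnreal, neg_mul]
    · simp [not_lt.2 h]
  simp only [mem_ofPred_eq] at h1
  rw [h1]
  simp_rw [e]
  rw [lintegral_indicator measurableSet_Ioi, ← ofReal_integral_eq_lintegral_ofReal]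
  · rw [integral_const_mul, integral_exp_mul_Ioi (by linarith)]
    congr 1
    rw [neg_mul]; field_simp
  · exact (integrableOn_exp_mul_Ioi (by linarith) t).const_mul _
  · exact Filter.Eventually.of_forall fun s => by positivity

lemma nStep_zero (t : ℝ) (x y : Lattice d) :
    G.nStep 0 t x y = if x = y then G.noJump x t else 0 := by
  have h : G.nStep 0 t x y = G.law x {ω | x = y ∧ 0 ≤ t ∧ t < ω.2 (0, x)} := by
    refine measure_congr ?_
    filter_upwards [G.law_zero x] with ω hω
    refine propext ?_
    change (ω.1 0 = y ∧ jumpTime ω 0 ≤ t ∧ t < jumpTime ω (0 + 1)) ↔ (x = y ∧ 0 ≤ t ∧ t < ω.2 (0, x))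
    rw [jumpTime_succ, jumpTime_zero, jumpTime_zero, hω, add_zero]
  rw [h]
  by_cases hxy : x = y
  · by_cases ht : 0 ≤ t
    · simp only [hxy, ht, true_and, if_true, noJump]
      exact G.law_lt_clock y ht
    · simp [ht, noJump]
  · simp [hxy]

/-- Decomposition at the first jump. -/
lemma nStep_succ (n : ℕ) (t : ℝ) (x y : Lattice d) :
    G.nStep (n + 1) t x y =
      ∫⁻ s, G.noJump x s * ∑' z, (G.C x z : ℝ≥0∞) * G.nStep n (t - s) z y := by
  have hA : MeasurableSet {p : ℝ × Omega d |
      p.2.1 n = y ∧ jumpTime p.2 n ≤ t - p.1 ∧ t - p.1 < jumpTime p.2 (n + 1)} := by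
    have hm : Measurable fun p : ℝ × Omega d => (t - p.1, p.2) := by fun_prop
    exact hm (measurableSet_nStep n y)
  rw [show (∫⁻ s, G.noJump x s * ∑' z, (G.C x z : ℝ≥0∞) * G.nStep n (t - s) z y) = _ from
    (G.law_first_step x hA).symm]
  refine measure_congr ?_
  filter_upwards [G.law_zero x] with ω hω
  refine propext ?_
  change (ω.1 (n + 1) = y ∧ jumpTime ω (n + 1) ≤ t ∧ t < jumpTime ω (n + 1 + 1)) ↔
    (ω.1 (n + 1) = y ∧ jumpTime (shift ω) n ≤ t - ω.2 (0, x) ∧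
      t - ω.2 (0, x) < jumpTime (shift ω) (n + 1))
  rw [jumpTime_succ, jumpTime_succ, hω, le_sub_iff_add_le', sub_lt_iff_lt_add']

/-- Decomposition at the last jump. -/
lemma nStep_succ' (n : ℕ) (t : ℝ) (x y : Lattice d) :
    G.nStep (n + 1) t x y =
      ∫⁻ s, G.noJump y s * ∑' z, (G.C z y : ℝ≥0∞) * G.nStep n (t - s) x z := by
  induction n generalizing t x with
  | zero =>
    rw [nStep_succ]
    have e1 : ∀ s, ∑' z, (G.C x z : ℝ≥0∞) * G.nStep 0 (t - s) z y =
        (G.C x y : ℝ≥0∞) * G.noJump y (t - s) := by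
      intro s
      rw [tsum_eq_single y (fun z hz => by rw [nStep_zero, if_neg hz, mul_zero]),
        nStep_zero, if_pos rfl]
    have e2 : ∀ s, ∑' z, (G.C z y : ℝ≥0∞) * G.nStep 0 (t - s) x z =
        (G.C x y : ℝ≥0∞) * G.noJump x (t - s) := by
      intro s
      rw [tsum_eq_single x (fun z hz => by rw [nStep_zero, if_neg (Ne.symm hz), mul_zero]),
        nStep_zero, if_pos rfl]
    simp_rw [e1, e2]
    rw [← lintegral_sub_left_eq_self _ t]
    refine lintegral_congr fun s => ?_
    rw [sub_sub_cancel]; ring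
  | succ n ih =>
    rw [nStep_succ]
    have hm : ∀ z w, Measurable fun p : ℝ × ℝ => G.nStep n (t - p.1 - p.2) z w := fun z w =>
      (G.measurable_nStep n z w).comp (by fun_prop)
    have hm' : ∀ z w, Measurable fun p : ℝ × ℝ => G.nStep n (t - p.2 - p.1) z w := fun z w =>
      (G.measurable_nStep n z w).comp (by fun_prop)
    have e1 : ∀ s, G.noJump x s * ∑' z, (G.C x z : ℝ≥0∞) * G.nStep (n + 1) (t - s) z y =
        ∫⁻ r, G.noJump x s * ∑' z, (G.C x z : ℝ≥0∞) * (G.noJump y r *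
          ∑' w, (G.C w y : ℝ≥0∞) * G.nStep n (t - s - r) z w) := by
      intro s
      have hz : ∀ z, Measurable fun r => G.noJump y r *
          ∑' w, (G.C w y : ℝ≥0∞) * G.nStep n (t - s - r) z w := fun z =>
        (G.measurable_noJump y).mul (Measurable.tsum fun w =>
          ((G.measurable_nStep n z w).comp (by fun_prop)).const_mul _)
      rw [lintegral_const_mul _ (Measurable.tsum fun z => (hz z).const_mul _),
        lintegral_tsum fun z => ((hz z).const_mul _).aemeasurable]
      congr 1
      refine tsum_congr fun z => ?_
      rw [lintegral_const_mul _ (hz z), ih]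
    have e2 : ∀ r, G.noJump y r * ∑' w, (G.C w y : ℝ≥0∞) * G.nStep (n + 1) (t - r) x w =
        ∫⁻ s, G.noJump y r * ∑' w, (G.C w y : ℝ≥0∞) * (G.noJump x s *
          ∑' z, (G.C x z : ℝ≥0∞) * G.nStep n (t - r - s) z w) := by
      intro r
      have hz : ∀ w, Measurable fun s => G.noJump x s *
          ∑' z, (G.C x z : ℝ≥0∞) * G.nStep n (t - r - s) z w := fun w =>
        (G.measurable_noJump x).mul (Measurable.tsum fun z =>
          ((G.measurable_nStep n z w).comp (by fun_prop)).const_mul _)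
      rw [lintegral_const_mul _ (Measurable.tsum fun z => (hz z).const_mul _),
        lintegral_tsum fun z => ((hz z).const_mul _).aemeasurable]
      congr 1
      refine tsum_congr fun w => ?_
      rw [lintegral_const_mul _ (hz w), nStep_succ]
    simp_rw [e1, e2]
    rw [lintegral_lintegral_swap]
    · refine lintegral_congr fun r => lintegral_congr fun s => ?_
      simp_rw [← ENNReal.tsum_mul_left]
      rw [ENNReal.tsum_comm]
      refine tsum_congr fun w => tsum_congr fun z => ?_
      rw [sub_right_comm t r s]; ring
    · refine Measurable.aemeasurable ?_
      refine ((G.measurable_noJump x).comp measurable_fst).mul (Measurable.tsum fun z =>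
        Measurable.const_mul (((G.measurable_noJump y).comp measurable_snd).mul
          (Measurable.tsum fun w => (hm z w).const_mul _)) _)

/-- Symmetry, by comparing the decompositions at the first and at the last jump. -/
lemma nStep_comm (n : ℕ) (t : ℝ) (x y : Lattice d) : G.nStep n t x y = G.nStep n t y x := by
  induction n generalizing t x y with
  | zero =>
    rw [nStep_zero, nStep_zero]
    by_cases h : x = y
    · subst h; rfl
    · rw [if_neg h, if_neg (Ne.symm h)]
  | succ n ih =>
    rw [nStep_succ, nStep_succ']
    refine lintegral_congr fun s => ?_
    congr 1
    refine tsum_congr fun z => ?_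
    rw [ih, G.symm]

lemma clock_pos (x : Lattice d) : ∀ᵐ ω ∂G.law x, ∀ i, 0 < ω.2 i := by
  refine ae_all_iff.2 fun i => ?_
  have h : ∀ᵐ u : ℝ ∂(expMeasure (G.nu i.2 : ℝ)), 0 < u := by
    rw [expMeasure, gammaMeasure, ae_withDensity_iff
      (show Measurable (gammaPDF 1 (G.nu i.2 : ℝ)) from
        (measurable_exponentialPDFReal _).ennreal_ofReal)]
    have hne : ∀ᵐ s : ℝ, s ≠ 0 := by simp [ae_iff]
    filter_upwards [hne] with s hs h0
    by_contra hn
    exact h0 (gammaPDF_of_neg (lt_of_le_of_ne (not_lt.1 hn) hs))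
  have h2 := (measurePreserving_eval_infinitePi
    (fun i : ℕ × Lattice d => expMeasure (G.nu i.2 : ℝ)) i).quasiMeasurePreserving.ae h
  exact Measure.quasiMeasurePreserving_snd.ae h2

lemma law_clock_le (x : Lattice d) {t : ℝ} (ht : 0 ≤ t) :
    G.law x {ω | ω.2 (0, x) ≤ t} = ENNReal.ofReal (1 - Real.exp (-(G.nu x * t))) := by
  have hm : MeasurableSet {ω : Omega d | t < ω.2 (0, x)} :=
    measurableSet_lt measurable_const ((measurable_pi_apply _).comp measurable_snd)
  have h : {ω : Omega d | ω.2 (0, x) ≤ t} = {ω : Omega d | t < ω.2 (0, x)}ᶜ := by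
    ext ω; simp
  rw [h, prob_compl_eq_one_sub hm, law_lt_clock _ _ ht, ENNReal.ofReal_sub _ (by positivity),
    ENNReal.ofReal_one]

/-- The probability that the chain makes at least `n` jumps before time `T` decays geometrically. -/
lemma law_jumpTime_le {c₂ : ℝ} (hc : ∀ x, (G.nu x : ℝ) ≤ c₂) (n : ℕ) {T : ℝ} (hT : 0 ≤ T)
    (x : Lattice d) : ∀ t ≤ T, G.law x {ω | jumpTime ω n ≤ t} ≤
      ENNReal.ofReal (1 - Real.exp (-(c₂ * T))) ^ n := by
  induction n generalizing x with
  | zero => intro t _; simpa using prob_le_one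
  | succ n ih =>
    intro t ht
    have hA : MeasurableSet {p : ℝ × Omega d | p.1 ≤ t ∧ 0 ≤ p.1 ∧ jumpTime p.2 n ≤ t - p.1} := by
      refine (measurableSet_le measurable_fst measurable_const).inter
        ((measurableSet_le measurable_const measurable_fst).inter
        (measurableSet_le ((measurable_jumpTime n).comp measurable_snd) (by fun_prop)))
    have hA' : MeasurableSet {p : ℝ × Omega d | p.1 ≤ t} :=
      measurableSet_le measurable_fst measurable_const
    have h1 : G.law x {ω | jumpTime ω (n + 1) ≤ t} ≤ G.law x {ω | (ω.2 (0, x), shift ω) ∈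
        {p : ℝ × Omega d | p.1 ≤ t ∧ 0 ≤ p.1 ∧ jumpTime p.2 n ≤ t - p.1}} := by
      refine measure_mono_ae ?_
      filter_upwards [G.law_zero x, G.clock_pos x] with ω hω hpos
      intro h
      change jumpTime ω (n + 1) ≤ t at h
      rw [jumpTime_succ, hω] at h
      have h0 : 0 ≤ jumpTime (shift ω) n := Finset.sum_nonneg fun k _ => (hpos _).le
      exact ⟨by linarith, (hpos _).le, by linarith⟩
    refine h1.trans ?_
    rw [G.law_first_step x hA]
    set B := ENNReal.ofReal (1 - Real.exp (-(c₂ * T))) with hB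
    have h2 : ∀ s y, G.law y {ω | (s, ω) ∈
        {p : ℝ × Omega d | p.1 ≤ t ∧ 0 ≤ p.1 ∧ jumpTime p.2 n ≤ t - p.1}} ≤
        B ^ n * G.law y {ω | (s, ω) ∈ {p : ℝ × Omega d | p.1 ≤ t}} := by
      intro s y
      by_cases hs : s ≤ t
      · by_cases hs0 : 0 ≤ s
        · simp only [mem_ofPred_eq, hs, hs0, true_and, ofPred_true, measure_univ, mul_one]
          exact ih y _ (by linarith)
        · simp [hs0]
      · simp [hs]
    calc _ ≤ ∫⁻ s, B ^ n * (G.noJump x s * ∑' y, (G.C x y : ℝ≥0∞) *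
          G.law y {ω | (s, ω) ∈ {p : ℝ × Omega d | p.1 ≤ t}}) := by
          refine lintegral_mono fun s => ?_
          calc _ ≤ G.noJump x s * ∑' y, (G.C x y : ℝ≥0∞) *
                (B ^ n * G.law y {ω | (s, ω) ∈ {p : ℝ × Omega d | p.1 ≤ t}}) := by
                gcongr with y; exact h2 s y
            _ = _ := by
                simp_rw [mul_left_comm _ (B ^ n) _]
                rw [ENNReal.tsum_mul_left]; ring
      _ = B ^ n * G.law x {ω | ω.2 (0, x) ≤ t} := by
          rw [lintegral_const_mul' _ _ (ENNReal.pow_ne_top ENNReal.ofReal_ne_top),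
            ← G.law_first_step x hA']; rfl
      _ ≤ B ^ n * B := by
          gcongr
          calc _ ≤ G.law x {ω | ω.2 (0, x) ≤ T} := measure_mono fun ω hω => le_trans hω ht
            _ ≤ B := by
              rw [law_clock_le _ _ hT]
              refine ENNReal.ofReal_le_ofReal ?_
              have := hc x
              gcongr
      _ = B ^ (n + 1) := (pow_succ _ _).symm

/-- There are only finitely many jumps in bounded time. -/
lemma exists_lt_jumpTime {c₂ : ℝ} (hc : ∀ x, (G.nu x : ℝ) ≤ c₂) (x : Lattice d) {t : ℝ}
    (ht : 0 ≤ t) : ∀ᵐ ω ∂G.law x, ∃ n, t < jumpTime ω n := by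
  rw [ae_iff]
  have hB : ENNReal.ofReal (1 - Real.exp (-(c₂ * t))) < 1 := by
    rw [ENNReal.ofReal_lt_one]; linarith [Real.exp_pos (-(c₂ * t))]
  have hlim := ENNReal.tendsto_pow_atTop_nhds_zero_of_lt_one hB
  refine le_antisymm (ge_of_tendsto' hlim fun n => ?_) zero_le
  refine le_trans (measure_mono fun ω hω => ?_) (G.law_jumpTime_le hc n ht x t le_rfl)
  simp only [not_exists, not_lt, mem_ofPred_eq] at hω
  exact hω n

end Conductances

/-- The value of the continuous time chain between two consecutive jumps. -/
lemma Y_eq {d : ℕ} {ω : Omega d} (hpos : ∀ i, 0 < ω.2 i) {n : ℕ} {t : ℝ} (h1 : jumpTime ω n ≤ t)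
    (h2 : t < jumpTime ω (n + 1)) : Y t ω = ω.1 n := by
  classical
  have hmono : StrictMono (jumpTime ω) := strictMono_nat_of_lt_succ fun k => by
    rw [jumpTime, jumpTime, Finset.sum_range_succ]
    linarith [hpos (k, ω.1 k)]
  have hex : ∃ n, jumpTime ω n ≤ t ∧ t < jumpTime ω (n + 1) := ⟨n, h1, h2⟩
  have hY : Y t ω = ω.1 (Nat.find hex) := by
    rw [Y, dif_pos hex]
  have hf := Nat.find_spec hex
  rw [hY]
  have ha : Nat.find hex < n + 1 := hmono.lt_iff_lt.1 (hf.1.trans_lt h2)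
  have hb : n < Nat.find hex + 1 := hmono.lt_iff_lt.1 (h1.trans_lt hf.2)
  rw [show Nat.find hex = n by omega]

lemma exists_jumpTime_le_lt {d : ℕ} {ω : Omega d} {t : ℝ} (ht : 0 ≤ t)
    (h : ∃ n, t < jumpTime ω n) : ∃ n, jumpTime ω n ≤ t ∧ t < jumpTime ω (n + 1) := by
  classical
  have hf := Nat.find_spec h
  obtain ⟨m, hm⟩ : ∃ m, Nat.find h = m + 1 := by
    refine Nat.exists_eq_succ_of_ne_zero fun h0 => ?_
    rw [h0, jumpTime_zero] at hf; linarith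
  rw [hm] at hf
  exact ⟨m, not_lt.1 (Nat.find_min h (by omega)), hf⟩

namespace Conductances

variable {d : ℕ} (G : Conductances d)

lemma setOf_Y_eq_ae {c₂ : ℝ} (hc : ∀ x, (G.nu x : ℝ) ≤ c₂) {t : ℝ} (ht : 0 ≤ t) (x y : Lattice d) :
    ({ω | Y t ω = y} : Set (Omega d)) =ᵐ[G.law x] ⋃ n, {ω : Omega d | ω.1 n = y ∧
      jumpTime ω n ≤ t ∧ t < jumpTime ω (n + 1)} := by
  filter_upwards [G.clock_pos x, G.exists_lt_jumpTime hc x ht] with ω hpos hex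
  refine propext ?_
  obtain ⟨n, hn1, hn2⟩ := exists_jumpTime_le_lt ht hex
  change Y t ω = y ↔ ω ∈ ⋃ n, {ω : Omega d | ω.1 n = y ∧ jumpTime ω n ≤ t ∧
    t < jumpTime ω (n + 1)}
  simp only [mem_iUnion, mem_ofPred_eq]
  constructor
  · intro h; exact ⟨n, by rw [← h, Y_eq hpos hn1 hn2], hn1, hn2⟩
  · rintro ⟨m, hm, hm1, hm2⟩
    rw [← hm, Y_eq hpos hm1 hm2]

lemma nullMeasurableSet_Y {c₂ : ℝ} (hc : ∀ x, (G.nu x : ℝ) ≤ c₂) {t : ℝ} (ht : 0 ≤ t)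
    (x y : Lattice d) : NullMeasurableSet {ω | Y t ω = y} (G.law x) :=
  (MeasurableSet.iUnion fun n => (measurable_prodMk_left (measurableSet_nStep n y) :
    MeasurableSet {ω : Omega d | ω.1 n = y ∧ jumpTime ω n ≤ t ∧
      t < jumpTime ω (n + 1)})).nullMeasurableSet.congr (G.setOf_Y_eq_ae hc ht x y).symm

/-- Transition probabilities of the continuous time chain, by the number of jumps. -/
lemma law_Y_eq {c₂ : ℝ} (hc : ∀ x, (G.nu x : ℝ) ≤ c₂) {t : ℝ} (ht : 0 ≤ t) (x y : Lattice d) :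
    G.law x {ω | Y t ω = y} = ∑' n, G.nStep n t x y := by
  have hms : ∀ n, MeasurableSet {ω : Omega d | ω.1 n = y ∧ jumpTime ω n ≤ t ∧
      t < jumpTime ω (n + 1)} := fun n => measurable_prodMk_left (measurableSet_nStep n y)
  rw [measure_congr (G.setOf_Y_eq_ae hc ht x y), measure_iUnion₀ ?_ fun n => (hms n).nullMeasurableSet]
  · rfl
  · intro m n hmn
    change G.law x (_ ∩ _) = 0
    rw [← nonpos_iff_eq_zero]
    have h0 : G.law x {ω | ¬ ∀ i, 0 < ω.2 i} = 0 := G.clock_pos x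
    rw [← h0]
    refine measure_mono fun ω hω hpos => ?_
    have hmono : StrictMono (jumpTime ω) := strictMono_nat_of_lt_succ fun k => by
      rw [jumpTime, jumpTime, Finset.sum_range_succ]
      linarith [hpos (k, ω.1 k)]
    obtain ⟨⟨_, a1, a2⟩, ⟨_, b1, b2⟩⟩ := hω
    have ha : n < m + 1 := hmono.lt_iff_lt.1 (b1.trans_lt a2)
    have hb : m < n + 1 := hmono.lt_iff_lt.1 (a1.trans_lt b2)
    omega

end Conductances

/-! ### The heat kernel solves the heat equation -/

section Duhamel

variable {d : ℕ} {C : Lattice d → Lattice d → ℝ} {Λ M : ℝ} {u : ℝ → Lattice d → ℝ} {B : ℝ}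

lemma Elliptic.measurable_tsum_mul (hm : ∀ x, Measurable fun t => u t x) (x : Lattice d) :
    Measurable fun r => ∑' y, C x y * u r y :=
  Measurable.tsum fun y => (hm y).const_mul _

lemma Elliptic.abs_tsum_mul_le (h : Elliptic C Λ M) {f : Lattice d → ℝ} (hB : ∀ x, |f x| ≤ B)
    (x : Lattice d) : |∑' y, C x y * f y| ≤ (∑' y, C x y) * B := by
  have hsum := h.summable_mul x (f := f) hB
  have := norm_tsum_le_tsum_norm hsum.norm
  refine this.trans ?_
  rw [← tsum_mul_right]
  refine hsum.norm.tsum_le_tsum (fun y => ?_) ((h.summable x).mul_right B)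
  rw [norm_mul, Real.norm_of_nonneg (h.nonneg x y)]
  exact mul_le_mul_of_nonneg_left (hB y) (h.nonneg x y)

lemma Elliptic.intervalIntegrable_exp_mul (h : Elliptic C Λ M) (hB : ∀ t x, |u t x| ≤ B)
    (hm : ∀ x, Measurable fun t => u t x) (x : Lattice d) (p q : ℝ) :
    IntervalIntegrable (fun r => Real.exp ((∑' y, C x y) * r) * ∑' y, C x y * u r y)
      volume p q := by
  refine IntervalIntegrable.continuousOn_mul ?_ (by fun_prop)
  refine (intervalIntegrable_const (c := (∑' y, C x y) * B)).mono_fun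
    (Elliptic.measurable_tsum_mul hm x).aestronglyMeasurable ?_
  exact Filter.Eventually.of_forall fun r => (h.abs_tsum_mul_le (hB r) x).trans (le_abs_self _)

/-- A bounded function, continuous in time, that satisfies the integrated (Duhamel) form of the
heat equation at a point solves it there. -/
lemma hasDerivAt_of_duhamel (h : Elliptic C Λ M) (hB : ∀ t x, |u t x| ≤ B)
    (hm : ∀ x, Measurable fun t => u t x) {T : ℝ}
    (hc : ∀ y, ContinuousOn (fun t => u t y) (Icc 0 T)) {x : Lattice d} {k : ℝ}
    (hu : ∀ t ∈ Icc 0 T, u t x = Real.exp (-((∑' y, C x y) * t)) *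
      (k + ∫ r in (0 : ℝ)..t, Real.exp ((∑' y, C x y) * r) * ∑' y, C x y * u r y))
    {t : ℝ} (ht : t ∈ Ioo 0 T) : HasDerivAt (fun t => u t x) (gen C (u t) x) t := by
  set F : ℝ → ℝ := fun r => ∑' y, C x y * u r y with hF
  have hsum : ∀ r, Summable fun y => C x y * u r y := fun r => h.summable_mul x (f := u r) (hB r)
  have hFc : ContinuousOn F (Icc 0 T) := by
    refine continuousOn_tsum (u := fun y => C x y * B) (fun y => (hc y).const_smul (C x y))
      ((h.summable x).mul_right B) fun y t _ => ?_
    rw [norm_mul, Real.norm_of_nonneg (h.nonneg x y)]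
    exact mul_le_mul_of_nonneg_left (hB t y) (h.nonneg x y)
  have hnhds : Icc 0 T ∈ nhds t := Icc_mem_nhds ht.1 ht.2
  have hd1 : HasDerivAt (fun t => ∫ r in (0 : ℝ)..t, Real.exp ((∑' y, C x y) * r) * F r)
      (Real.exp ((∑' y, C x y) * t) * F t) t := by
    refine intervalIntegral.integral_hasDerivAt_right
      (h.intervalIntegrable_exp_mul hB hm x 0 t) ?_ ?_
    · exact (Measurable.mul (by fun_prop) (Elliptic.measurable_tsum_mul hm
        x)).stronglyMeasurable.stronglyMeasurableAtFilter
    · exact ContinuousAt.mul (by fun_prop) (hFc.continuousAt hnhds)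
  have hd2 : HasDerivAt (fun t => Real.exp (-((∑' y, C x y) * t)))
      (Real.exp (-((∑' y, C x y) * t)) * -(∑' y, C x y)) t := by
    have := ((hasDerivAt_id t).const_mul (∑' y, C x y)).neg.exp
    simpa using this
  have hd3 := hd2.mul (hd1.const_add k)
  have hgen : gen C (u t) x = F t - (∑' y, C x y) * u t x := by
    rw [gen, ← tsum_mul_right, ← (hsum t).tsum_sub ((h.summable x).mul_right _)]
    exact tsum_congr fun y => by ring
  have hval : Real.exp (-((∑' y, C x y) * t)) * -(∑' y, C x y) *
      (k + ∫ r in (0 : ℝ)..t, Real.exp ((∑' y, C x y) * r) * F r) +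
      Real.exp (-((∑' y, C x y) * t)) * (Real.exp ((∑' y, C x y) * t) * F t) =
      gen C (u t) x := by
    rw [hgen, hu t ⟨ht.1.le, ht.2.le⟩, ← mul_assoc (Real.exp _) (Real.exp _), ← Real.exp_add,
      neg_add_cancel, Real.exp_zero]
    ring
  rw [← hval]
  refine hd3.congr_of_eventuallyEq ?_
  filter_upwards [hnhds] with s hs
  exact hu s hs

/-- A bounded function satisfying the Duhamel form of the heat equation everywhere solves it. -/
lemma sol_of_duhamel (h : Elliptic C Λ M) (hB : ∀ t x, |u t x| ≤ B)
    (hm : ∀ x, Measurable fun t => u t x) (k : Lattice d → ℝ)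
    (hu : ∀ x t, 0 ≤ t → u t x = Real.exp (-((∑' y, C x y) * t)) *
      (k x + ∫ r in (0 : ℝ)..t, Real.exp ((∑' y, C x y) * r) * ∑' y, C x y * u r y))
    (a b : ℝ) (A : Finset (Lattice d)) (ha : 0 ≤ a) : Sol C u a b A := by
  have huc : ∀ x, ContinuousOn (fun t => u t x) (Ici 0) := by
    intro x
    have := intervalIntegral.continuous_primitive (h.intervalIntegrable_exp_mul hB hm x) 0
    refine ContinuousOn.congr (f := fun t => Real.exp (-((∑' y, C x y) * t)) *
      (k x + ∫ r in (0 : ℝ)..t, Real.exp ((∑' y, C x y) * r) * ∑' y, C x y * u r y)) ?_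
      fun t ht => hu x t ht
    fun_prop
  intro x _
  refine ⟨(huc x).mono fun t ht => ha.trans ht.1, fun t ht => ?_⟩
  exact hasDerivAt_of_duhamel h hB hm (T := b) (fun y => (huc y).mono fun t ht => ht.1)
    (fun t ht => hu x t ht.1) ⟨ha.trans_lt ht.1, ht.2⟩

end Duhamel

namespace Conductances

variable {d : ℕ} (G : Conductances d)

/-- `ℙ^x(Y_t = y)`. -/
noncomputable def transition (t : ℝ) (x y : Lattice d) : ℝ := (G.law x).real {ω | Y t ω = y}

lemma nStep_of_neg (n : ℕ) {t : ℝ} (ht : t < 0) (x y : Lattice d) : G.nStep n t x y = 0 := by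
  induction n generalizing t x with
  | zero => rw [nStep_zero, noJump, if_neg (not_le.2 ht), ite_self]
  | succ n ih =>
    rw [nStep_succ, lintegral_eq_zero_iff']
    · refine Filter.Eventually.of_forall fun s => ?_
      by_cases hs : 0 ≤ s
      · simp [ih (show t - s < 0 by linarith)]
      · simp [noJump, hs]
    · exact ((G.measurable_noJump x).mul (Measurable.tsum fun z =>
        ((G.measurable_nStep n z y).comp (by fun_prop)).const_mul _)).aemeasurable

lemma tsum_nStep_le_one {c₂ : ℝ} (hc : ∀ x, (G.nu x : ℝ) ≤ c₂) (t : ℝ) (x y : Lattice d) :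
    ∑' n, G.nStep n t x y ≤ 1 := by
  rcases lt_or_ge t 0 with ht | ht
  · simp [G.nStep_of_neg _ ht]
  · rw [← G.law_Y_eq hc ht]; exact prob_le_one

/-- The backward equation in integrated form. -/
lemma tsum_nStep_eq (t : ℝ) (x y : Lattice d) : ∑' n, G.nStep n t x y =
    (if x = y then G.noJump x t else 0) +
      ∫⁻ s, G.noJump x s * ∑' z, (G.C x z : ℝ≥0∞) * ∑' n, G.nStep n (t - s) z y := by
  have hm : ∀ n, Measurable fun s => G.noJump x s *
      ∑' z, (G.C x z : ℝ≥0∞) * G.nStep n (t - s) z y := fun n =>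
    (G.measurable_noJump x).mul (Measurable.tsum fun z =>
      ((G.measurable_nStep n z y).comp (by fun_prop)).const_mul _)
  rw [tsum_eq_zero_add' ENNReal.summable, nStep_zero]
  simp_rw [nStep_succ]
  rw [← lintegral_tsum fun n => (hm n).aemeasurable]
  congr 1
  refine lintegral_congr fun s => ?_
  rw [ENNReal.tsum_mul_left, ENNReal.tsum_comm]
  simp_rw [ENNReal.tsum_mul_left]

lemma coe_nu (x : Lattice d) : (G.nu x : ℝ) = ∑' y, (G.C x y : ℝ) := by
  rw [nu, NNReal.coe_tsum]

lemma toReal_duhamel {c₂ : ℝ} (hc : ∀ x, (G.nu x : ℝ) ≤ c₂) (y x : Lattice d) {t : ℝ}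
    (ht : 0 ≤ t) : (∑' n, G.nStep n t x y).toReal = Real.exp (-((∑' y, (G.C x y : ℝ)) * t)) *
      ((if x = y then 1 else 0) + ∫ r in (0 : ℝ)..t, Real.exp ((∑' y, (G.C x y : ℝ)) * r) *
        ∑' z, (G.C x z : ℝ) * (∑' n, G.nStep n r z y).toReal) := by
  set ν : ℝ := ∑' y, (G.C x y : ℝ) with hν
  have hν' : (G.nu x : ℝ) = ν := G.coe_nu x
  set u : ℝ → Lattice d → ℝ := fun r z => (∑' n, G.nStep n r z y).toReal with hu
  have hfin : ∀ r z, ∑' n, G.nStep n r z y ≠ ⊤ := fun r z =>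
    ne_top_of_le_ne_top ENNReal.one_ne_top (G.tsum_nStep_le_one hc r z y)
  have hu0 : ∀ r z, 0 ≤ u r z := fun r z => ENNReal.toReal_nonneg
  have hu1 : ∀ r z, u r z ≤ 1 := fun r z =>
    ENNReal.toReal_le_of_le_ofReal zero_le_one (by simpa using G.tsum_nStep_le_one hc r z y)
  have hsumC : Summable fun z => (G.C x z : ℝ) := by exact_mod_cast G.summable x
  have hsum : ∀ r, Summable fun z => (G.C x z : ℝ) * u r z := fun r =>
    Summable.of_nonneg_of_le (fun z => mul_nonneg (NNReal.coe_nonneg _) (hu0 r z))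
      (fun z => mul_le_of_le_one_right (NNReal.coe_nonneg _) (hu1 r z)) hsumC
  set F : ℝ → ℝ := fun r => ∑' z, (G.C x z : ℝ) * u r z with hF
  have hF0 : ∀ r, 0 ≤ F r := fun r =>
    tsum_nonneg fun z => mul_nonneg (NNReal.coe_nonneg _) (hu0 r z)
  have hFν : ∀ r, F r ≤ ν := fun r => (hsum r).tsum_le_tsum
      (fun z => mul_le_of_le_one_right (NNReal.coe_nonneg _) (hu1 r z)) hsumC
  have hum : ∀ z, Measurable fun r => u r z := fun z =>
    (Measurable.tsum fun n => G.measurable_nStep n z y).ennreal_toReal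
  have hFm : Measurable F := Measurable.tsum fun z => (hum z).const_mul _
  have hFE : ∀ r, ∑' z, (G.C x z : ℝ≥0∞) * ∑' n, G.nStep n r z y = ENNReal.ofReal (F r) := by
    intro r
    rw [hF, ENNReal.ofReal_tsum_of_nonneg
      (fun z => mul_nonneg (NNReal.coe_nonneg _) (hu0 r z)) (hsum r)]
    refine tsum_congr fun z => ?_
    rw [ENNReal.ofReal_mul (NNReal.coe_nonneg _), ENNReal.ofReal_coe_nnreal,
      ENNReal.ofReal_toReal (hfin r z)]
  have hint : ∫⁻ s, G.noJump x s * ∑' z, (G.C x z : ℝ≥0∞) * ∑' n, G.nStep n (t - s) z y =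
      ENNReal.ofReal (∫ s in (0 : ℝ)..t, Real.exp (-(ν * s)) * F (t - s)) := by
    have hI : IntegrableOn (fun s => Real.exp (-(ν * s)) * F (t - s)) (Ioc 0 t) := by
      rw [← intervalIntegrable_iff_integrableOn_Ioc_of_le ht]
      refine IntervalIntegrable.continuousOn_mul ?_ (by fun_prop)
      refine (intervalIntegrable_const (c := ν)).mono_fun
        (hFm.comp (by fun_prop)).aestronglyMeasurable ?_
      refine Filter.Eventually.of_forall fun r => ?_
      change |F (t - r)| ≤ |ν|
      rw [abs_of_nonneg (hF0 _)]
      exact (hFν _).trans (le_abs_self _)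
    rw [intervalIntegral.integral_of_le ht, ofReal_integral_eq_lintegral_ofReal hI
      (Filter.Eventually.of_forall fun s => mul_nonneg (Real.exp_pos _).le (hF0 _)),
      ← lintegral_indicator measurableSet_Ioc]
    refine lintegral_congr_ae ?_
    have hne : ∀ᵐ s : ℝ, s ≠ 0 := by simp [ae_iff]
    filter_upwards [hne] with s hs
    by_cases h0 : 0 < s
    · by_cases h1 : s ≤ t
      · rw [indicator_of_mem (show s ∈ Ioc 0 t from ⟨h0, h1⟩), hFE, noJump, if_pos h0.le, hν',
          ENNReal.ofReal_mul (Real.exp_pos _).le]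
      · rw [indicator_of_notMem (fun h => h1 h.2)]
        simp [G.nStep_of_neg _ (show t - s < 0 by linarith [not_le.1 h1])]
    · rw [indicator_of_notMem (fun h => h0 h.1), noJump,
        if_neg (fun h => h0 (lt_of_le_of_ne h (Ne.symm hs))), zero_mul]
  have hsub : ∫ s in (0 : ℝ)..t, Real.exp (-(ν * s)) * F (t - s) =
      Real.exp (-(ν * t)) * ∫ r in (0 : ℝ)..t, Real.exp (ν * r) * F r := by
    have := intervalIntegral.integral_comp_sub_left
      (fun r => Real.exp (-(ν * (t - r))) * F r) t (a := 0) (b := t)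
    simp only [sub_sub_cancel, sub_self, sub_zero] at this
    rw [this, ← intervalIntegral.integral_const_mul]
    refine intervalIntegral.integral_congr fun r _ => ?_
    rw [← mul_assoc, ← Real.exp_add]; congr 2; ring
  have hIn : 0 ≤ ∫ s in (0 : ℝ)..t, Real.exp (-(ν * s)) * F (t - s) :=
    intervalIntegral.integral_nonneg ht fun s _ => mul_nonneg (Real.exp_pos _).le (hF0 _)
  change (∑' n, G.nStep n t x y).toReal = _
  rw [tsum_nStep_eq, hint, ENNReal.toReal_add _ ENNReal.ofReal_ne_top,
    ENNReal.toReal_ofReal hIn, hsub, mul_add, noJump, if_pos ht, hν']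
  · congr 1
    split_ifs
    · rw [ENNReal.toReal_ofReal (Real.exp_pos _).le, mul_one]
    · simp
  · rw [noJump]; split_ifs <;> simp

lemma transition_eq {c₂ : ℝ} (hc : ∀ x, (G.nu x : ℝ) ≤ c₂) {t : ℝ} (ht : 0 ≤ t)
    (x y : Lattice d) : G.transition t x y = (∑' n, G.nStep n t x y).toReal := by
  rw [transition, Measure.real, G.law_Y_eq hc ht]

lemma transition_comm {c₂ : ℝ} (hc : ∀ x, (G.nu x : ℝ) ≤ c₂) {t : ℝ} (ht : 0 ≤ t)
    (x y : Lattice d) : G.transition t x y = G.transition t y x := by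
  rw [G.transition_eq hc ht, G.transition_eq hc ht]
  simp_rw [G.nStep_comm _ t x y]

lemma transition_nonneg (t : ℝ) (x y : Lattice d) : 0 ≤ G.transition t x y := measureReal_nonneg

lemma sum_transition_le_one {c₂ : ℝ} (hc : ∀ x, (G.nu x : ℝ) ≤ c₂) {t : ℝ} (ht : 0 ≤ t)
    (y : Lattice d) (A : Finset (Lattice d)) : ∑ x ∈ A, G.transition t x y ≤ 1 := by
  simp_rw [fun x => G.transition_comm hc ht x y, transition, Measure.real]
  rw [← ENNReal.toReal_sum fun x _ => measure_ne_top _ _, ← measure_biUnion_finset₀]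
  · exact ENNReal.toReal_le_of_le_ofReal zero_le_one (by simpa using prob_le_one)
  · intro x _ z _ hxz
    refine Disjoint.aedisjoint (Set.disjoint_left.2 fun ω hω hω' => hxz ?_)
    exact Eq.trans (Eq.symm hω) hω'
  · exact fun x _ => G.nullMeasurableSet_Y hc ht y x

/-- The transition probabilities as a function of the starting point solve the heat equation. -/
lemma transition_sol {c₂ Λ M : ℝ} (hc : ∀ x, (G.nu x : ℝ) ≤ c₂)
    (h : Elliptic (fun x y => (G.C x y : ℝ)) Λ M) (y : Lattice d) (a b : ℝ)
    (A : Finset (Lattice d)) (ha : 0 ≤ a) :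
    Sol (fun x y => (G.C x y : ℝ)) (fun t x => G.transition t x y) a b A := by
  have h1 := sol_of_duhamel h (u := fun t x => (∑' n, G.nStep n t x y).toReal) (B := 1)
    (fun t x => by
      rw [abs_of_nonneg ENNReal.toReal_nonneg]
      exact ENNReal.toReal_le_of_le_ofReal zero_le_one
        (by simpa using G.tsum_nStep_le_one hc t x y))
    (fun x => (Measurable.tsum fun n => G.measurable_nStep n x y).ennreal_toReal)
    (fun x => if x = y then 1 else 0) (fun x t ht => G.toReal_duhamel hc y x ht) a b A ha
  intro x hx
  obtain ⟨h2, h3⟩ := h1 x hx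
  refine ⟨h2.congr fun t ht => G.transition_eq hc (ha.trans ht.1) x y, fun t ht => ?_⟩
  have ht0 : 0 < t := ha.trans_lt ht.1
  have e : (fun x => G.transition t x y) = fun x => (∑' n, G.nStep n t x y).toReal :=
    funext fun x => G.transition_eq hc ht0.le x y
  change HasDerivAt (fun t => G.transition t x y) (gen _ (fun x => G.transition t x y) x) t
  rw [e]
  refine (h3 t ht).congr_of_eventuallyEq ?_
  filter_upwards [Ici_mem_nhds ht0] with s hs
  exact G.transition_eq hc hs x y

end Conductances

/-! ### Hölder continuity of the heat kernel -/

/-- The interior Hölder estimate with constants `c`, `β`, at every scale. -/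
def HolderAt {d : ℕ} (C : Lattice d → Lattice d → ℝ) (c β : ℝ) : Prop :=
  ∀ (z : Lattice d) (r t₁ : ℝ) (u : ℝ → Lattice d → ℝ) (B : ℝ), 0 < r →
    Sol C u (t₁ - r ^ 2) t₁ (box z r) →
    (∀ t ∈ Icc (t₁ - r ^ 2) t₁, ∀ x, |u t x| ≤ B) →
    ∀ t ∈ Icc (t₁ - r ^ 2) t₁, ∀ x,
      |u t x - u t₁ z| ≤ c * B * ((√(t₁ - t) + ‖x - z‖) / r) ^ β

namespace Conductances

variable {d : ℕ} (G : Conductances d)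

/-- Hölder continuity in time and in the starting point: the Hölder estimate at scale `√(τ / 2)`,
with the supremum bounded by the on-diagonal decay at time `τ / 2`. -/
lemma abs_transition_sub_le {c₂ Λ M c β c' : ℝ} (hc₂ : ∀ x, (G.nu x : ℝ) ≤ c₂)
    (h : Elliptic (fun x y => (G.C x y : ℝ)) Λ M) (hc : 0 < c) (hβ : 0 < β) (hc' : 0 < c')
    (hH : HolderAt (fun x y => (G.C x y : ℝ)) c β)
    (hdiag : ∀ t, 0 < t → ∀ x y, G.transition t x y ≤ c' * t ^ (-(d : ℝ) / 2))
    {τ s t : ℝ} (hτ : 0 < τ) (hs : τ ≤ s) (hst : s ≤ t) (x₁ x₂ y : Lattice d) :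
    |G.transition s x₁ y - G.transition t x₂ y| ≤
      (c + 1) * c' * (τ / 2) ^ (-((d : ℝ) + β) / 2) * (√(t - s) + ‖x₁ - x₂‖) ^ β := by
  set r : ℝ := √(τ / 2) with hr
  have hr0 : 0 < r := Real.sqrt_pos.2 (by linarith)
  have hr2 : r ^ 2 = τ / 2 := Real.sq_sqrt (by linarith)
  set B : ℝ := c' * (τ / 2) ^ (-(d : ℝ) / 2) with hB
  have hB0 : 0 < B := by positivity
  have hbd : ∀ a, τ / 2 ≤ a → ∀ x, |G.transition a x y| ≤ B := by
    intro a ha x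
    rw [abs_of_nonneg (G.transition_nonneg _ _ _)]
    refine (hdiag a (by linarith) x y).trans ?_
    rw [hB]
    refine mul_le_mul_of_nonneg_left ?_ hc'.le
    exact Real.rpow_le_rpow_of_nonpos (by linarith) ha
      (by have : (0 : ℝ) ≤ d := Nat.cast_nonneg d
          linarith)
  have hscale : B * (1 / r) ^ β = c' * (τ / 2) ^ (-((d : ℝ) + β) / 2) := by
    have e : (1 / r) ^ β = (τ / 2) ^ (-β / 2) := by
      rw [one_div, Real.inv_rpow hr0.le, ← Real.rpow_neg hr0.le, hr, Real.sqrt_eq_rpow,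
        ← Real.rpow_mul (by linarith)]
      congr 1; ring
    rw [e, hB, mul_assoc, ← Real.rpow_add (by linarith)]
    congr 2; ring
  set N : ℝ := √(t - s) + ‖x₁ - x₂‖ with hN
  have hN0 : 0 ≤ N := by positivity
  have hNr : B * (N / r) ^ β = c' * (τ / 2) ^ (-((d : ℝ) + β) / 2) * N ^ β := by
    rw [← hscale, div_eq_mul_one_div, Real.mul_rpow hN0 (by positivity)]; ring
  have key : |G.transition s x₁ y - G.transition t x₂ y| ≤ (c + 1) * (B * (N / r) ^ β) := by
    rcases le_or_gt (t - s) (r ^ 2) with hts | hts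
    · have := hH x₂ r t (fun t x => G.transition t x y) B hr0
        (G.transition_sol hc₂ h y _ _ _ (by linarith))
        (fun a ha x => hbd a (by linarith [ha.1]) x) s ⟨by linarith, hst⟩ x₁
      refine this.trans ?_
      have h0 : 0 ≤ B * (N / r) ^ β := by positivity
      calc c * B * (N / r) ^ β = c * (B * (N / r) ^ β) := by ring
        _ ≤ _ := by nlinarith
    · have h1 := hbd s (by linarith) x₁
      have h2 := hbd t (by linarith) x₂
      rw [abs_of_nonneg (G.transition_nonneg _ _ _)] at h1 h2
      have h3 : |G.transition s x₁ y - G.transition t x₂ y| ≤ B :=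
        abs_le.2 ⟨by linarith [G.transition_nonneg s x₁ y],
          by linarith [G.transition_nonneg t x₂ y]⟩
      have h4 : 1 ≤ (N / r) ^ β := by
        refine Real.one_le_rpow ?_ hβ.le
        rw [one_le_div hr0]
        have : r ≤ √(t - s) := Real.le_sqrt_of_sq_le hts.le
        linarith [norm_nonneg (x₁ - x₂)]
      have h5 : B ≤ B * (N / r) ^ β := le_mul_of_one_le_right hB0.le h4
      nlinarith
  rw [hNr] at key
  linarith

/-- Hölder continuity in all variables; the end point is treated through the symmetry of the
transition probabilities. -/
lemma abs_transition_sub_le' {c₂ Λ M c β c' : ℝ} (hc₂ : ∀ x, (G.nu x : ℝ) ≤ c₂)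
    (h : Elliptic (fun x y => (G.C x y : ℝ)) Λ M) (hc : 0 < c) (hβ : 0 < β) (hc' : 0 < c')
    (hH : HolderAt (fun x y => (G.C x y : ℝ)) c β)
    (hdiag : ∀ t, 0 < t → ∀ x y, G.transition t x y ≤ c' * t ^ (-(d : ℝ) / 2))
    {τ s t : ℝ} (hτ : 0 < τ) (hs : τ ≤ s) (ht : τ ≤ t) (x₁ x₂ y₁ y₂ : Lattice d) :
    |G.transition s x₁ y₁ - G.transition t x₂ y₂| ≤
      2 * ((c + 1) * c') * (τ / 2) ^ (-((d : ℝ) + β) / 2) *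
        (√|t - s| + ‖x₁ - x₂‖ + ‖y₁ - y₂‖) ^ β := by
  set K : ℝ := (c + 1) * c' * (τ / 2) ^ (-((d : ℝ) + β) / 2) with hK
  have hK0 : 0 ≤ K := by positivity
  set N : ℝ := √|t - s| + ‖x₁ - x₂‖ + ‖y₁ - y₂‖ with hN
  have hx := norm_nonneg (x₁ - x₂)
  have hy := norm_nonneg (y₁ - y₂)
  have h1 : |G.transition s x₁ y₁ - G.transition t x₂ y₁| ≤ K * N ^ β := by
    have hle : (√|t - s| + ‖x₁ - x₂‖) ^ β ≤ N ^ β := by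
      gcongr; linarith
    rcases le_total s t with hst | hst
    · have := G.abs_transition_sub_le hc₂ h hc hβ hc' hH hdiag hτ hs hst x₁ x₂ y₁
      rw [abs_of_nonneg (sub_nonneg.2 hst)] at hle
      exact this.trans (mul_le_mul_of_nonneg_left hle hK0)
    · have := G.abs_transition_sub_le hc₂ h hc hβ hc' hH hdiag hτ ht hst x₂ x₁ y₁
      rw [abs_sub_comm t s, abs_of_nonneg (sub_nonneg.2 hst), norm_sub_rev] at hle
      rw [abs_sub_comm]
      exact this.trans (mul_le_mul_of_nonneg_left hle hK0)
  have h2 : |G.transition t x₂ y₁ - G.transition t x₂ y₂| ≤ K * N ^ β := by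
    rw [G.transition_comm hc₂ (hτ.le.trans ht) x₂ y₁, G.transition_comm hc₂ (hτ.le.trans ht) x₂ y₂]
    have := G.abs_transition_sub_le hc₂ h hc hβ hc' hH hdiag hτ ht le_rfl y₁ y₂ x₂
    refine this.trans (mul_le_mul_of_nonneg_left ?_ hK0)
    rw [sub_self, Real.sqrt_zero, zero_add]
    gcongr
    linarith [Real.sqrt_nonneg |t - s|]
  have h3 := abs_sub_le (G.transition s x₁ y₁) (G.transition t x₂ y₁) (G.transition t x₂ y₂)
  have : 2 * ((c + 1) * c') * (τ / 2) ^ (-((d : ℝ) + β) / 2) = 2 * K := by rw [hK]; ring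
  rw [this]; linarith

end Conductances

lemma dist_eq_edist2 {d : ℕ} {D : ℝ} (hD : 0 < D) (x y : S d D) :
    dist x y = D⁻¹ * edist2 (unscale x) (unscale y) := by
  conv_lhs => rw [← scale_unscale hD.ne' x, ← scale_unscale hD.ne' y]
  rw [Subtype.dist_eq, scale, scale, dist_smul₀, edist2, Real.norm_of_nonneg (by positivity)]

lemma norm_unscale_sub_le {d : ℕ} {D : ℝ} (hD : 0 < D) (x y : S d D) :
    ‖unscale x - unscale y‖ ≤ D * dist x y := by
  rw [dist_eq_edist2 hD, mul_inv_cancel_left₀ hD.ne', norm_sub_rev]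
  exact norm_sub_le_edist2 _ _

lemma V_eq_iff {d : ℕ} {D : ℝ} (hD : 0 < D) (t : ℝ≥0) (ω : Conductances.Omega d) (y : S d D) :
    V D t ω = y ↔ Y (D ^ 2 * t) ω = unscale y := by
  rw [V]
  constructor
  · rintro rfl; rw [unscale_scale hD.ne']
  · intro h; rw [h, scale_unscale hD.ne']

lemma heatKernel_eq {d : ℕ} (G : Conductances d) {D : ℝ} (hD : 0 < D) (t : ℝ≥0) (x y : S d D) :
    heatKernel G D t x y = D ^ d * G.transition (D ^ 2 * t) (unscale x) (unscale y) := by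
  have h1 : (muD d D).real {y} = (D ^ d)⁻¹ := by
    rw [muD, Measure.real, Measure.smul_apply, Measure.count_singleton, smul_eq_mul, mul_one,
      ENNReal.toReal_ofReal (by positivity)]
  rw [heatKernel, h1, Conductances.transition, lawV, div_inv_eq_mul, mul_comm]
  simp_rw [V_eq_iff hD]

theorem abs_heatKernel_sub_le {d : ℕ} (G : Conductances d) {c₂ Λ M c β c' : ℝ}
    (hc₂ : ∀ x, (G.nu x : ℝ) ≤ c₂)
    (h : Elliptic (fun x y => (G.C x y : ℝ)) Λ M) (hc : 0 < c) (hβ : 0 < β) (hc' : 0 < c')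
    (hH : HolderAt (fun x y => (G.C x y : ℝ)) c β)
    (hdiag : ∀ t, 0 < t → ∀ x y, G.transition t x y ≤ c' * t ^ (-(d : ℝ) / 2))
    {D : ℝ} (hD : 0 < D) {t₀ : ℝ} (ht₀ : 0 < t₀) {s t : ℝ≥0} (hs : t₀ ≤ s) (ht : t₀ ≤ t)
    (x₁ x₂ y₁ y₂ : S d D) :
    |heatKernel G D s x₁ y₁ - heatKernel G D t x₂ y₂| ≤
      2 * ((c + 1) * c') * 2 ^ (((d : ℝ) + β) / 2) * t₀ ^ (-((d : ℝ) + β) / 2) *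
        (|(t : ℝ) - s| ^ (1 / 2 : ℝ) + dist x₁ x₂ + dist y₁ y₂) ^ β := by
  have hD2 : 0 < D ^ 2 := by positivity
  have key := G.abs_transition_sub_le' hc₂ h hc hβ hc' hH hdiag (τ := D ^ 2 * t₀)
    (s := D ^ 2 * s) (t := D ^ 2 * t) (by positivity) (by gcongr) (by gcongr)
    (unscale x₁) (unscale x₂) (unscale y₁) (unscale y₂)
  rw [heatKernel_eq G hD, heatKernel_eq G hD, ← mul_sub, abs_mul, abs_of_pos (by positivity)]
  have hsq : √|D ^ 2 * (t : ℝ) - D ^ 2 * s| = D * |(t : ℝ) - s| ^ (1 / 2 : ℝ) := by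
    rw [← mul_sub, abs_mul, abs_of_pos hD2, Real.sqrt_mul hD2.le, Real.sqrt_sq hD.le,
      Real.sqrt_eq_rpow]
  set N : ℝ := |(t : ℝ) - s| ^ (1 / 2 : ℝ) + dist x₁ x₂ + dist y₁ y₂ with hN
  have hN0 : 0 ≤ N := by positivity
  have hle : √|D ^ 2 * (t : ℝ) - D ^ 2 * s| + ‖unscale x₁ - unscale x₂‖ +
      ‖unscale y₁ - unscale y₂‖ ≤ D * N := by
    rw [hsq, hN, mul_add, mul_add]
    linarith [norm_unscale_sub_le hD x₁ x₂, norm_unscale_sub_le hD y₁ y₂]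
  have hpow : (D ^ 2 * t₀ / 2) ^ (-((d : ℝ) + β) / 2) =
      (D ^ d * D ^ β)⁻¹ * (2 ^ (((d : ℝ) + β) / 2) * t₀ ^ (-((d : ℝ) + β) / 2)) := by
    have e1 : D ^ 2 * t₀ / 2 = D ^ 2 * (2⁻¹ * t₀) := by ring
    have e2 : (D ^ 2) ^ (-((d : ℝ) + β) / 2) = (D ^ d * D ^ β)⁻¹ := by
      rw [← Real.rpow_natCast D 2, ← Real.rpow_mul hD.le, ← Real.rpow_natCast D d,
        ← Real.rpow_add hD, ← Real.rpow_neg hD.le]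
      congr 1; push_cast; ring
    have e3 : ((2 : ℝ)⁻¹) ^ (-((d : ℝ) + β) / 2) = 2 ^ (((d : ℝ) + β) / 2) := by
      rw [Real.inv_rpow (by norm_num), ← Real.rpow_neg (by norm_num)]
      congr 1; ring
    rw [e1, Real.mul_rpow hD2.le (by positivity), Real.mul_rpow (by norm_num) ht₀.le, e2, e3]
  calc D ^ d * |G.transition (D ^ 2 * s) (unscale x₁) (unscale y₁) -
        G.transition (D ^ 2 * t) (unscale x₂) (unscale y₂)| ≤
      D ^ d * (2 * ((c + 1) * c') * (D ^ 2 * t₀ / 2) ^ (-((d : ℝ) + β) / 2) * (D * N) ^ β) := by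
        gcongr
        refine key.trans ?_
        gcongr
    _ = _ := by
        rw [hpow, Real.mul_rpow hD.le hN0]
        have : (0 : ℝ) < D ^ β := by positivity
        field_simp

/-! ### Hölder continuity of bounded Duhamel solutions in a cylinder -/

section Steklov

variable {d : ℕ} {C : Lattice d → Lattice d → ℝ} {Λ M B : ℝ} {v : ℝ → Lattice d → ℝ}

/-- The Steklov average of `v`: its mean over the preceding time interval of length `h`. It makes a
function that is merely measurable in time continuous in time. -/
noncomputable def steklov (h : ℝ) (v : ℝ → Lattice d → ℝ) (t : ℝ) (x : Lattice d) : ℝ :=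
  h⁻¹ * ∫ σ in (0 : ℝ)..h, v (t - σ) x

lemma intervalIntegrable_of_bounded {f : ℝ → ℝ} (hf : Measurable f) {K : ℝ}
    (hK : ∀ t, |f t| ≤ K) (a b : ℝ) : IntervalIntegrable f volume a b :=
  (intervalIntegrable_const (c := K)).mono_fun hf.aestronglyMeasurable
    (Filter.Eventually.of_forall fun t => (hK t).trans (le_abs_self K))

lemma continuous_steklov (hB : ∀ t x, |v t x| ≤ B) (hm : ∀ x, Measurable fun t => v t x)
    (h : ℝ) (x : Lattice d) : Continuous fun t => steklov h v t x := by
  have hi := intervalIntegrable_of_bounded (hm x) (fun t => hB t x)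
  have hp := intervalIntegral.continuous_primitive hi 0
  have e : (fun t => steklov h v t x) = fun t =>
      h⁻¹ * ((∫ s in (0 : ℝ)..t, v s x) - ∫ s in (0 : ℝ)..(t - h), v s x) := by
    funext t
    rw [steklov, intervalIntegral.integral_comp_sub_left (fun s => v s x), sub_zero,
      intervalIntegral.integral_interval_sub_left (hi _ _) (hi _ _)]
  rw [e]
  fun_prop

lemma abs_steklov_sub_le {h : ℝ} (hh : 0 < h) {t b K : ℝ} {x : Lattice d}
    (hm : Measurable fun t => v t x) (hB : ∀ t, |v t x| ≤ B)
    (hK : ∀ σ ∈ Icc 0 h, |v (t - σ) x - b| ≤ K) : |steklov h v t x - b| ≤ K := by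
  have hi : IntervalIntegrable (fun σ => v (t - σ) x) volume 0 h :=
    intervalIntegrable_of_bounded (hm.comp (by fun_prop)) (fun σ => hB _) 0 h
  have e : steklov h v t x - b = h⁻¹ * ∫ σ in (0 : ℝ)..h, (v (t - σ) x - b) := by
    rw [intervalIntegral.integral_sub hi intervalIntegrable_const,
      intervalIntegral.integral_const, steklov, smul_eq_mul]
    field_simp
    ring
  have hb := intervalIntegral.norm_integral_le_of_norm_le_const (a := 0) (b := h)
    (f := fun σ => v (t - σ) x - b) (C := K) (fun σ hσ => by
      rw [uIoc_of_le hh.le] at hσ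
      exact hK σ ⟨hσ.1.le, hσ.2⟩)
  rw [sub_zero, abs_of_pos hh, Real.norm_eq_abs] at hb
  rw [e, abs_mul, abs_of_pos (inv_pos.2 hh), inv_mul_le_iff₀ hh]
  linarith

lemma abs_steklov_le {h : ℝ} (hh : 0 < h) (hB : ∀ t x, |v t x| ≤ B)
    (hm : ∀ x, Measurable fun t => v t x) (t : ℝ) (x : Lattice d) : |steklov h v t x| ≤ B := by
  have := abs_steklov_sub_le hh (b := 0) (t := t) (hm x) (fun t => hB t x)
    (fun σ _ => by rw [sub_zero]; exact hB _ x)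
  rwa [sub_zero] at this

/-- The Duhamel formula is linear and invariant under time shifts, so it passes to Steklov
averages. -/
lemma steklov_duhamel (hC : Elliptic C Λ M) (hB : ∀ t x, |v t x| ≤ B)
    (hm : ∀ x, Measurable fun t => v t x) {x : Lattice d} {h T : ℝ} (hh : 0 < h)
    (hv : ∀ τ t, -h ≤ τ → 0 ≤ t → τ + t ≤ T → v (τ + t) x = Real.exp (-((∑' y, C x y) * t)) *
      (v τ x + ∫ r in (0 : ℝ)..t, Real.exp ((∑' y, C x y) * r) * ∑' y, C x y * v (τ + r) y))
    {t : ℝ} (ht : t ∈ Icc 0 T) :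
    steklov h v t x = Real.exp (-((∑' y, C x y) * t)) *
      (steklov h v 0 x + ∫ r in (0 : ℝ)..t, Real.exp ((∑' y, C x y) * r) *
        ∑' y, C x y * steklov h v r y) := by
  set ν : ℝ := ∑' y, C x y with hν
  have hν0 : 0 ≤ ν := tsum_nonneg fun y => hC.nonneg x y
  set F : ℝ → ℝ := fun r => ∑' y, C x y * v r y with hF
  have hFm : Measurable F := Elliptic.measurable_tsum_mul hm x
  have hFb : ∀ r, |F r| ≤ ν * B := fun r => hC.abs_tsum_mul_le (hB r) x
  set H : ℝ → ℝ → ℝ := fun σ r => Real.exp (ν * r) * F (r - σ) with hH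
  have hHm : Measurable H.uncurry := by
    refine Measurable.mul (by fun_prop) (hFm.comp (by fun_prop))
  have hHi : IntegrableOn H.uncurry (uIoc 0 h ×ˢ uIoc 0 t) := by
    refine Measure.integrableOn_of_bounded (M := Real.exp (ν * t) * (ν * B)) ?_
      hHm.aestronglyMeasurable ?_
    · rw [Measure.volume_eq_prod, Measure.prod_prod, uIoc_of_le hh.le, uIoc_of_le ht.1,
        Real.volume_Ioc, Real.volume_Ioc]
      exact ENNReal.mul_ne_top ENNReal.ofReal_ne_top ENNReal.ofReal_ne_top
    · rw [ae_restrict_iff' (measurableSet_uIoc.prod measurableSet_uIoc)]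
      refine Filter.Eventually.of_forall fun p hp => ?_
      have h2 : p.2 ≤ t := by have := hp.2; rw [uIoc_of_le ht.1] at this; exact this.2
      simp only [Function.uncurry, hH]
      rw [norm_mul, Real.norm_of_nonneg (Real.exp_pos _).le]
      have := hFb (p.2 - p.1)
      rw [Real.norm_eq_abs]
      gcongr
  have hHi' : IntervalIntegrable (fun σ => ∫ r in (0 : ℝ)..t, H σ r) volume 0 h := by
    rw [intervalIntegrable_iff_integrableOn_Ioc_of_le hh.le]
    rw [Measure.volume_eq_prod, uIoc_of_le hh.le, uIoc_of_le ht.1, IntegrableOn,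
      ← Measure.prod_restrict] at hHi
    have := hHi.integral_prod_left
    refine this.congr (Filter.Eventually.of_forall fun σ => ?_)
    simp only [intervalIntegral.integral_of_le ht.1, Function.uncurry]
  have hinner : ∀ r, ∫ σ in (0 : ℝ)..h, H σ r =
      h * (Real.exp (ν * r) * ∑' y, C x y * steklov h v r y) := by
    intro r
    have h1 : HasSum (fun y => ∫ σ in (0 : ℝ)..h, C x y * v (r - σ) y)
        (∫ σ in (0 : ℝ)..h, F (r - σ)) := by
      refine intervalIntegral.hasSum_integral_of_dominated_convergence
        (fun y _ => C x y * B) (fun y => ?_) (fun y => ?_) ?_ ?_ ?_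
      · exact (((hm y).comp (by fun_prop : Measurable fun σ : ℝ => r - σ)).const_mul
          _).aestronglyMeasurable
      · refine Filter.Eventually.of_forall fun σ _ => ?_
        rw [norm_mul, Real.norm_of_nonneg (hC.nonneg x y)]
        exact mul_le_mul_of_nonneg_left (hB _ y) (hC.nonneg x y)
      · exact Filter.Eventually.of_forall fun σ _ => (hC.summable x).mul_right B
      · exact intervalIntegrable_const
      · exact Filter.Eventually.of_forall fun σ _ =>
          (hC.summable_mul x (f := v (r - σ)) (hB _)).hasSum
    simp only [hH]
    have e : ∀ y, ∫ σ in (0 : ℝ)..h, C x y * v (r - σ) y = h * (C x y * steklov h v r y) := by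
      intro y
      rw [intervalIntegral.integral_const_mul, steklov]
      field_simp
    rw [intervalIntegral.integral_const_mul, ← h1.tsum_eq]
    simp_rw [e]
    rw [tsum_mul_left]; ring
  have hvi : IntervalIntegrable (fun σ => v (0 - σ) x) volume 0 h :=
    intervalIntegrable_of_bounded ((hm x).comp (by fun_prop)) (fun σ => hB _ x) 0 h
  have h1 : ∫ σ in (0 : ℝ)..h, v (t - σ) x = ∫ σ in (0 : ℝ)..h,
      Real.exp (-(ν * t)) * (v (0 - σ) x + ∫ r in (0 : ℝ)..t, H σ r) := by
    refine intervalIntegral.integral_congr fun σ hσ => ?_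
    rw [uIcc_of_le hh.le] at hσ
    have := hv (-σ) t (by linarith [hσ.2]) ht.1 (by linarith [hσ.1, ht.2])
    simp only [hH]
    rw [show t - σ = -σ + t by ring, this, zero_sub]
    simp only [neg_add_eq_sub]; rfl
  rw [steklov, h1, intervalIntegral.integral_const_mul,
    intervalIntegral.integral_add hvi hHi', intervalIntegral_intervalIntegral_swap hHi]
  simp_rw [hinner]
  rw [intervalIntegral.integral_const_mul, steklov]
  field_simp

/-- Interior Hölder estimate for a bounded function, measurable in time, that satisfies the Duhamel
formula at the points of a box. -/
theorem abs_sub_le_of_duhamel {c β : ℝ} (hC : Elliptic C Λ M) (hc : HolderAt C c β)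
    (hB : ∀ t x, |v t x| ≤ B) (hm : ∀ x, Measurable fun t => v t x) {z : Lattice d} {r ε : ℝ}
    (hr : 0 < r) (hε : 0 < ε)
    (hv : ∀ x ∈ box z r, ∀ τ t, -ε ≤ τ → 0 ≤ t → τ + t ≤ r ^ 2 →
      v (τ + t) x = Real.exp (-((∑' y, C x y) * t)) *
      (v τ x + ∫ s in (0 : ℝ)..t, Real.exp ((∑' y, C x y) * s) * ∑' y, C x y * v (τ + s) y))
    {θ : ℝ} (hθ : θ ∈ Icc 0 (r ^ 2)) {x : Lattice d} (hx : x ∈ box z r) :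
    |v θ x - v (r ^ 2) z| ≤ c * B * ((√(r ^ 2 - θ) + ‖x - z‖) / r) ^ β := by
  have hB0 : 0 ≤ B := (abs_nonneg _).trans (hB 0 z)
  have hΛ := hC.pos
  -- the Duhamel formula makes `v` Lipschitz in time at the points of the box
  have hclose : ∀ h, 0 < h → h ≤ ε → ∀ y ∈ box z r, ∀ t ∈ Icc 0 (r ^ 2),
      |steklov h v t y - v t y| ≤ 2 * Λ * B * h := by
    intro h hh hhε y hy t ht
    refine abs_steklov_sub_le hh (hm y) (fun t => hB t y) fun σ hσ => ?_
    set ν : ℝ := ∑' w, C y w with hν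
    have hν0 : 0 ≤ ν := tsum_nonneg fun w => hC.nonneg y w
    have hνΛ : ν ≤ Λ := hC.tsum_le y
    have e := hv y hy (t - σ) σ (by linarith [hσ.2, ht.1]) hσ.1 (by linarith [ht.2])
    rw [sub_add_cancel, ← hν] at e
    set I : ℝ := ∫ s in (0 : ℝ)..σ, Real.exp (ν * s) * ∑' w, C y w * v (t - σ + s) w with hI
    have hIb : |I| ≤ Real.exp (ν * σ) * (ν * B) * σ := by
      have := intervalIntegral.norm_integral_le_of_norm_le_const (a := 0) (b := σ)
        (f := fun s => Real.exp (ν * s) * ∑' w, C y w * v (t - σ + s) w)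
        (C := Real.exp (ν * σ) * (ν * B)) (fun s hs => by
          rw [uIoc_of_le hσ.1] at hs
          rw [norm_mul, Real.norm_of_nonneg (Real.exp_pos _).le, Real.norm_eq_abs]
          have := hC.abs_tsum_mul_le (hB (t - σ + s)) y
          have := hs.2
          gcongr)
      rwa [sub_zero, abs_of_nonneg hσ.1] at this
    have he : Real.exp (-(ν * σ)) * Real.exp (ν * σ) = 1 := by
      rw [← Real.exp_add, neg_add_cancel, Real.exp_zero]
    have he1 : Real.exp (-(ν * σ)) ≤ 1 := Real.exp_le_one_iff.2 (by
      have := mul_nonneg hν0 hσ.1; linarith)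
    have he2 : 1 - ν * σ ≤ Real.exp (-(ν * σ)) := by
      have := Real.add_one_le_exp (-(ν * σ)); linarith
    have hsplit : v (t - σ) y - v t y =
        (1 - Real.exp (-(ν * σ))) * v (t - σ) y - Real.exp (-(ν * σ)) * I := by
      rw [e]; ring
    rw [hsplit]
    have h1 : |(1 - Real.exp (-(ν * σ))) * v (t - σ) y| ≤ ν * σ * B := by
      rw [abs_mul, abs_of_nonneg (by linarith)]
      exact mul_le_mul (by linarith) (hB _ y) (abs_nonneg _) (mul_nonneg hν0 hσ.1)
    have h2 : |Real.exp (-(ν * σ)) * I| ≤ ν * σ * B := by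
      rw [abs_mul, abs_of_pos (Real.exp_pos _)]
      calc Real.exp (-(ν * σ)) * |I| ≤
            Real.exp (-(ν * σ)) * (Real.exp (ν * σ) * (ν * B) * σ) := by gcongr
        _ = Real.exp (-(ν * σ)) * Real.exp (ν * σ) * (ν * σ * B) := by ring
        _ = ν * σ * B := by rw [he, one_mul]
    have h3 := abs_sub ((1 - Real.exp (-(ν * σ))) * v (t - σ) y) (Real.exp (-(ν * σ)) * I)
    have h4 : ν * σ * B ≤ Λ * h * B := by
      have := hσ.2
      have := hσ.1
      gcongr
    linarith
  have hzb : z ∈ box z r := (mem_box hr.le).2 (by simpa using hr.le)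
  refine le_of_forall_pos_le_add fun e he => ?_
  set h : ℝ := min ε (e / (4 * Λ * B + 1)) with hh
  have hden : 0 < 4 * Λ * B + 1 := by positivity
  have hh0 : 0 < h := lt_min hε (div_pos he hden)
  have hhε : h ≤ ε := min_le_left _ _
  have hhe : (4 * Λ * B + 1) * h ≤ e := by
    have := min_le_right ε (e / (4 * Λ * B + 1))
    rw [← hh, le_div_iff₀ hden] at this
    linarith
  have hst : Sol C (steklov h v) (r ^ 2 - r ^ 2) (r ^ 2) (box z r) := by
    rw [sub_self]
    intro y hy
    refine ⟨(continuous_steklov hB hm h y).continuousOn, fun t ht => ?_⟩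
    exact hasDerivAt_of_duhamel hC (abs_steklov_le hh0 hB hm)
      (fun y => (continuous_steklov hB hm h y).measurable)
      (fun y => (continuous_steklov hB hm h y).continuousOn)
      (fun t ht => steklov_duhamel hC hB hm hh0
        (fun τ t h1 h2 h3 => hv y hy τ t (by linarith) h2 h3) ht) ht
  have key := hc z r (r ^ 2) (steklov h v) B hr hst
    (fun t _ x => abs_steklov_le hh0 hB hm t x) θ (by rwa [sub_self]) x
  have k1 := hclose h hh0 hhε x hx θ hθ
  have k2 := hclose h hh0 hhε z hzb (r ^ 2) ⟨by positivity, le_rfl⟩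
  have k3 : |v θ x - v (r ^ 2) z| ≤ |steklov h v θ x - steklov h v (r ^ 2) z| +
      |steklov h v θ x - v θ x| + |steklov h v (r ^ 2) z - v (r ^ 2) z| := by
    have e1 : v θ x - v (r ^ 2) z = (steklov h v θ x - steklov h v (r ^ 2) z) -
      (steklov h v θ x - v θ x) + (steklov h v (r ^ 2) z - v (r ^ 2) z) := by ring
    rw [e1]
    refine (abs_add_le _ _).trans ?_
    have := abs_sub (steklov h v θ x - steklov h v (r ^ 2) z) (steklov h v θ x - v θ x)
    linarith
  linarith

end Steklov

/-! ### Parabolic functions satisfy the Duhamel formula -/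

open Conductances (Omega)

section Parabolic

variable {d : ℕ} {D : ℝ}

lemma scale_injective (hD : D ≠ 0) : Function.Injective (scale (d := d) D) := fun k l h => by
  rw [← unscale_scale hD k, h, unscale_scale hD]

lemma isOpen_singleton_S (hD : 0 < D) (x : S d D) : IsOpen ({x} : Set (S d D)) := by
  rw [Metric.isOpen_singleton_iff]
  refine ⟨D⁻¹, inv_pos.2 hD, fun y hy => ?_⟩
  have h1 : ‖unscale y - unscale x‖ < 1 := by
    refine (norm_unscale_sub_le hD y x).trans_lt ?_
    rwa [← lt_inv_mul_iff₀ hD, mul_one]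
  have h2 : unscale y = unscale x := by
    funext i
    have := (norm_le_pi_norm (unscale y - unscale x) i).trans_lt h1
    rw [Pi.sub_apply, Int.norm_eq_abs] at this
    have h3 : |unscale y i - unscale x i| < 1 := by exact_mod_cast this
    rw [Int.abs_lt_one_iff] at h3
    omega
  rw [← scale_unscale hD.ne' y, h2, scale_unscale hD.ne']

/-- The space-time process started from `(a, k)` leaves `[0, b) × {k}` at the first jump or at the
deterministic time `b - a`, whichever comes first. -/
lemma exit_eq (hD : 0 < D) (q : ℝ≥0 × S d D → ℝ) {a b : ℝ≥0} (hab : a < b) {k : Lattice d}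
    {ω : Omega d} (hpos : ∀ i, 0 < ω.2 i) (h0 : ω.1 0 = k) (h1 : ω.1 1 ≠ k) :
    q (Z D a (exitTime (Iio b ×ˢ {scale D k}) a ω) ω) =
      if ω.2 (0, k) ≤ D ^ 2 * ((b : ℝ) - a) then
        q (a + (ω.2 (0, k) / D ^ 2).toNNReal, scale D (ω.1 1)) else q (b, scale D k) := by
  have hD2 : 0 < D ^ 2 := by positivity
  set U : ℝ := ω.2 (0, k) with hU
  have hU0 : 0 < U := hpos _
  have hT1 : jumpTime ω 1 = U := by simp [jumpTime, h0, hU]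
  have hT2 : U < jumpTime ω 2 := by
    have : jumpTime ω 2 = jumpTime ω 1 + ω.2 (1, ω.1 1) := Finset.sum_range_succ _ _
    linarith [hpos (1, ω.1 1)]
  have hY0 : ∀ t, 0 ≤ t → t < U → Y t ω = k := fun t ht ht' => by
    rw [Y_eq hpos (n := 0) (by rwa [jumpTime_zero]) (by rw [zero_add, hT1]; exact ht'), h0]
  have hY1 : Y U ω = ω.1 1 := Y_eq hpos hT1.le hT2
  split_ifs with h
  · set e : ℝ≥0 := (U / D ^ 2).toNNReal with he
    have hec : (e : ℝ) = U / D ^ 2 := Real.coe_toNNReal _ (by positivity)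
    have heU : D ^ 2 * (e : ℝ) = U := by rw [hec]; field_simp
    have hVe : V D e ω = scale D (ω.1 1) := by rw [V, heU, hY1]
    have hleast : IsLeast {s : ℝ≥0 | 0 < s ∧ Z D a s ω ∉ Iio b ×ˢ {scale D k}} e := by
      constructor
      · refine ⟨?_, fun hmem => ?_⟩
        · rw [← NNReal.coe_pos, hec]; positivity
        · have h2 : V D e ω = scale D k := hmem.2
          rw [hVe] at h2
          exact h1 (scale_injective hD.ne' h2)
      · intro s hs
        by_contra hlt
        rw [not_le] at hlt
        refine hs.2 ⟨?_, ?_⟩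
        · change a + s < b
          rw [← NNReal.coe_lt_coe, NNReal.coe_add]
          have : (s : ℝ) < e := by exact_mod_cast hlt
          have h3 : (e : ℝ) ≤ b - a := by
            rw [hec, div_le_iff₀ hD2]; linarith
          linarith
        · change V D s ω = scale D k
          have : (s : ℝ) < e := by exact_mod_cast hlt
          rw [V, hY0 _ (by positivity) (by rw [← heU]; gcongr)]
    rw [exitTime, hleast.csInf_eq, Z, hVe]
  · set e : ℝ≥0 := b - a with he
    have hec : (e : ℝ) = b - a := NNReal.coe_sub hab.le
    have hVs : ∀ s ≤ e, V D s ω = scale D k := by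
      intro s hs
      have h3 : (s : ℝ) ≤ e := by exact_mod_cast hs
      rw [V, hY0 _ (by positivity)]
      rw [not_le, ← hec] at h
      exact lt_of_le_of_lt (by gcongr) h
    have hae : a + e = b := add_tsub_cancel_of_le hab.le
    have hleast : IsLeast {s : ℝ≥0 | 0 < s ∧ Z D a s ω ∉ Iio b ×ˢ {scale D k}} e := by
      constructor
      · refine ⟨tsub_pos_of_lt hab, fun hmem => ?_⟩
        have h2 : a + e < b := hmem.1
        rw [hae] at h2
        exact lt_irrefl _ h2
      · intro s hs
        by_contra hlt
        rw [not_le] at hlt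
        refine hs.2 ⟨?_, hVs s hlt.le⟩
        change a + s < b
        rw [← hae]; gcongr
    rw [exitTime, hleast.csInf_eq, Z, hVs e le_rfl, hae]

lemma Conductances.law_one_ne (G : Conductances d) (x : Lattice d) :
    ∀ᵐ ω ∂G.law x, ω.1 1 ≠ x := by
  have hA : MeasurableSet {p : ℝ × Omega d | p.2.1 0 = x} :=
    ((measurable_chain 0).comp measurable_snd) (measurableSet_singleton x)
  have h := G.law_first_step x hA
  have h0 : ∀ y, (G.C x y : ℝ≥0∞) * G.law y {ω | ω.1 0 = x} = 0 := by
    intro y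
    by_cases hy : y = x
    · rw [hy, G.diag]; simp
    · have : G.law y {ω | ω.1 0 = x} = 0 := by
        refine measure_mono_null (fun ω (hω : ω.1 0 = x) => ?_) (ae_iff.1 (G.law_zero y))
        intro h; exact hy (h.symm.trans hω)
      rw [this, mul_zero]
  rw [ae_iff]
  simp only [ne_eq, not_not]
  refine Eq.trans (h.trans ?_) rfl
  simp only [mem_ofPred_eq, h0, tsum_zero, mul_zero, lintegral_zero]

/-- First exit decomposition of a parabolic function over `[0, b) × {k}`. -/
lemma IsParabolic.ofReal_eq {G : Conductances d} (hD : 0 < D) {q : ℝ≥0 × S d D → ℝ}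
    {U : Set (ℝ≥0 × S d D)} (hq : IsParabolic G q U) {a b : ℝ≥0} (hab : a < b) {k : Lattice d}
    (hU : ∀ t ≤ b, (t, scale D k) ∈ U) :
    ENNReal.ofReal (q (a, scale D k)) =
      ∫⁻ s in Ioi (0 : ℝ), ENNReal.ofReal (Real.exp (-(G.nu k * s))) *
        ∑' y, (G.C k y : ℝ≥0∞) * if s ≤ D ^ 2 * ((b : ℝ) - a) then
          ENNReal.ofReal (q (a + (s / D ^ 2).toNNReal, scale D y)) else
          ENNReal.ofReal (q (b, scale D k)) := by
  obtain ⟨hq0, hqm, hq⟩ := hq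
  have hclosed : closure (Iio b ×ˢ {scale D k} : Set (ℝ≥0 × S d D)) ⊆ Iic b ×ˢ {scale D k} :=
    closure_minimal (prod_mono_left Iio_subset_Iic_self) (isClosed_Iic.prod isClosed_singleton)
  have hcompact : IsCompact (Iic b ×ˢ {scale D k} : Set (ℝ≥0 × S d D)) := by
    rw [← Icc_bot]
    exact isCompact_Icc.prod isCompact_singleton
  obtain ⟨hint, heq⟩ := hq (Iio b ×ˢ {scale D k}) (isOpen_Iio.prod (isOpen_singleton_S hD _))
    (hcompact.of_isClosed_subset isClosed_closure hclosed)
    (fun z hz => by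
      obtain ⟨h1, h2⟩ := hclosed hz
      have := hU z.1 h1
      rwa [← show z.2 = scale D k from h2] at this)
    (a, scale D k) ⟨hab, rfl⟩
  simp only [lawV, unscale_scale hD.ne'] at hint heq
  rw [heq, ofReal_integral_eq_lintegral_ofReal hint (Filter.Eventually.of_forall fun ω => hq0 _)]
  set F : ℝ → Omega d → ℝ≥0∞ := fun s ω => if s ≤ D ^ 2 * ((b : ℝ) - a) then
      ENNReal.ofReal (q (a + (s / D ^ 2).toNNReal, scale D (ω.1 0))) else
      ENNReal.ofReal (q (b, scale D k)) with hF
  have hFm : Measurable fun p : ℝ × Omega d => F p.1 p.2 := by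
    refine Measurable.ite (measurableSet_le measurable_fst measurable_const) ?_ measurable_const
    refine (hqm.comp (Measurable.prodMk ?_ ?_)).ennreal_ofReal
    · exact measurable_const.add (by fun_prop)
    · exact (measurable_of_countable (scale D)).comp ((measurable_chain 0).comp measurable_snd)
  have h1 : ∫⁻ ω, ENNReal.ofReal (q (Z D a (exitTime (Iio b ×ˢ {scale D k}) a ω) ω)) ∂(G.law k) =
      ∫⁻ ω, F (ω.2 (0, k)) (shift ω) ∂(G.law k) := by
    refine lintegral_congr_ae ?_
    filter_upwards [G.clock_pos k, G.law_zero k, G.law_one_ne k] with ω hpos h0 h1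
    rw [exit_eq hD q hab hpos h0 h1, apply_ite ENNReal.ofReal]
    rfl
  rw [h1, G.lintegral_first_step k hFm]
  refine lintegral_congr fun s => ?_
  congr 1
  refine tsum_congr fun y => ?_
  congr 1
  have h2 : ∫⁻ ω, F s ω ∂(G.law y) = ∫⁻ _ω, (if s ≤ D ^ 2 * ((b : ℝ) - a) then
      ENNReal.ofReal (q (a + (s / D ^ 2).toNNReal, scale D y)) else
      ENNReal.ofReal (q (b, scale D k))) ∂(G.law y) := by
    refine lintegral_congr_ae ?_
    filter_upwards [G.law_zero y] with ω hω
    simp only [hF, hω]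
  rw [h2, lintegral_const, measure_univ, mul_one]

/-- The function `q` in lattice space and time units, with time frozen at `T`; freezing keeps it
bounded at all times when `q` is bounded up to time `T`. -/
noncomputable def latticeFn (D T : ℝ) (q : ℝ≥0 × S d D → ℝ) (τ : ℝ) (k : Lattice d) : ℝ :=
  q ((min (τ / D ^ 2) T).toNNReal, scale D k)

lemma measurable_latticeFn {T : ℝ} {q : ℝ≥0 × S d D → ℝ} (hq : Measurable q) (k : Lattice d) :
    Measurable fun τ => latticeFn D T q τ k :=
  hq.comp (Measurable.prodMk (by fun_prop) measurable_const)

lemma latticeFn_of_le {T : ℝ} (hD : 0 < D) {q : ℝ≥0 × S d D → ℝ} {t : ℝ≥0} (ht : t ≤ T)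
    (k : Lattice d) : latticeFn D T q (D ^ 2 * t) k = q (t, scale D k) := by
  rw [latticeFn, mul_div_cancel_left₀ _ (by positivity), min_eq_left ht, Real.toNNReal_coe]

/-- Duhamel formula for parabolic functions, in lattice units, with time running backwards. -/
lemma IsParabolic.duhamel {G : Conductances d} (hD : 0 < D) {q : ℝ≥0 × S d D → ℝ}
    {U : Set (ℝ≥0 × S d D)} (hq : IsParabolic G q U) {T B : ℝ}
    (hB : ∀ t : ℝ≥0, (t : ℝ) ≤ T → ∀ x, q (t, x) ≤ B) (hT0 : 0 ≤ T)
    {α t : ℝ} (hα : 0 ≤ α) (ht : 0 ≤ t) (hαt : α + t ≤ D ^ 2 * T) {k : Lattice d}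
    (hU : ∀ s : ℝ≥0, (s : ℝ) ≤ (α + t) / D ^ 2 → (s, scale D k) ∈ U) :
    latticeFn D T q α k = Real.exp (-((∑' y, (G.C k y : ℝ)) * t)) *
      (latticeFn D T q (α + t) k + ∫ r in (0 : ℝ)..t, Real.exp ((∑' y, (G.C k y : ℝ)) * r) *
        ∑' y, (G.C k y : ℝ) * latticeFn D T q (α + t - r) y) := by
  have hD2 : 0 < D ^ 2 := by positivity
  rcases ht.eq_or_lt with rfl | htpos
  · simp
  set w := latticeFn D T q with hw
  set ν : ℝ := ∑' y, (G.C k y : ℝ) with hν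
  have hν' : (G.nu k : ℝ) = ν := G.coe_nu k
  have hν0 : 0 < ν := by rw [← hν']; exact_mod_cast G.nu_pos k
  have hw0 : ∀ r z, 0 ≤ w r z := fun r z => hq.1 _
  have hwB : ∀ r z, w r z ≤ B := fun r z => hB _ (by
    rw [Real.coe_toNNReal']; exact max_le (min_le_right _ _) hT0) _
  have hB0 : 0 ≤ B := (hw0 0 k).trans (hwB 0 k)
  have hsumC : Summable fun z => (G.C k z : ℝ) := by exact_mod_cast G.summable k
  have hsum : ∀ r, Summable fun z => (G.C k z : ℝ) * w r z := fun r =>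
    Summable.of_nonneg_of_le (fun z => mul_nonneg (NNReal.coe_nonneg _) (hw0 r z))
      (fun z => mul_le_mul_of_nonneg_left (hwB r z) (NNReal.coe_nonneg _)) (hsumC.mul_right B)
  set F : ℝ → ℝ := fun r => ∑' z, (G.C k z : ℝ) * w r z with hF
  have hF0 : ∀ r, 0 ≤ F r := fun r =>
    tsum_nonneg fun z => mul_nonneg (NNReal.coe_nonneg _) (hw0 r z)
  have hFν : ∀ r, F r ≤ ν * B := fun r => by
    rw [hν, ← tsum_mul_right]
    exact (hsum r).tsum_le_tsum
      (fun z => mul_le_mul_of_nonneg_left (hwB r z) (NNReal.coe_nonneg _)) (hsumC.mul_right B)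
  have hFm : Measurable F := Measurable.tsum fun z => (measurable_latticeFn hq.2.1 z).const_mul _
  set a : ℝ≥0 := ⟨α / D ^ 2, by positivity⟩ with ha
  set b : ℝ≥0 := ⟨(α + t) / D ^ 2, by positivity⟩ with hb
  have hab : a < b := by
    rw [← NNReal.coe_lt_coe]
    change α / D ^ 2 < (α + t) / D ^ 2
    gcongr; linarith
  have hbT : (b : ℝ) ≤ T := by
    change (α + t) / D ^ 2 ≤ T
    rw [div_le_iff₀ hD2]; linarith
  have hba : D ^ 2 * ((b : ℝ) - a) = t := by
    change D ^ 2 * ((α + t) / D ^ 2 - α / D ^ 2) = t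
    field_simp; ring
  have hae : α = D ^ 2 * (a : ℝ) := by
    change α = D ^ 2 * (α / D ^ 2); field_simp
  have hbe : α + t = D ^ 2 * (b : ℝ) := by
    change α + t = D ^ 2 * ((α + t) / D ^ 2); field_simp
  have hwa : w α k = q (a, scale D k) := by
    rw [hae]; exact latticeFn_of_le hD ((NNReal.coe_le_coe.2 hab.le).trans hbT) k
  have hwb : w (α + t) k = q (b, scale D k) := by
    rw [hbe]; exact latticeFn_of_le hD hbT k
  have hws : ∀ s, 0 ≤ s → s ≤ t → ∀ y, q (a + (s / D ^ 2).toNNReal, scale D y) = w (α + s) y := by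
    intro s hs hst y
    have e : ((a + (s / D ^ 2).toNNReal : ℝ≥0) : ℝ) = (α + s) / D ^ 2 := by
      rw [NNReal.coe_add, Real.coe_toNNReal _ (by positivity)]
      change α / D ^ 2 + s / D ^ 2 = _
      ring
    have e2 : α + s = D ^ 2 * ((a + (s / D ^ 2).toNNReal : ℝ≥0) : ℝ) := by
      rw [e]; field_simp
    rw [e2]
    refine (latticeFn_of_le hD ?_ y).symm
    rw [e, div_le_iff₀ hD2]; linarith
  have key := hq.ofReal_eq hD hab (k := k) (fun s hs => hU s (by exact_mod_cast hs))
  rw [← hwa, ← hwb, hba, hν'] at key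
  have hsplit : Ioi (0 : ℝ) = Ioc 0 t ∪ Ioi t := (Ioc_union_Ioi_eq_Ioi ht).symm
  have hdisj : Disjoint (Ioc 0 t) (Ioi t) :=
    Set.disjoint_left.2 fun s hs hs' => not_lt.2 hs.2 hs'
  rw [hsplit, lintegral_union measurableSet_Ioi hdisj] at key
  have hI1 : ∫⁻ s in Ioc 0 t, ENNReal.ofReal (Real.exp (-(ν * s))) *
        ∑' y, (G.C k y : ℝ≥0∞) * (if s ≤ t then
          ENNReal.ofReal (q (a + (s / D ^ 2).toNNReal, scale D y)) else
          ENNReal.ofReal (w (α + t) k)) =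
      ENNReal.ofReal (∫ s in (0 : ℝ)..t, Real.exp (-(ν * s)) * F (α + s)) := by
    have hI : IntegrableOn (fun s => Real.exp (-(ν * s)) * F (α + s)) (Ioc 0 t) := by
      rw [← intervalIntegrable_iff_integrableOn_Ioc_of_le ht]
      refine IntervalIntegrable.continuousOn_mul ?_ (by fun_prop)
      exact intervalIntegrable_of_bounded (hFm.comp (by fun_prop)) (K := ν * B)
        (fun r => by simp only [Function.comp]; rw [abs_of_nonneg (hF0 _)]; exact hFν _) 0 t
    rw [intervalIntegral.integral_of_le ht, ofReal_integral_eq_lintegral_ofReal hI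
      (Filter.Eventually.of_forall fun s => mul_nonneg (Real.exp_pos _).le (hF0 _))]
    refine setLIntegral_congr_fun measurableSet_Ioc fun s hs => ?_
    rw [ENNReal.ofReal_mul (Real.exp_pos _).le]
    congr 1
    rw [hF, ENNReal.ofReal_tsum_of_nonneg
      (fun z => mul_nonneg (NNReal.coe_nonneg _) (hw0 _ z)) (hsum _)]
    refine tsum_congr fun z => ?_
    rw [if_pos hs.2, hws s hs.1.le hs.2, ENNReal.ofReal_mul (NNReal.coe_nonneg _),
      ENNReal.ofReal_coe_nnreal]
  have hI2 : ∫⁻ s in Ioi t, ENNReal.ofReal (Real.exp (-(ν * s))) *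
        ∑' y, (G.C k y : ℝ≥0∞) * (if s ≤ t then
          ENNReal.ofReal (q (a + (s / D ^ 2).toNNReal, scale D y)) else
          ENNReal.ofReal (w (α + t) k)) =
      ENNReal.ofReal (Real.exp (-(ν * t)) * w (α + t) k) := by
    have hI : IntegrableOn (fun s => ν * Real.exp (-ν * s) * w (α + t) k) (Ioi t) :=
      ((integrableOn_exp_mul_Ioi (by linarith) t).const_mul ν).mul_const _
    have hv : ∫ s in Ioi t, ν * Real.exp (-ν * s) * w (α + t) k =
        Real.exp (-(ν * t)) * w (α + t) k := by
      rw [integral_mul_const, integral_const_mul, integral_exp_mul_Ioi (by linarith), neg_mul]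
      field_simp
    rw [← hv, ofReal_integral_eq_lintegral_ofReal hI
      (Filter.Eventually.of_forall fun s => mul_nonneg (by positivity) (hw0 _ _))]
    refine setLIntegral_congr_fun measurableSet_Ioi fun s hs => ?_
    simp only [not_le.2 (show t < s from hs), if_false]
    rw [ENNReal.tsum_mul_right, G.tsum_coe, ENNReal.ofReal_mul (by positivity),
      ENNReal.ofReal_mul hν0.le, ← hν', ENNReal.ofReal_coe_nnreal, neg_mul]
    ring
  rw [hI1, hI2, ← ENNReal.ofReal_add
    (intervalIntegral.integral_nonneg ht fun s _ => mul_nonneg (Real.exp_pos _).le (hF0 _))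
    (mul_nonneg (Real.exp_pos _).le (hw0 _ _))] at key
  rw [ENNReal.ofReal_eq_ofReal_iff (hw0 _ _) (add_nonneg
    (intervalIntegral.integral_nonneg ht fun s _ => mul_nonneg (Real.exp_pos _).le (hF0 _))
    (mul_nonneg (Real.exp_pos _).le (hw0 _ _)))] at key
  have hsub : ∫ s in (0 : ℝ)..t, Real.exp (-(ν * s)) * F (α + s) =
      Real.exp (-(ν * t)) * ∫ r in (0 : ℝ)..t, Real.exp (ν * r) * F (α + t - r) := by
    have := intervalIntegral.integral_comp_sub_left
      (fun r => Real.exp (-(ν * r)) * F (α + r)) t (a := 0) (b := t)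
    simp only [sub_self, sub_zero] at this
    rw [← this, ← intervalIntegral.integral_const_mul]
    refine intervalIntegral.integral_congr fun r _ => ?_
    rw [← mul_assoc, ← Real.exp_add, add_sub_assoc]; congr 2; ring
  rw [key, hsub]
  ring

end Parabolic

/-! ### Hölder continuity of parabolic functions -/

lemma dist_scale_le {d : ℕ} {D : ℝ} (hD : 0 < D) (x : S d D) (k : Lattice d) :
    dist (scale D k) x ≤ D⁻¹ * (d * ‖k - unscale x‖) := by
  rw [dist_eq_edist2 hD, unscale_scale hD.ne', norm_sub_rev]
  exact mul_le_mul_of_nonneg_left (edist2_le _ _) (by positivity)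

set_option maxHeartbeats 1000000 in
/-- Parabolic functions solve the equation backwards in time, and the Hölder estimate controls the
difference to the final value, so the cylinder is placed to end, in reversed time, at the earlier of
the two points. -/
lemma abs_parabolic_sub_le_of_le {d : ℕ} {G : Conductances d} {Λ M c β : ℝ}
    (h : Elliptic (fun x y => (G.C x y : ℝ)) Λ M) (hc : 0 < c) (hβ : 0 < β)
    (hH : HolderAt (fun x y => (G.C x y : ℝ)) c β) {γ : ℝ} (hγ0 : 0 < γ) (hγ1 : γ < 1)
    {D : ℝ} (hD : 0 < D) {R : ℝ} (hR : 0 < R) {x₀ : S d D} {q : ℝ≥0 × S d D → ℝ}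
    (hq : IsParabolic G q (interior (Q γ 0 x₀ (4 * R))))
    (hbdd : BddAbove ((fun z => |q z|) '' slab γ R)) {s t : ℝ≥0} (hst : s ≤ t) {x y : S d D}
    (hs : (s, x) ∈ Q γ 0 x₀ R) (ht : (t, y) ∈ Q γ 0 x₀ R) :
    |q (t, y) - q (s, x)| ≤ (c + 1) * ((d + 1) / √γ) ^ β * supNorm γ R q * R ^ (-β) *
      (|(t : ℝ) - s| ^ (1 / 2 : ℝ) + dist x y) ^ β := by
  have hD2 : 0 < D ^ 2 := by positivity
  set B := supNorm γ R q with hBdef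
  set T : ℝ := γ * (4 * R) ^ 2 with hT
  have hT0 : 0 ≤ T := by positivity
  have hB : ∀ t : ℝ≥0, (t : ℝ) ≤ T → ∀ x, |q (t, x)| ≤ B := fun t ht x =>
    le_csSup hbdd (mem_image_of_mem _ ht)
  obtain ⟨-, hs1, hs2⟩ := hs
  obtain ⟨-, ht1, ht2⟩ := ht
  simp only [NNReal.coe_zero, zero_add] at hs1 hs2 ht1 ht2
  have hgR : 0 < γ * R ^ 2 := by positivity
  have hTe : T = 16 * (γ * R ^ 2) := by rw [hT]; ring
  have hγs : 0 < √γ := Real.sqrt_pos.2 hγ0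
  have hγs1 : √γ ≤ 1 := Real.sqrt_le_one.2 hγ1.le
  have hd0 : (0 : ℝ) ≤ d := Nat.cast_nonneg d
  -- a sup norm box of radius `r` lies in a Euclidean ball of radius `R * D` in the unscaled lattice,
  -- and `r ^ 2` is at most the unscaled length in time of the cylinder of size `R`
  set r : ℝ := √γ * R * D / (d + 1) with hr
  have hr0 : 0 < r := by positivity
  have hr1 : r * (d + 1) = √γ * R * D := by rw [hr]; field_simp
  have hrD : r ≤ √γ * R * D := by nlinarith
  have hr2 : r ^ 2 ≤ γ * R ^ 2 * D ^ 2 := by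
    calc r ^ 2 ≤ (√γ * R * D) ^ 2 := by gcongr
      _ = γ * R ^ 2 * D ^ 2 := by rw [mul_pow, mul_pow, Real.sq_sqrt hγ0.le]
  have hdr : D⁻¹ * (d * r) ≤ R := by
    rw [inv_mul_le_iff₀ hD]
    have : √γ * R * D ≤ 1 * R * D := by gcongr
    nlinarith
  set N : ℝ := |(t : ℝ) - s| ^ (1 / 2 : ℝ) + dist x y with hN
  have hN0 : 0 ≤ N := by positivity
  have hts : (s : ℝ) ≤ t := by exact_mod_cast hst
  have hsqrt : |(t : ℝ) - s| ^ (1 / 2 : ℝ) = √((t : ℝ) - s) := by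
    rw [Real.sqrt_eq_rpow, abs_of_nonneg (by linarith)]
  have hsT : (s : ℝ) ≤ T := by linarith
  have htT : (t : ℝ) ≤ T := by linarith
  have hB0 : 0 ≤ B := (abs_nonneg _).trans (hB s hsT x)
  have hfin : (D * N / r) ^ β = ((d + 1) / √γ) ^ β * R ^ (-β) * N ^ β := by
    have : D * N / r = (d + 1) / √γ * R⁻¹ * N := by
      rw [hr]; field_simp
    rw [this, Real.mul_rpow (by positivity) hN0, Real.mul_rpow (by positivity) (by positivity),
      Real.inv_rpow hR.le, Real.rpow_neg hR.le]
  have key : |q (t, y) - q (s, x)| ≤ (c + 1) * (B * (D * N / r) ^ β) := by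
    rcases le_or_gt (D * N) r with hNr | hNr
    · have hy1 : ‖unscale y - unscale x‖ ≤ D * dist x y := by
        rw [dist_comm]; exact norm_unscale_sub_le hD y x
      have hNx : D * dist x y ≤ D * N := by
        have : 0 ≤ |(t : ℝ) - s| ^ (1 / 2 : ℝ) := by positivity
        gcongr; linarith
      have hNt : D * √((t : ℝ) - s) ≤ r := by
        have : D * √((t : ℝ) - s) ≤ D * N := by
          gcongr; rw [hN, hsqrt]; linarith [dist_nonneg (x := x) (y := y)]
        linarith
      have htr : D ^ 2 * ((t : ℝ) - s) ≤ r ^ 2 := by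
        calc D ^ 2 * ((t : ℝ) - s) = (D * √((t : ℝ) - s)) ^ 2 := by
              rw [mul_pow, Real.sq_sqrt (by linarith)]
          _ ≤ r ^ 2 := by gcongr
      -- the reversed time `τ` stands for the time `(E - τ) / D ^ 2`; it runs over `[0, r ^ 2]`
      set E : ℝ := D ^ 2 * s + r ^ 2 with hE
      set w := latticeFn D T q with hw
      have hwB : ∀ τ k, |w τ k| ≤ B := fun τ k => hB _ (by
        rw [Real.coe_toNNReal']; exact max_le (min_le_right _ _) hT0) _
      have hmain := abs_sub_le_of_duhamel (v := fun τ k => w (E - τ) k) h hH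
        (fun τ k => hwB _ k)
        (fun k => (measurable_latticeFn hq.2.1 k).comp (by fun_prop)) (z := unscale x)
        (r := r) (ε := γ * R ^ 2 * D ^ 2) hr0 (by positivity)
        (fun k hk τ a hτ ha hτa => by
          obtain ⟨α, hα⟩ : ∃ α, α = E - (τ + a) := ⟨_, rfl⟩
          have hα0 : 0 ≤ α := by
            have : (0 : ℝ) ≤ D ^ 2 * s := by positivity
            rw [hα, hE]; linarith
          have hαT : α + a < D ^ 2 * T := by
            have h1 : D ^ 2 * (s : ℝ) ≤ γ * R ^ 2 * D ^ 2 := by nlinarith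
            have h2 : 0 < γ * R ^ 2 * D ^ 2 := by positivity
            have h3 : D ^ 2 * T = 16 * (γ * R ^ 2 * D ^ 2) := by rw [hTe]; ring
            rw [h3, hα, hE]; linarith
          have hdist : dist (scale D k) x₀ ≤ 4 * R := by
            have h1 := dist_scale_le hD x k
            have h2 : D⁻¹ * (d * ‖k - unscale x‖) ≤ D⁻¹ * (d * r) := by
              have := (mem_box hr0.le).1 hk
              gcongr
            linarith [dist_triangle (scale D k) x x₀]
          have key := hq.duhamel hD (fun t ht x => (le_abs_self _).trans (hB t ht x)) hT0 hα0 ha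
            hαT.le (k := k) (fun σ hσ => by
              have hσT : (σ : ℝ) < T := hσ.trans_lt ((div_lt_iff₀ hD2).2 (by linarith))
              refine mem_interior.2 ⟨{σ : ℝ≥0 | (σ : ℝ) < T} ×ˢ {scale D k}, ?_, ?_, hσT, rfl⟩
              · rintro ⟨σ', k'⟩ ⟨h1, h2⟩
                have h2' : k' = scale D k := h2
                have h1' : (σ' : ℝ) < T := h1
                refine ⟨zero_le, ?_, ?_⟩
                · simp only [NNReal.coe_zero, zero_add]; exact h1'.le
                · rw [h2']; exact hdist
              · exact (isOpen_lt NNReal.continuous_coe continuous_const).prod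
                  (isOpen_singleton_S hD _))
          have e1 : E - (τ + a) = α := hα.symm
          have e2 : E - τ = α + a := by rw [hα]; ring
          have e3 : ∀ σ, E - (τ + σ) = α + a - σ := fun σ => by rw [hα]; ring
          simp only [e2, e3, add_sub_cancel_right]
          exact key)
        (θ := r ^ 2 - D ^ 2 * ((t : ℝ) - s))
        ⟨by linarith, by have : 0 ≤ D ^ 2 * ((t : ℝ) - s) := mul_nonneg hD2.le (by linarith)
                         linarith⟩
        (x := unscale y) ((mem_box hr0.le).2 (by linarith))
      have e1 : E - (r ^ 2 - D ^ 2 * ((t : ℝ) - s)) = D ^ 2 * t := by rw [hE]; ring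
      have e2 : E - r ^ 2 = D ^ 2 * s := by rw [hE]; ring
      have e3 : √(r ^ 2 - (r ^ 2 - D ^ 2 * ((t : ℝ) - s))) = D * √((t : ℝ) - s) := by
        rw [sub_sub_cancel, Real.sqrt_mul hD2.le, Real.sqrt_sq hD.le]
      simp only [e1, e2, e3] at hmain
      rw [hw, latticeFn_of_le hD htT, latticeFn_of_le hD hsT, scale_unscale hD.ne',
        scale_unscale hD.ne'] at hmain
      have h5 : D * √((t : ℝ) - s) + ‖unscale y - unscale x‖ ≤ D * N := by
        rw [hN, hsqrt, mul_add]; linarith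
      calc |q (t, y) - q (s, x)| ≤
            c * B * ((D * √((t : ℝ) - s) + ‖unscale y - unscale x‖) / r) ^ β := hmain
        _ ≤ c * B * (D * N / r) ^ β := by gcongr
        _ = c * (B * (D * N / r) ^ β) := by ring
        _ ≤ _ := by
          have : 0 ≤ B * (D * N / r) ^ β := by positivity
          nlinarith
    · have h1 := hB s hsT x
      have h2 := hB t htT y
      have h3 := hq.1 (s, x)
      have h4 := hq.1 (t, y)
      rw [abs_of_nonneg h3] at h1
      rw [abs_of_nonneg h4] at h2
      have h5 : |q (t, y) - q (s, x)| ≤ B := abs_le.2 ⟨by linarith, by linarith⟩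
      have h6 : 1 ≤ (D * N / r) ^ β :=
        Real.one_le_rpow ((one_le_div hr0).2 hNr.le) hβ.le
      have h7 : B ≤ B * (D * N / r) ^ β := le_mul_of_one_le_right hB0 h6
      nlinarith
  rw [hfin] at key
  calc _ ≤ _ := key
    _ = _ := by ring

theorem abs_parabolic_sub_le {d : ℕ} {G : Conductances d} {Λ M c β : ℝ}
    (h : Elliptic (fun x y => (G.C x y : ℝ)) Λ M) (hc : 0 < c) (hβ : 0 < β)
    (hH : HolderAt (fun x y => (G.C x y : ℝ)) c β) {γ : ℝ} (hγ0 : 0 < γ) (hγ1 : γ < 1)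
    {D : ℝ} (hD : 0 < D) {R : ℝ} (hR : 0 < R) {x₀ : S d D} {q : ℝ≥0 × S d D → ℝ}
    (hq : IsParabolic G q (interior (Q γ 0 x₀ (4 * R))))
    (hbdd : BddAbove ((fun z => |q z|) '' slab γ R)) {s t : ℝ≥0} {x y : S d D}
    (hs : (s, x) ∈ Q γ 0 x₀ R) (ht : (t, y) ∈ Q γ 0 x₀ R) :
    |q (s, x) - q (t, y)| ≤ (c + 1) * ((d + 1) / √γ) ^ β * supNorm γ R q * R ^ (-β) *
      (|(t : ℝ) - s| ^ (1 / 2 : ℝ) + dist x y) ^ β := by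
  rcases le_total s t with hst | hst
  · rw [abs_sub_comm]
    exact abs_parabolic_sub_le_of_le h hc hβ hH hγ0 hγ1 hD hR hq hbdd hst hs ht
  · rw [abs_sub_comm (t : ℝ), dist_comm]
    exact abs_parabolic_sub_le_of_le h hc hβ hH hγ0 hγ1 hD hR hq hbdd hst ht hs

end SymChain

theorem theorem4p8 (d : ℕ) (γ : ℝ) (hγ0 : 0 < γ) (hγ1 : γ < 1)
    (c₁ c₂ M₀ δ : ℝ) (φ : ℕ → ℝ) :
    ∃ c β : ℝ, 0 < c ∧ 0 < β ∧
      ∀ G : SymChain.Conductances d, G.A1 c₁ c₂ → G.A2 M₀ δ → G.A3 φ → ∀ D : ℝ, 1 ≤ D →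
        (∀ (R : ℝ) (x₀ : SymChain.S d D) (q : ℝ≥0 × SymChain.S d D → ℝ), 0 < R →
          SymChain.IsParabolic G q (interior (SymChain.Q γ 0 x₀ (4 * R))) →
          BddAbove ((fun z => |q z|) '' SymChain.slab γ R) →
          ∀ (s t : ℝ≥0) (x y : SymChain.S d D),
            (s, x) ∈ SymChain.Q γ 0 x₀ R → (t, y) ∈ SymChain.Q γ 0 x₀ R →
            |q (s, x) - q (t, y)| ≤ c * SymChain.supNorm γ R q * R ^ (-β) *
              (|(t : ℝ) - s| ^ (1 / 2 : ℝ) + dist x y) ^ β) ∧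
        (∀ (t₀ : ℝ), 0 < t₀ → t₀ < 1 →
          ∀ (s t : ℝ≥0), t₀ ≤ s → t₀ ≤ t →
          ∀ (x₁ x₂ y₁ y₂ : SymChain.S d D),
            |SymChain.heatKernel G D s x₁ y₁ - SymChain.heatKernel G D t x₂ y₂| ≤
              c * t₀ ^ (-((d : ℝ) + β) / 2) *
                (|(t : ℝ) - s| ^ (1 / 2 : ℝ) + dist x₁ x₂ + dist y₁ y₂) ^ β) := by
  rcases Nat.eq_zero_or_pos d with rfl | hd
  · -- There are no conductances on a point: `C_{xx} = 0` contradicts `ν_x > 0`.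
    refine ⟨1, 1, one_pos, one_pos, fun G => absurd (G.pos 0) ?_⟩
    rw [show (∑' y, G.C 0 y) = 0 from ?_]
    · exact lt_irrefl 0
    · refine (tsum_congr fun y => ?_).trans tsum_zero
      rw [Subsingleton.elim y 0, G.diag]
  obtain ⟨Λ, hΛ, hell⟩ := SymChain.exists_elliptic d c₁ c₂ M₀ δ φ
  obtain ⟨c, β, hc, hβ, hH⟩ := SymChain.exists_holder d hΛ M₀
  obtain ⟨c', hc', hdiag⟩ := SymChain.exists_onDiagonal d hd hΛ
  set A₁ : ℝ := (c + 1) * ((d + 1) / √γ) ^ β with hA₁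
  set A₂ : ℝ := 2 * ((c + 1) * c') * 2 ^ (((d : ℝ) + β) / 2) with hA₂
  have hγs : 0 < √γ := Real.sqrt_pos.2 hγ0
  have hA₁0 : 0 < A₁ := by positivity
  have hA₂0 : 0 < A₂ := by positivity
  refine ⟨max A₁ A₂, β, lt_max_of_lt_left hA₁0, hβ, ?_⟩
  intro G h1 h2 h3 D hD1
  have hD : 0 < D := by linarith
  have hG := hell G h1 h2 h3
  have hν : ∀ x, (G.nu x : ℝ) ≤ c₂ := fun x => (h1.2.2 x).2
  have hHG : SymChain.HolderAt (fun x y => (G.C x y : ℝ)) c β := hH _ hG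
  refine ⟨fun R x₀ q hR hq hbdd s t x y hs ht => ?_, fun t₀ ht₀ _ s t hs ht x₁ x₂ y₁ y₂ => ?_⟩
  · refine (SymChain.abs_parabolic_sub_le hG hc hβ hHG hγ0 hγ1 hD hR hq hbdd hs ht).trans ?_
    have hsup : 0 ≤ SymChain.supNorm γ R q := by
      refine Real.sSup_nonneg ?_
      rintro _ ⟨z, -, rfl⟩
      exact abs_nonneg _
    gcongr
    exact le_max_left _ _
  · have hdiagG : ∀ t, 0 < t → ∀ x y, G.transition t x y ≤ c' * t ^ (-(d : ℝ) / 2) :=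
      fun t ht x y => hdiag _ _ hG (fun t x => G.transition t x y)
        (fun a b A ha => G.transition_sol hν hG y a b A ha)
        (fun t _ x => G.transition_nonneg t x y)
        (fun t ht A => G.sum_transition_le_one hν ht y A) t ht x
    refine (SymChain.abs_heatKernel_sub_le G hν hG hc hβ hc' hHG hdiagG hD ht₀ hs ht
      x₁ x₂ y₁ y₂).trans ?_
    gcongr
    exact le_max_right _ _
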